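/- For a parameter $c$ let $f_c(z)=z^2+c$; for a map $T$ of a set to itself, its graph has an edge $x\to T(x)$ for every $x$. For $N\ge 1$ let $r(N)=\frac1N\sum_{n\mid N}\mu(N/n)2^n$. A finite directed graph is *admissible* if every vertex has out-degree $1$ and in-degree $0$ or $2$ and, for every $N\ge 2$, it contains at most $r(N)$ cycles of length $N$. A set of vertices of an admissible graph $G$ *generates* $G$ if no proper admissible subgraph of $G$ contains it. Let $G$ be an admissible graph and $\{P_1,\dots,P_n\}$ a generating set of $G$ with the least possible number of elements. Let $U_1(G)(\mathbb C)$ be the set of all $(\alpha_1,\dots,\alpha_n,c)\in\mathbb C^{n+1}$ such that the smallest admissible subgraph of the graph of $f_c$ on $\mathbb C$ containing $\alpha_1,\dots,\alpha_n$ exists and is isomorphic to $G$ by an isomorphism with $P_i\mapsto\alpha_i$. Let $Y_1(G)$ be the Zariski closure of $U_1(G)(\mathbb C)$ in $\mathbb A^{n+1}$, as a variety over $\mathbb Q$, and let $X_1(G)$ be the normalization of the projective closure of $Y_1(G)$. Consider the following six admissible graphs. - 8(1,1)a: two fixed points $p,q$, their nonperiodic preimages $p',q'$, two preimages of $p'$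 and two preimages of $q'$. - 8(1,1)b: two fixed points $p,q$, their nonperiodic preimages $p',q'$, two preimages $u,v$ of $p'$, and two preimages of $u$. - 8(2)a: a 2-cycle $\{p,q\}$, the nonperiodic preimages $p'$ of $q$ and $q'$ of $p$, two preimages of $p'$ and two preimages of $q'$. - 8(2)b: a 2-cycle $\{p,q\}$, the nonperiodic preimages $p'$ of $q$ and $q'$ of $p$, two preimages $u,v$ of $p'$, and two preimages of $u$. - 10(2,1,1)a: a 2-cycle $\{p,q\}$, the nonperiodic preimages $p'$ of $q$ and $q'$ of $p$, two preimages of $p'$, and two fixed points with their nonperiodic preimages. - 10(2,1,1)b: two fixed points $p,q$, their nonperiodic preimages $p',q'$, two preimages of $p'$, and a 2-cycle with the nonperiodic preimages of its two points. **Theorem.** For each of these six graphs $G$ and each minimal generating set of $G$, the curve $X_1(G)$ is isomorphic over $\mathbb Q$ to the elliptic curve named below. Let $d$ be a squarefree integer and $K=\mathbb Q(\sqrt d)$. With the group structure of that elliptic curve, the torsion subgroup of $X_1(G)(K)$ is as follows. - (11A3: $y^2+y=x^3-x^2$) If $G$ is 8(1,1)b or 8(2)b, then $X_1(G)(K)_{\mathrm{tors}}\cong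 \mathbb Z/5\mathbb Z$. - (15A8: $y^2+xy+y=x^3+x^2$) If $G$ is 10(2,1,1)b, then $X_1(G)(K)_{\mathrm{tors}}\cong \mathbb Z/2\mathbb Z\oplus\mathbb Z/4\mathbb Z$ if $d=-15$; $\mathbb Z/8\mathbb Z$ if $d\in\{-3,5\}$; $\mathbb Z/4\mathbb Z$ otherwise. - (17A4: $y^2+xy+y=x^3-x^2-x$) If $G$ is 10(2,1,1)a, then $X_1(G)(K)_{\mathrm{tors}}\cong \mathbb Z/2\mathbb Z\oplus\mathbb Z/4\mathbb Z$ if $d=17$; $\mathbb Z/4\mathbb Z$ otherwise. - (24A4: $y^2=x^3-x^2+x$) If $G$ is 8(1,1)a, then $X_1(G)(K)_{\mathrm{tors}}\cong \mathbb Z/2\mathbb Z\oplus\mathbb Z/4\mathbb Z$ if $d=-3$; $\mathbb Z/8\mathbb Z$ if $d\in\{-1,3\}$; $\mathbb Z/4\mathbb Z$ otherwise. - (40A3: $y^2=(x-1)(x^2+x-1)$) If $G$ is 8(2)a, then $X_1(G)(K)_{\mathrm{tors}}\cong \mathbb Z/2\mathbb Z\oplus\mathbb Z/4\mathbb Z$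 if $d=5$; $\mathbb Z/4\mathbb Z$ otherwise. -/

import Mathlib

/-! ### Admissible graphs

A finite directed graph in which every vertex has out-degree `1` is given by its successor map
`T`, with an edge `x → T x` for every vertex `x`.  -/

namespace DynModCurve

/-- The number `d(N) = ∑_{n ∣ N} μ(N/n) 2^n` of points of period `N` of a generic quadratic
polynomial; the number of `N`-cycles of such a polynomial is `r(N) = d(N) / N`. -/
def periodCount (N : ℕ) : ℤ :=
  ∑ n ∈ N.divisors, ArithmeticFunction.moebius (N / n) * 2 ^ n

/-- The vertex set `S` spans an admissible subgraph of the graph of the map `T : X → X`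
(the graph on `X` with the edges `x → T x`): it is finite, every vertex has out-degree `1` and
in-degree `0` or `2` in it, and for `N ≥ 2` it contains at most `r(N)` cycles of length `N`, that
is, at most `N * r(N) = d(N)` vertices of exact period `N`. -/
structure IsAdmissible {X : Type*} (T : X → X) (S : Set X) : Prop where
  finite : S.Finite
  mapsTo : Set.MapsTo T S S
  inDegree : ∀ y ∈ S, {x ∈ S | T x = y}.ncard = 0 ∨ {x ∈ S | T x = y}.ncard = 2
  cycles : ∀ N : ℕ, 2 ≤ N →
    (({x ∈ S | Function.minimalPeriod T x = N}.ncard : ℕ) : ℤ) ≤ periodCount N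

/-- `H` is the vertex set of the smallest admissible subgraph of the graph of `T` that contains
all the points of the family `P`. -/
def Generates {X : Type*} (T : X → X) {n : ℕ} (P : Fin n → X) (H : Set X) : Prop :=
  IsLeast {S : Set X | IsAdmissible T S ∧ ∀ i, P i ∈ S} H

/-- The family `P` is a minimal generating set of the whole graph of `T`: it generates it, and
every other generating set has at least as many elements. -/
def IsMinimalGenerating {V : Type*} (T : V → V) {n : ℕ} (P : Fin n → V) : Prop :=
  Generates T P Set.univ ∧
    ∀ (m : ℕ) (Q : Fin m → V), Generates T Q Set.univ → n ≤ m

/-! ### Dynamical modular curves -/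

/-- The quadratic polynomial map `f_c(z) = z ^ 2 + c`. -/
def quadMap {L : Type*} [Field L] (c z : L) : L := z ^ 2 + c

/-- The set `U₁(G)(L)`, where `G` is the graph of `T : V → V` with minimal generating set
`P 0, …, P (n-1)`: all tuples `(α_0, …, α_{n-1}, c)` in `L` (the coordinate `some i` is `α_i` and
the coordinate `none` is `c`) such that the smallest admissible subgraph of the graph of `f_c` on
`L` that contains all the `α_i` exists and is isomorphic to `G` via an isomorphism `φ` that sends
`P i` to `α_i`.  (The points of a finite subgraph with out-degrees `1` are preperiodic.) -/
def U1 {V : Type*} (T : V → V) {n : ℕ} (P : Fin n → V) (L : Type*) [Field L] :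
    Set (Option (Fin n) → L) :=
  {z | ∃ φ : V → L, Function.Injective φ ∧ (∀ v, φ (T v) = quadMap (z none) (φ v)) ∧
    (∀ i, φ (P i) = z (some i)) ∧
    Generates (quadMap (z none)) (fun i => z (some i)) (Set.range φ)}

/-- The coordinate ring over `ℚ` of the Zariski closure `Y₁(G)` of `U₁(G)(ℂ)` in affine
space. -/
abbrev CoordinateRing {V : Type*} (T : V → V) {n : ℕ} (P : Fin n → V) : Type :=
  MvPolynomial (Option (Fin n)) ℚ ⧸ MvPolynomial.vanishingIdeal ℚ (U1 T P ℂ)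

/-- The function field over `ℚ` of `Y₁(G)`, which is also that of `X₁(G)`, the normalization of
the projective closure of `Y₁(G)`. -/
abbrev FunctionField {V : Type*} (T : V → V) {n : ℕ} (P : Fin n → V) : Type :=
  FractionRing (CoordinateRing T P)

/-- `E` is an elliptic curve over `ℚ` and `X₁(G)` is isomorphic to `E` over `ℚ`, for every choice
of the minimal generating set used to construct `X₁(G)` (and there is such a set).  Both curves are normal projective curves
over `ℚ`, so they are isomorphic over `ℚ` if and only if their function fields are isomorphic as
`ℚ`-algebras. -/
def IsIsomorphicTo {V : Type*} (T : V → V) (E : WeierstrassCurve ℚ) : Prop :=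
  E.IsElliptic ∧ (∃ (n : ℕ) (P : Fin n → V), IsMinimalGenerating T P) ∧
    ∀ (n : ℕ) (P : Fin n → V), IsMinimalGenerating T P →
      Nonempty (FunctionField T P ≃ₐ[ℚ] E.toAffine.FunctionField)

/-! ### The six graphs, each by its successor map -/

/-- The graph 8(1,1)a: fixed points `0`, `2`, with nonperiodic preimages `1`, `3`; the vertices
`4`, `5` are the preimages of `1`, and `6`, `7` are the preimages of `3`. -/
def graph8_11a : Fin 8 → Fin 8 := ![0, 0, 2, 2, 1, 1, 3, 3]

/-- The graph 8(1,1)b: fixed points `0`, `2`, with nonperiodic preimages `1`, `3`; the vertices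
`4`, `5` are the preimages of `1`, and `6`, `7` are the preimages of `4`. -/
def graph8_11b : Fin 8 → Fin 8 := ![0, 0, 2, 2, 1, 1, 4, 4]

/-- The graph 8(2)a: a 2-cycle `0`, `1`, with nonperiodic preimages `2` of `1` and `3` of `0`;
the vertices `4`, `5` are the preimages of `2`, and `6`, `7` are the preimages of `3`. -/
def graph8_2a : Fin 8 → Fin 8 := ![1, 0, 1, 0, 2, 2, 3, 3]

/-- The graph 8(2)b: a 2-cycle `0`, `1`, with nonperiodic preimages `2` of `1` and `3` of `0`;
the vertices `4`, `5` are the preimages of `2`, and `6`, `7` are the preimages of `4`. -/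
def graph8_2b : Fin 8 → Fin 8 := ![1, 0, 1, 0, 2, 2, 4, 4]

/-- The graph 10(2,1,1)a: a 2-cycle `0`, `1`, with nonperiodic preimages `2` of `1` and `3` of
`0`; the vertices `4`, `5` are the preimages of `2`; fixed points `6`, `8`, with nonperiodic
preimages `7`, `9`. -/
def graph10_211a : Fin 10 → Fin 10 := ![1, 0, 1, 0, 2, 2, 6, 6, 8, 8]

/-- The graph 10(2,1,1)b: fixed points `0`, `2`, with nonperiodic preimages `1`, `3`; the vertices
`4`, `5` are the preimages of `1`; a 2-cycle `6`, `7`, with nonperiodic preimages `8` of `7` and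
`9` of `6`. -/
def graph10_211b : Fin 10 → Fin 10 := ![0, 0, 2, 2, 1, 1, 7, 6, 7, 6]

/-! ### The elliptic curves, by their Cremona labels -/

/-- The elliptic curve 11A3: `y² + y = x³ - x²`. -/
def curve11A3 : WeierstrassCurve ℚ := ⟨0, -1, 1, 0, 0⟩

/-- The elliptic curve 15A8: `y² + xy + y = x³ + x²`. -/
def curve15A8 : WeierstrassCurve ℚ := ⟨1, 1, 1, 0, 0⟩

/-- The elliptic curve 17A4: `y² + xy + y = x³ - x² - x`. -/
def curve17A4 : WeierstrassCurve ℚ := ⟨1, -1, 1, -1, 0⟩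

/-- The elliptic curve 24A4: `y² = x³ - x² + x`. -/
def curve24A4 : WeierstrassCurve ℚ := ⟨0, -1, 0, 1, 0⟩

/-- The elliptic curve 40A3: `y² = (x - 1)(x² + x - 1) = x³ - 2x + 1`. -/
def curve40A3 : WeierstrassCurve ℚ := ⟨0, 0, 0, -2, 1⟩

/-- The torsion subgroup of the group `E(K)` of `K`-rational points of `E`. -/
abbrev Torsion (E : WeierstrassCurve ℚ) (K : Type*) [Field K] [Algebra ℚ K] [DecidableEq K] :
    AddSubgroup (E.baseChange K).toAffine.Point :=
  AddCommGroup.torsion (E.baseChange K).toAffine.Point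

end DynModCurve

/-!
# Six dynamical modular curves of genus one and their torsion over quadratic fields

**The isomorphisms.** By the definition of the smallest admissible subgraph, `U₁(G)` consists of the
points `(φ(P₁), …, φ(Pₙ), c)` for the injective maps `φ` from the vertices of `G` to `ℂ` that
commute with the dynamics (`mem_U1_iff`). As the two preimages of a point under `f_c` are opposite,
the values of `φ` at a generating set determine all the others polynomially, so that the function
field does not depend on the generating set, and it is enough to find a generic point of the family
of all `(φ, c)` (`nonempty_functionField_algEquiv`).

For each of the six graphs, fixed points and 2-cycles have coordinates `1/2 ± ρ` and `-1/2 ± σ`, and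
all vertices except the last pair of square roots `±w` lie on a conic of the form
`(α - β) (α + β) = 1`. With `t = α - β` all of them are Laurent polynomials in `t`, and `s = 2 t w`
satisfies `s² = q(t)` for a monic quartic `q` with `q(0) = 1`. Completing the square of the quartic,
that is, setting `s = m - t² - a t / 2` with a multiple of the elliptic coordinate `x` for `m` up to
a constant, turns `s² = q(t)` into the Weierstrass equation (`isIsomorphicTo_of_quartic`,
`exists_generators`).

**Torsion of the curves with a rational point of order `2`.** The four curves 15A8, 17A4, 24A4, 40A3
have the form `η² = 4 X (X² + A X + 1)` with `A = -7/4, 9/4, -1, 3` (`IsModel`), for which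
`X(2P) η² = (X² - 1)²`. There is no torsion of odd order: at a prime above `2`, a non-integral
`X` grows in absolute value under doubling, hence never occurs at a point of odd order, while a
short computation modulo that prime, or modulo a small power of it, shows that an infinite sequence
of doublings cannot stay integral (`false_of_doubling_of_odd`, `false_of_doubling_of_four_mul_odd`). The
`2`-primary torsion is then found by successive halving, starting from the points with `X = ±1`,
whose double is `(0, 0)`: halving `X = k` amounts to solving quadratic equations, and it is decided
over `ℚ(√d)` which of them have solutions, by means of the criteria that a square has square norm
and that a squarefree integer is a square in `ℚ(√d)` only if it is `1` or `d`
(`isSquare_norm_of_sq`, `eq_one_or_eq_of_sq`). A subgroup that is closed under halving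
contains all the torsion (`torsion_le_of_half_mem`).

**Torsion of 11A3.** There is no point of order `2` over a quadratic field, since the relevant cubic
has no rational root. So all torsion points have odd order, and are integral at a prime above `2`
by the same growth argument. Their reductions lie in the group of points over `𝔽₄`, which consists
of the origin and of four points with `x = 0` or `x = 1`; and two points with the same reduction are
equal, as their difference would not be integral otherwise. This leaves the five multiples
of `(0, 0)` (`torsion_curve11A3Over`).
-/

/-! ### Admissible graphs and function fields -/

namespace DynModCurve

open Polynomial

lemma periodCount_nonneg {N : ℕ} (hN : 1 ≤ N) : 0 ≤ periodCount N := by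
  have h0 : N ∉ N.properDivisors := by simp
  have hsub : ∑ n ∈ N.properDivisors, (2 : ℤ) ^ n ≤ 2 ^ N - 1 := by
    have h1 : ∑ n ∈ N.properDivisors, (2 : ℤ) ^ n ≤ ∑ n ∈ Finset.range N, (2 : ℤ) ^ n := by
      apply Finset.sum_le_sum_of_subset_of_nonneg
      · intro n hn
        rw [Finset.mem_range]
        exact (Nat.mem_properDivisors.1 hn).2
      · intros; positivity
    have h2 := mul_geom_sum (2 : ℤ) N
    linarith
  have hmu : -∑ n ∈ N.properDivisors, (2 : ℤ) ^ n ≤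
      ∑ n ∈ N.properDivisors, ArithmeticFunction.moebius (N / n) * 2 ^ n := by
    rw [← Finset.sum_neg_distrib]
    apply Finset.sum_le_sum
    intro n _
    have h3 : |ArithmeticFunction.moebius (N / n)| ≤ 1 := ArithmeticFunction.abs_moebius_le_one
    have h4 := (abs_le.1 h3).1
    have h5 : (0 : ℤ) < 2 ^ n := by positivity
    nlinarith
  rw [periodCount, ← Nat.cons_self_properDivisors (by omega), Finset.sum_cons]
  rw [Nat.div_self (by omega)]
  simp only [ArithmeticFunction.moebius_apply_one, one_mul]
  linarith

/-- The whole graph of `T` is admissible if its in-degrees are `0` or `2`, every third iterate is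
a point of period dividing `2`, and at most two points have exact period `2`. -/
lemma isAdmissible_univ {V : Type*} [Fintype V] [DecidableEq V] (T : V → V)
    (hin : ∀ y, (Finset.univ.filter fun x => T x = y).card = 0 ∨
      (Finset.univ.filter fun x => T x = y).card = 2)
    (h2 : (Finset.univ.filter fun x => T (T x) = x ∧ T x ≠ x).card ≤ 2)
    (hper : ∀ x, T (T (T (T (T x)))) = T (T (T x))) : IsAdmissible T Set.univ where
  finite := Set.finite_univ
  mapsTo _ _ := Set.mem_univ _
  inDegree y _ := by
    have : {x ∈ Set.univ | T x = y} = ↑(Finset.univ.filter fun x => T x = y) := by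
      ext; simp
    rw [this, Set.ncard_coe_finset]
    exact hin y
  cycles N hN := by
    have hT2 : ∀ x, Function.minimalPeriod T x = N → T (T x) = x := by
      intro x hx
      have hp : T^[N * 3] x = x :=
        (hx ▸ Function.isPeriodicPt_minimalPeriod T x).mul_const 3
      have h5 : T^[N * 3] x = T^[N * 3 - 3] (T (T (T x))) := by
        rw [show T (T (T x)) = T^[3] x from rfl, ← Function.iterate_add_apply,
          show N * 3 - 3 + 3 = N * 3 by omega]
      have h6 : T^[N * 3 - 3] (T (T (T (T (T x))))) = T (T (T^[N * 3] x)) := by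
        rw [show T (T (T (T (T x)))) = T^[5] x from rfl,
          show T (T (T^[N * 3] x)) = T^[2] (T^[N * 3] x) from rfl, ← Function.iterate_add_apply,
          ← Function.iterate_add_apply, show N * 3 - 3 + 5 = 2 + N * 3 by omega]
      rw [hper, ← h5, hp] at h6
      exact h6.symm
    rcases hN.lt_or_eq with hN3 | rfl
    · have : {x ∈ Set.univ | Function.minimalPeriod T x = N} = ∅ := by
        rw [Set.eq_empty_iff_forall_notMem]
        rintro x ⟨-, hx⟩
        have h : Function.IsPeriodicPt T 2 x := hT2 x hx
        have := h.minimalPeriod_le (by norm_num)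
        omega
      rw [this]
      simpa using periodCount_nonneg (by omega)
    · have hsub : {x ∈ Set.univ | Function.minimalPeriod T x = 2} ⊆
          ↑(Finset.univ.filter fun x => T (T x) = x ∧ T x ≠ x) := by
        rintro x ⟨-, hx⟩
        simp only [Finset.coe_filter, Finset.mem_univ, true_and, Set.mem_ofPred_eq]
        refine ⟨hT2 x hx, fun h => ?_⟩
        have := Function.minimalPeriod_eq_one_iff_isFixedPt.2 h
        omega
      have hle := Set.ncard_le_ncard hsub (Finset.finite_toSet _)
      rw [Set.ncard_coe_finset] at hle
      have hp : periodCount 2 = 2 := by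
        rw [periodCount, Nat.Prime.divisors Nat.prime_two]
        simp [ArithmeticFunction.moebius_apply_prime Nat.prime_two]
      rw [hp]
      exact_mod_cast hle.trans h2

/-- A set that is closed under `T` and under passing to the other preimage of the image of one
of its points is admissible. -/
lemma IsAdmissible.of_closed {V : Type*} {T : V → V} (hT : IsAdmissible T Set.univ) {S : Set V}
    (hS : Set.MapsTo T S S) (hsib : ∀ x ∈ S, ∀ y, T y = T x → y ∈ S) : IsAdmissible T S where
  finite := hT.finite.subset (Set.subset_univ _)
  mapsTo := hS
  inDegree y _ := by
    rcases Set.eq_empty_or_nonempty {x ∈ S | T x = y} with h | ⟨x, hx, rfl⟩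
    · left; rw [h]; simp
    · have : {z ∈ S | T z = T x} = {z ∈ Set.univ | T z = T x} := by
        ext z; simp only [Set.mem_ofPred_eq, Set.mem_univ, true_and, and_iff_right_iff_imp]
        exact hsib x hx z
      rw [this]
      exact hT.inDegree _ (Set.mem_univ _)
  cycles N hN := by
    refine le_trans ?_ (hT.cycles N hN)
    have hf : {x ∈ Set.univ | Function.minimalPeriod T x = N}.Finite :=
      hT.finite.subset (Set.subset_univ _)
    have hsub : {x ∈ S | Function.minimalPeriod T x = N} ⊆
        {x ∈ Set.univ | Function.minimalPeriod T x = N} := fun x hx => ⟨Set.mem_univ _, hx.2⟩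
    exact_mod_cast Set.ncard_le_ncard hsub hf

lemma Generates.eq_univ {V : Type*} {T : V → V} {n : ℕ} {P : Fin n → V}
    (hP : Generates T P Set.univ) {S : Set V} (hS : IsAdmissible T S) (h : ∀ i, P i ∈ S) :
    S = Set.univ :=
  Set.univ_subset_iff.1 (hP.2 ⟨hS, h⟩)

lemma exists_isMinimalGenerating {V : Type*} {T : V → V} (hT : IsAdmissible T Set.univ) :
    ∃ (n : ℕ) (P : Fin n → V), IsMinimalGenerating T P := by
  classical
  have hex : ∃ n : ℕ, ∃ P : Fin n → V, Generates T P Set.univ := by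
    have := Set.finite_univ_iff.1 hT.finite
    obtain ⟨n, ⟨e⟩⟩ := Finite.exists_equiv_fin V
    refine ⟨n, e.symm, ⟨hT, fun _ => Set.mem_univ _⟩, fun S hS x _ => ?_⟩
    simpa using hS.2 (e x)
  obtain ⟨P, hP⟩ := Nat.find_spec hex
  exact ⟨Nat.find hex, P, hP, fun m Q hQ => Nat.find_min' hex ⟨Q, hQ⟩⟩

lemma minimalPeriod_comp {V L : Type*} {T : V → V} {f : L → L} {φ : V → L}
    (hφ : Function.Injective φ) (h : ∀ v, φ (T v) = f (φ v)) (v : V) :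
    Function.minimalPeriod f (φ v) = Function.minimalPeriod T v := by
  have hit : ∀ n : ℕ, φ (T^[n] v) = f^[n] (φ v) := fun n =>
    (Function.Semiconj.iterate_right (f := φ) (fun x => h x) n).eq v
  apply Nat.dvd_antisymm
  · rw [← Function.isPeriodicPt_iff_minimalPeriod_dvd]
    show f^[_] (φ v) = φ v
    rw [← hit]
    exact congrArg φ (Function.isPeriodicPt_minimalPeriod T v)
  · rw [← Function.isPeriodicPt_iff_minimalPeriod_dvd]
    apply hφ
    rw [hit]
    exact Function.isPeriodicPt_minimalPeriod f (φ v)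

lemma ncard_quadMap_preimage_le {L : Type*} [Field L] (c y : L) :
    {x : L | quadMap c x = y}.Finite ∧ {x : L | quadMap c x = y}.ncard ≤ 2 := by
  rcases Set.eq_empty_or_nonempty {x : L | quadMap c x = y} with h | ⟨w, hw⟩
  · rw [h]; simp
  · have hsub : {x : L | quadMap c x = y} ⊆ {w, -w} := by
      intro x hx
      have h : x ^ 2 = w ^ 2 :=
        add_right_cancel ((hx : x ^ 2 + c = y).trans (hw : w ^ 2 + c = y).symm)
      exact sq_eq_sq_iff_eq_or_eq_neg.1 h
    have hfin : ({w, -w} : Set L).Finite := Set.toFinite _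
    refine ⟨hfin.subset hsub, (Set.ncard_le_ncard hsub hfin).trans ?_⟩
    exact (Set.ncard_insert_le _ _).trans (by simp)

/-- An injective equivariant map into the graph of `f_c` embeds the graph generated by `P`. -/
lemma mem_U1_iff {V : Type*} {T : V → V} (hT : IsAdmissible T Set.univ) {n : ℕ} {P : Fin n → V}
    (hP : Generates T P Set.univ) {L : Type*} [Field L] (z : Option (Fin n) → L) :
    z ∈ U1 T P L ↔ ∃ φ : V → L, Function.Injective φ ∧
      (∀ v, φ (T v) = quadMap (z none) (φ v)) ∧ ∀ i, φ (P i) = z (some i) := by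
  constructor
  · rintro ⟨φ, h1, h2, h3, -⟩
    exact ⟨φ, h1, h2, h3⟩
  rintro ⟨φ, hinj, heq, hz⟩
  refine ⟨φ, hinj, heq, hz, ⟨⟨?_, ?_, ?_, ?_⟩, ?_⟩, ?_⟩
  · have := Set.finite_univ_iff.1 hT.finite
    exact Set.finite_range φ
  · rintro _ ⟨v, rfl⟩
    exact ⟨T v, heq v⟩
  · rintro _ ⟨v, rfl⟩
    have : {x ∈ Set.range φ | quadMap (z none) x = φ v} = φ '' {x ∈ Set.univ | T x = v} := by
      ext x
      constructor
      · rintro ⟨⟨w, rfl⟩, hw⟩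
        exact ⟨w, ⟨trivial, hinj (by rw [heq, hw])⟩, rfl⟩
      · rintro ⟨w, ⟨-, rfl⟩, rfl⟩
        exact ⟨⟨w, rfl⟩, (heq w).symm⟩
    rw [this, Set.ncard_image_of_injective _ hinj]
    exact hT.inDegree v trivial
  · intro N hN
    have : {x ∈ Set.range φ | Function.minimalPeriod (quadMap (z none)) x = N} =
        φ '' {x ∈ Set.univ | Function.minimalPeriod T x = N} := by
      ext x
      constructor
      · rintro ⟨⟨w, rfl⟩, hw⟩
        exact ⟨w, ⟨trivial, by rwa [minimalPeriod_comp hinj heq] at hw⟩, rfl⟩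
      · rintro ⟨w, ⟨-, hw⟩, rfl⟩
        exact ⟨⟨w, rfl⟩, by rwa [minimalPeriod_comp hinj heq]⟩
    rw [this, Set.ncard_image_of_injective _ hinj]
    exact hT.cycles N hN
  · exact fun i => ⟨P i, hz i⟩
  · rintro S ⟨hS, hSP⟩
    have hadm : IsAdmissible T (φ ⁻¹' S) := by
      refine hT.of_closed ?_ ?_
      · intro v hv
        show φ (T v) ∈ S
        rw [heq]
        exact hS.mapsTo hv
      · intro x hx y hxy
        by_contra hy
        -- the fibre of `S` through `φ x` has two points, and `φ y` would be a third one
        have hfib := ncard_quadMap_preimage_le (z none) (φ (T x))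
        have hss : {w ∈ S | quadMap (z none) w = φ (T x)} ⊂
            {w | quadMap (z none) w = φ (T x)} := by
          refine ⟨fun w hw => hw.2, fun hsub => hy (hsub (a := φ y) ?_).1⟩
          show quadMap (z none) (φ y) = _
          rw [← heq, hxy]
        have hlt := Set.ncard_lt_ncard hss hfib.1
        have hmem : φ (T x) ∈ S := by rw [heq]; exact hS.mapsTo hx
        have hne : {w ∈ S | quadMap (z none) w = φ (T x)}.ncard ≠ 0 := by
          intro h0
          rw [Set.ncard_eq_zero (hfib.1.subset hss.1)] at h0
          exact (h0 ▸ (⟨hx, (heq x).symm⟩ : φ x ∈ {w ∈ S | quadMap (z none) w = φ (T x)}) :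
            φ x ∈ (∅ : Set L))
        rcases hS.inDegree _ hmem with h | h
        · exact hne h
        · have := hfib.2
          omega
    have := hP.eq_univ hadm fun i => by
      show φ (P i) ∈ S
      rw [hz]; exact hSP i
    rintro _ ⟨v, rfl⟩
    have hv : v ∈ φ ⁻¹' S := this ▸ Set.mem_univ v
    exact hv

/-- The values of an equivariant map at a generating set, together with `c`, generate all
values, since two preimages of the same point have opposite values. -/
lemma mem_of_generates {V : Type*} {T : V → V} (hT : IsAdmissible T Set.univ) {n : ℕ}
    {P : Fin n → V} (hP : Generates T P Set.univ) {L : Type*} [Field L] [Algebra ℚ L] {φ : V → L}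
        {c : L}
    (heq : ∀ v, φ (T v) = quadMap c (φ v)) (B : Subalgebra ℚ L) (hc : c ∈ B)
    (hB : ∀ i, φ (P i) ∈ B) (v : V) : φ v ∈ B := by
  have hadm : IsAdmissible T (φ ⁻¹' (B : Set L)) := by
    refine hT.of_closed ?_ ?_
    · intro w hw
      show φ (T w) ∈ B
      rw [heq]
      exact B.add_mem (B.pow_mem hw 2) hc
    · intro x hx y hxy
      have h : φ y ^ 2 = φ x ^ 2 := by
        have h1 := heq x
        have h2 := heq y
        rw [hxy] at h2
        simp only [quadMap] at h1 h2
        linear_combination h1 - h2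
      show φ y ∈ B
      rcases sq_eq_sq_iff_eq_or_eq_neg.1 h with h | h
      · rw [h]; exact hx
      · rw [h]; exact B.neg_mem hx
  have hv : v ∈ φ ⁻¹' (B : Set L) := (hP.eq_univ hadm hB) ▸ Set.mem_univ v
  exact hv

/-- If `φ : V → F` and `c` form a generic point of the family of all complex realisations of the
graph and generate `F`, then `F` is the function field, whichever generating set is used. -/
theorem nonempty_functionField_algEquiv {V : Type*} {T : V → V} (hT : IsAdmissible T Set.univ)
    {F : Type} [Field F] [Algebra ℚ F] (φ : V → F) (c : F) (heq : ∀ v, φ (T v) = quadMap c (φ v))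
    (hgen : IntermediateField.adjoin ℚ (insert c (Set.range φ)) = ⊤)
    (hspec : ∀ p : MvPolynomial (Option V) ℚ,
      MvPolynomial.aeval (fun o : Option V => o.elim c φ) p = 0 ↔
        ∀ (ψ : V → ℂ) (b : ℂ), Function.Injective ψ → (∀ v, ψ (T v) = quadMap b (ψ v)) →
          MvPolynomial.aeval (fun o : Option V => o.elim b ψ) p = 0)
    {n : ℕ} {P : Fin n → V} (hP : Generates T P Set.univ) :
    Nonempty (FunctionField T P ≃ₐ[ℚ] F) := by
  let j₀ : MvPolynomial (Option (Fin n)) ℚ →ₐ[ℚ] F :=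
    MvPolynomial.aeval fun o : Option (Fin n) => o.elim c (φ ∘ P)
  have hj₀ : ∀ f, f ∈ MvPolynomial.vanishingIdeal ℚ (U1 T P ℂ) ↔ j₀ f = 0 := by
    intro f
    have hren : ∀ (L : Type) [Field L] [Algebra ℚ L] (b : L) (ψ : V → L),
        MvPolynomial.aeval (fun o : Option V => o.elim b ψ) (MvPolynomial.rename (Option.map P) f) =
          MvPolynomial.aeval (fun o : Option (Fin n) => o.elim b (ψ ∘ P)) f := by
      intro L _ _ b ψ
      rw [MvPolynomial.aeval_rename]
      congr 2
      ext o
      cases o <;> rfl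
    rw [MvPolynomial.mem_vanishingIdeal_iff]
    show _ ↔ MvPolynomial.aeval (fun o : Option (Fin n) => o.elim c (φ ∘ P)) f = 0
    rw [← hren F, hspec]
    constructor
    · intro h ψ b hψ hb
      rw [hren ℂ]
      refine h _ ((mem_U1_iff hT hP _).2 ⟨ψ, hψ, hb, fun i => rfl⟩)
    · intro h z hz
      obtain ⟨ψ, h1, h2, h3⟩ := (mem_U1_iff hT hP z).1 hz
      have := h ψ (z none) h1 h2
      rw [hren ℂ] at this
      convert this using 3
      ext o
      cases o
      · rfl
      · exact (h3 _).symm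
  let j : CoordinateRing T P →ₐ[ℚ] F :=
    Ideal.Quotient.liftₐ _ j₀ fun a ha => (hj₀ a).1 ha
  have hj : Function.Injective j := by
    rw [injective_iff_map_eq_zero]
    intro a
    obtain ⟨f, rfl⟩ := Ideal.Quotient.mk_surjective a
    intro hf
    exact Ideal.Quotient.eq_zero_iff_mem.2 ((hj₀ f).2 hf)
  let _ : Algebra (CoordinateRing T P) F := j.toRingHom.toAlgebra
  have : IsScalarTower ℚ (CoordinateRing T P) F :=
    IsScalarTower.of_algebraMap_eq fun q => (j.commutes q).symm
  have : FaithfulSMul (CoordinateRing T P) F := (faithfulSMul_iff_algebraMap_injective _ _).2 hj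
  have hrange : ∀ y ∈ Algebra.adjoin ℚ (insert c (Set.range φ)), ∃ a, j a = y := by
    intro y hy
    have hle : Algebra.adjoin ℚ (insert c (Set.range φ)) ≤ j.range := by
      rw [Algebra.adjoin_le_iff]
      have hc : c ∈ j.range := ⟨Ideal.Quotient.mk _ (MvPolynomial.X none), by
        show j₀ (MvPolynomial.X none) = c
        simp [j₀]⟩
      have hPi : ∀ i, φ (P i) ∈ j.range := fun i =>
        ⟨Ideal.Quotient.mk _ (MvPolynomial.X (some i)), by
          show j₀ (MvPolynomial.X (some i)) = _
          simp [j₀]⟩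
      rintro y (rfl | ⟨v, rfl⟩)
      · exact hc
      · exact mem_of_generates hT hP heq j.range hc hPi v
    exact hle hy
  have hfrac : IsFractionRing (CoordinateRing T P) F := by
    refine IsFractionRing.of_field _ _ fun z => ?_
    have hz : z ∈ IntermediateField.adjoin ℚ (insert c (Set.range φ)) := hgen ▸ trivial
    obtain ⟨a, ha, b, hb, h⟩ := IntermediateField.mem_adjoin_iff_div.1 hz
    obtain ⟨a', rfl⟩ := hrange a ha
    obtain ⟨b', rfl⟩ := hrange b hb
    exact ⟨a', b', h⟩
  exact ⟨(FractionRing.algEquiv (CoordinateRing T P) F).restrictScalars ℚ⟩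

end DynModCurve

/-! ### Function fields of quartic models -/

namespace DynModCurve

open Polynomial

lemma aeval_mem_of_mem {L : Type*} [CommRing L] [Algebra ℚ L] {B : Subalgebra ℚ L} {x : L}
    (hx : x ∈ B)
    (p : ℚ[X]) : aeval x p ∈ B :=
  Algebra.adjoin_le (Set.singleton_subset_iff.2 hx) (aeval_mem_adjoin_singleton ℚ x)

/-- A Laurent polynomial expression in `t` and a square root `s` of `q(t)` is, up to a power of
`t`, of the form `A(t) + B(t) s`. -/
lemma exists_normalForm (q : ℚ[X]) (g : MvPolynomial (Fin 3) ℚ) :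
    ∃ (k : ℕ) (A B : ℚ[X]), ∀ (L : Type) [Field L] [Algebra ℚ L] (t s : L), t ≠ 0 →
      s ^ 2 = aeval t q →
      t ^ k * MvPolynomial.aeval ![t, t⁻¹, s] g = aeval t A + aeval t B * s := by
  induction g using MvPolynomial.induction_on with
  | C a => exact ⟨0, C a, 0, fun L _ _ t s _ _ => by simp⟩
  | add f g hf hg =>
    obtain ⟨k, A, B, h⟩ := hf
    obtain ⟨l, A', B', h'⟩ := hg
    refine ⟨k + l, A * X ^ l + A' * X ^ k, B * X ^ l + B' * X ^ k, fun L _ _ t s ht hs => ?_⟩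
    have e := h L t s ht hs
    have e' := h' L t s ht hs
    simp only [map_add, map_mul, map_pow, aeval_X]
    linear_combination t ^ l * e + t ^ k * e'
  | mul_X f i hf =>
    obtain ⟨k, A, B, h⟩ := hf
    fin_cases i
    · refine ⟨k, A * X, B * X, fun L _ _ t s ht hs => ?_⟩
      have e := h L t s ht hs
      simp only [map_mul, aeval_X, MvPolynomial.aeval_X, Fin.zero_eta, Matrix.cons_val_zero]
      linear_combination t * e
    · refine ⟨k + 1, A, B, fun L _ _ t s ht hs => ?_⟩
      have e := h L t s ht hs
      simp only [map_mul, MvPolynomial.aeval_X, Fin.mk_one, Matrix.cons_val_one,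
        Matrix.cons_val_zero]
      linear_combination e + t ^ k * MvPolynomial.aeval ![t, t⁻¹, s] f * mul_inv_cancel₀ ht
    · refine ⟨k, B * q, A, fun L _ _ t s ht hs => ?_⟩
      have e := h L t s ht hs
      simp only [map_mul, MvPolynomial.aeval_X, Fin.reduceFinMk, Matrix.cons_val]
      linear_combination s * e + aeval t B * hs

/-- If `q` is not a square and `t₁` is transcendental, then `(t₁, √q(t₁))` is a generic point of
the curve `s² = q(t)`, `t ≠ 0`. -/
lemma aeval_eq_zero_of_transcendental {q : ℚ[X]} (hq : ∀ r, r ^ 2 ≠ q) {L₁ L₂ : Type} [Field L₁]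
    [Algebra ℚ L₁] [Field L₂] [Algebra ℚ L₂] {t₁ s₁ : L₁} (ht₁ : Transcendental ℚ t₁)
    (hs₁ : s₁ ^ 2 = aeval t₁ q) {t₂ s₂ : L₂} (ht₂ : t₂ ≠ 0) (hs₂ : s₂ ^ 2 = aeval t₂ q)
    (g : MvPolynomial (Fin 3) ℚ) (hg : MvPolynomial.aeval ![t₁, t₁⁻¹, s₁] g = 0) :
    MvPolynomial.aeval ![t₂, t₂⁻¹, s₂] g = 0 := by
  obtain ⟨k, A, B, h⟩ := exists_normalForm q g
  have hinj := transcendental_iff_injective.1 ht₁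
  have ht₁0 : t₁ ≠ 0 := fun h0 => ht₁ (h0 ▸ isAlgebraic_zero)
  have h1 := h L₁ t₁ s₁ ht₁0 hs₁
  rw [hg, mul_zero] at h1
  have hAB : A ^ 2 = B ^ 2 * q := by
    apply hinj
    simp only [map_pow, map_mul, ← hs₁]
    linear_combination (-aeval t₁ A + aeval t₁ B * s₁) * h1
  have hB : B = 0 := by
    by_contra hB
    obtain ⟨r, rfl⟩ := (UniqueFactorizationMonoid.pow_dvd_pow_iff_dvd two_ne_zero).1
        (Dvd.intro q hAB.symm)
    refine hq r (mul_left_cancel₀ (pow_ne_zero 2 hB) ?_)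
    rw [← hAB]; ring
  have hA : A = 0 := by
    rw [hB] at hAB
    simpa using hAB
  have h2 := h L₂ t₂ s₂ ht₂ hs₂
  rw [hA, hB] at h2
  simpa [ht₂] using h2

lemma exists_transcendental_complex : ∃ t : ℂ, Transcendental ℚ t := by
  by_contra! h
  have h1 := Algebraic.countable ℚ ℂ
  have h2 : {x : ℂ | IsAlgebraic ℚ x} = Set.univ := by
    ext x
    simpa [Transcendental] using h x
  rw [h2] at h1
  exact not_countable_complex h1

section FunctionField

variable (E : WeierstrassCurve ℚ)

/-- The coordinate function `x` on `E`. -/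
noncomputable def xGen : E.toAffine.FunctionField :=
  algebraMap E.toAffine.CoordinateRing _
    (WeierstrassCurve.Affine.CoordinateRing.mk E.toAffine (C X))

/-- The coordinate function `y` on `E`. -/
noncomputable def yGen : E.toAffine.FunctionField :=
  algebraMap E.toAffine.CoordinateRing _ (WeierstrassCurve.Affine.CoordinateRing.mk E.toAffine X)

lemma aeval_xGen (p : ℚ[X]) : aeval (xGen E) p =
    algebraMap E.toAffine.CoordinateRing E.toAffine.FunctionField
      (WeierstrassCurve.Affine.CoordinateRing.mk E.toAffine (C p)) := by
  let f : ℚ[X] →ₐ[ℚ] E.toAffine.FunctionField :=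
    (algebraMap E.toAffine.CoordinateRing E.toAffine.FunctionField).toRatAlgHom.comp
      ((WeierstrassCurve.Affine.CoordinateRing.mk E.toAffine).comp C).toRatAlgHom
  have : f = aeval (xGen E) := by
    apply Polynomial.algHom_ext
    simp [f, xGen]
  rw [← this]
  rfl

lemma transcendental_xGen : Transcendental ℚ (xGen E) := by
  rw [transcendental_iff]
  intro p hp
  rw [aeval_xGen] at hp
  have h1 := (map_eq_zero_iff _ (IsFractionRing.injective E.toAffine.CoordinateRing
    E.toAffine.FunctionField)).1 hp
  have h2 := WeierstrassCurve.Affine.CoordinateRing.smul_basis_eq_zero (W' := E.toAffine)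
    (p := p) (q := 0) (by rw [WeierstrassCurve.Affine.CoordinateRing.smul, h1]; simp)
  exact h2.1

lemma yGen_equation : yGen E ^ 2 + algebraMap ℚ _ E.a₁ * xGen E * yGen E +
    algebraMap ℚ _ E.a₃ * yGen E =
    xGen E ^ 3 + algebraMap ℚ _ E.a₂ * xGen E ^ 2 + algebraMap ℚ _ E.a₄ * xGen E +
        algebraMap ℚ _ E.a₆ := by
  have h : WeierstrassCurve.Affine.CoordinateRing.mk E.toAffine E.toAffine.polynomial = 0 :=
    AdjoinRoot.mk_self
  have h' := congrArg (algebraMap E.toAffine.CoordinateRing E.toAffine.FunctionField) h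
  have hC : ∀ p : ℚ[X], algebraMap E.toAffine.CoordinateRing E.toAffine.FunctionField
      (WeierstrassCurve.Affine.CoordinateRing.mk E.toAffine (C p)) = aeval (xGen E) p :=
    fun p => (aeval_xGen E p).symm
  have hY : algebraMap E.toAffine.CoordinateRing E.toAffine.FunctionField
      (WeierstrassCurve.Affine.CoordinateRing.mk E.toAffine X) = yGen E := rfl
  simp only [WeierstrassCurve.Affine.polynomial, map_sub, map_add, map_mul, map_pow, hC, hY,
      map_zero, aeval_C,
    aeval_X] at h'
  linear_combination h'

lemma adjoin_xGen_yGen : IntermediateField.adjoin ℚ {xGen E, yGen E} = ⊤ := by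
  rw [eq_top_iff]
  rintro z -
  set B := IntermediateField.adjoin ℚ {xGen E, yGen E}
  have hx : xGen E ∈ B := IntermediateField.subset_adjoin _ _ (by simp)
  have hy : yGen E ∈ B := IntermediateField.subset_adjoin _ _ (by simp)
  have hp : ∀ p : ℚ[X], aeval (xGen E) p ∈ B := fun p =>
    aeval_mem_of_mem (B := B.toSubalgebra) hx p
  have hR : ∀ r : E.toAffine.CoordinateRing, algebraMap _ E.toAffine.FunctionField r ∈ B := by
    intro r
    obtain ⟨p, q, rfl⟩ := WeierstrassCurve.Affine.CoordinateRing.exists_smul_basis_eq r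
    rw [WeierstrassCurve.Affine.CoordinateRing.smul, WeierstrassCurve.Affine.CoordinateRing.smul,
        mul_one, map_add, map_mul, ← aeval_xGen, ← aeval_xGen]
    exact B.add_mem (hp p) (B.mul_mem (hp q) hy)
  obtain ⟨a, b, -, rfl⟩ := IsFractionRing.div_surjective (A := E.toAffine.CoordinateRing) z
  exact B.div_mem (hR a) (hR b)

end FunctionField

/-- The criterion behind all six isomorphisms.  The realisations of the graph over a field are
parametrised by the points of the affine curve `s² = q(t)`, `t ≠ 0`, through the Laurent polynomial
expressions `Φ (some v)` for the vertices and `Φ none` for `c`, in the variables `t`, `t⁻¹`, `s`;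
the function field of this curve is that of `E`. -/
theorem isIsomorphicTo_of_quartic {V : Type*} {T : V → V} (hT : IsAdmissible T Set.univ)
    (E : WeierstrassCurve ℚ) [hE : E.IsElliptic] {q : ℚ[X]} (hq : ∀ r, r ^ 2 ≠ q)
    (Φ : Option V → MvPolynomial (Fin 3) ℚ)
    (hΦ : ∀ (L : Type) [Field L] [Algebra ℚ L] (t s : L), t ≠ 0 → s ^ 2 = aeval t q → ∀ v,
      MvPolynomial.aeval ![t, t⁻¹, s] (Φ (some (T v))) =
        MvPolynomial.aeval ![t, t⁻¹, s] (Φ (some v)) ^ 2 + MvPolynomial.aeval ![t, t⁻¹, s] (Φ none))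
    (hinj : ∃ t s : ℝ, t ≠ 0 ∧ s ^ 2 = aeval t q ∧
      Function.Injective fun v => MvPolynomial.aeval ![t, t⁻¹, s] (Φ (some v)))
    (hsurj : ∀ (ψ : V → ℂ) (b : ℂ), Function.Injective ψ → (∀ v, ψ (T v) = ψ v ^ 2 + b) →
      ∃ t s : ℂ, t ≠ 0 ∧ s ^ 2 = aeval t q ∧
        (∀ v, MvPolynomial.aeval ![t, t⁻¹, s] (Φ (some v)) = ψ v) ∧
        MvPolynomial.aeval ![t, t⁻¹, s] (Φ none) = b)
    (hgen : ∀ (L : Type) [Field L] [Algebra ℚ L] (t s : L), t ≠ 0 → s ^ 2 = aeval t q →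
      ∀ B : IntermediateField ℚ L, (∀ v, MvPolynomial.aeval ![t, t⁻¹, s] (Φ (some v)) ∈ B) →
        t ∈ B ∧ s ∈ B)
    (hF : ∃ t s : E.toAffine.FunctionField, s ^ 2 = aeval t q ∧
      ∀ B : IntermediateField ℚ E.toAffine.FunctionField, t ∈ B → s ∈ B → xGen E ∈ B ∧ yGen E ∈ B) :
    IsIsomorphicTo T E := by
  refine ⟨hE, exists_isMinimalGenerating hT, fun n P hP => ?_⟩
  obtain ⟨t, s, hs, hts⟩ := hF
  have htop : ∀ B : IntermediateField ℚ E.toAffine.FunctionField, t ∈ B → s ∈ B → B = ⊤ := by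
    intro B ht hs
    rw [eq_top_iff, ← adjoin_xGen_yGen, IntermediateField.adjoin_le_iff]
    obtain ⟨hx, hy⟩ := hts B ht hs
    rintro z (rfl | rfl)
    · exact hx
    · exact hy
  have ht : Transcendental ℚ t := by
    intro halg
    have h1 : IsIntegral ℚ t := isAlgebraic_iff_isIntegral.1 halg
    have h2 : IsIntegral ℚ s := by
      refine IsIntegral.of_pow (n := 2) two_pos ?_
      rw [hs]
      exact aeval_mem_of_mem (B := integralClosure ℚ E.toAffine.FunctionField) h1 q
    have hx := (hts (algebraicClosure ℚ E.toAffine.FunctionField)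
      (mem_algebraicClosure_iff'.2 h1) (mem_algebraicClosure_iff'.2 h2)).1
    exact transcendental_xGen E (mem_algebraicClosure_iff.1 hx)
  have ht0 : t ≠ 0 := fun h0 => ht (h0 ▸ isAlgebraic_zero)
  -- substituting the parametrisation into a polynomial in the vertices and `c`
  have hbind : ∀ (L : Type) [Field L] [Algebra ℚ L] (t s : L) (p : MvPolynomial (Option V) ℚ),
      MvPolynomial.aeval (fun o : Option V => o.elim (MvPolynomial.aeval ![t, t⁻¹, s] (Φ none))
        (fun v => MvPolynomial.aeval ![t, t⁻¹, s] (Φ (some v)))) p =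
      MvPolynomial.aeval ![t, t⁻¹, s] (MvPolynomial.bind₁ Φ p) := by
    intro L _ _ t s p
    rw [MvPolynomial.aeval_bind₁]
    congr 2
    ext o
    cases o <;> rfl
  refine nonempty_functionField_algEquiv hT
    (fun v => MvPolynomial.aeval ![t, t⁻¹, s] (Φ (some v)))
    (MvPolynomial.aeval ![t, t⁻¹, s] (Φ none)) (hΦ _ t s ht0 hs) ?_ (fun p => ?_) hP.1
  · obtain ⟨h1, h2⟩ := hgen _ t s ht0 hs (IntermediateField.adjoin ℚ _) fun v =>
      IntermediateField.subset_adjoin _ _ (Set.mem_insert_of_mem _ (Set.mem_range_self v))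
    exact htop _ h1 h2
  · rw [hbind]
    constructor
    · intro hp ψ b hψ hb
      obtain ⟨t', s', ht', hs', h1, h2⟩ := hsurj ψ b hψ hb
      obtain rfl : (fun v => MvPolynomial.aeval ![t', t'⁻¹, s'] (Φ (some v))) = ψ := funext h1
      rw [← h2, hbind]
      exact aeval_eq_zero_of_transcendental hq ht hs ht' hs' _ hp
    · intro hp
      obtain ⟨t', ht'⟩ := exists_transcendental_complex
      have ht'0 : t' ≠ 0 := fun h0 => ht' (h0 ▸ isAlgebraic_zero)
      obtain ⟨s', hs'⟩ := IsAlgClosed.exists_pow_nat_eq (aeval t' q) two_pos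
      obtain ⟨t₀, s₀, ht₀, hs₀, hinj⟩ := hinj
      have := hp (fun v => MvPolynomial.aeval ![t', t'⁻¹, s'] (Φ (some v)))
        (MvPolynomial.aeval ![t', t'⁻¹, s'] (Φ none)) ?_ (hΦ ℂ t' s' ht'0 hs')
      · rw [hbind] at this
        exact aeval_eq_zero_of_transcendental hq ht' hs' ht0 hs _ this
      · intro v w hvw
        apply hinj
        have h := aeval_eq_zero_of_transcendental hq ht' hs' ht₀ hs₀
          (Φ (some v) - Φ (some w)) (by rw [map_sub, sub_eq_zero]; exact hvw)
        rwa [map_sub, sub_eq_zero] at h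

end DynModCurve

/-! ### The six dynamical modular curves -/

namespace DynModCurve

open Polynomial

lemma sq_ne_of_not_isSquare_eval_one {q : ℚ[X]} (h : ¬ IsSquare (q.eval 1)) (r : ℚ[X]) :
    r ^ 2 ≠ q := by
  rintro rfl
  exact h ⟨r.eval 1, by rw [eval_pow, sq]⟩

lemma eq_neg_of_equivariant {V : Type*} {T : V → V} {L : Type*} [Field L] {ψ : V → L} {b : L}
    (hinj : Function.Injective ψ) (h : ∀ v, ψ (T v) = ψ v ^ 2 + b) {v w : V} (hvw : v ≠ w)
    (hT : T v = T w) : ψ w = -ψ v := by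
  have h1 := h v
  rw [hT, h w] at h1
  rcases sq_eq_sq_iff_eq_or_eq_neg.1 (add_right_cancel h1) with h2 | h2
  · exact absurd (hinj h2).symm hvw
  · exact h2

/-- Two distinct fixed points of `f_b` have sum `1`. -/
lemma eq_one_sub_of_fixed {L : Type*} [Field L] {p r b : L} (h : p ≠ r) (hp : p = p ^ 2 + b)
    (hr : r = r ^ 2 + b) : r = 1 - p := by
  have : (p - r) * (p + r - 1) = 0 := by linear_combination hr - hp
  rcases mul_eq_zero.1 this with h1 | h1
  · exact absurd (sub_eq_zero.1 h1) h
  · linear_combination h1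

/-- The two points of a 2-cycle of `f_b` have sum `-1`. -/
lemma eq_neg_one_sub_of_cycle {L : Type*} [Field L] {p r b : L} (h : p ≠ r) (hp : r = p ^ 2 + b)
    (hr : p = r ^ 2 + b) : r = -1 - p := by
  have : (p - r) * (p + r + 1) = 0 := by linear_combination hr - hp
  rcases mul_eq_zero.1 this with h1 | h1
  · exact absurd (sub_eq_zero.1 h1) h
  · linear_combination h1

/-- The expression `(t + t⁻¹) / 2`; the variables `X 0`, `X 1`, `X 2` stand for `t`, `t⁻¹`, `s`. -/
noncomputable def halfSum : MvPolynomial (Fin 3) ℚ :=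
  MvPolynomial.C (1 / 2) * (MvPolynomial.X 0 + MvPolynomial.X 1)

/-- The expression `(t⁻¹ - t) / 2`. -/
noncomputable def halfDiff : MvPolynomial (Fin 3) ℚ :=
  MvPolynomial.C (1 / 2) * (MvPolynomial.X 1 - MvPolynomial.X 0)

/-- The expression `s / (2 t)`. -/
noncomputable def halfRoot : MvPolynomial (Fin 3) ℚ :=
  MvPolynomial.C (1 / 2) * MvPolynomial.X 2 * MvPolynomial.X 1

section

variable {L : Type*} [Field L] [Algebra ℚ L] (t s : L)

lemma aeval_halfSum : MvPolynomial.aeval ![t, t⁻¹, s] halfSum = (t + t⁻¹) / 2 := by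
  simp [halfSum]; ring

lemma aeval_halfDiff : MvPolynomial.aeval ![t, t⁻¹, s] halfDiff = (t⁻¹ - t) / 2 := by
  simp [halfDiff]; ring

lemma aeval_halfRoot : MvPolynomial.aeval ![t, t⁻¹, s] halfRoot = s / (2 * t) := by
  simp [halfRoot]; ring

end

/-- The quartic `X⁴ + a X³ + b X² + c X + 1`. -/
noncomputable def quartic (a b c : ℚ) : ℚ[X] := X ^ 4 + C a * X ^ 3 + C b * X ^ 2 + C c * X + 1

lemma aeval_quartic {L : Type*} [Field L] [Algebra ℚ L] (a b c : ℚ) (t : L) :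
    aeval t (quartic a b c) = t ^ 4 + algebraMap ℚ L a * t ^ 3 + algebraMap ℚ L b * t ^ 2 +
      algebraMap ℚ L c * t + 1 := by
  simp [quartic]

lemma eval_one_quartic (a b c : ℚ) : (quartic a b c).eval 1 = 2 + a + b + c := by
  simp [quartic]; ring

lemma charZero_of_algebra (L : Type*) [Field L] [Algebra ℚ L] : CharZero L :=
  algebraRat.charZero L

lemma xGen_sub_ne_zero (E : WeierstrassCurve ℚ) (a : ℚ) :
    xGen E - algebraMap ℚ _ a ≠ 0 := fun h =>
  transcendental_xGen E (sub_eq_zero.1 h ▸ isAlgebraic_algebraMap a)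

/-- A quadratic equation for `t` over `ℚ(m)` turns `s = m - t² - a t / 2` into a square root of a
quartic in `t`. -/
lemma sq_eq_quartic {L : Type*} [Field L] [Algebra ℚ L] {a b c : ℚ} {m t : L}
    (h : (2 * m + algebraMap ℚ L (b - a ^ 2 / 4)) * t ^ 2 +
      (algebraMap ℚ L a * m + algebraMap ℚ L c) * t + 1 - m ^ 2 = 0) :
    (m - t ^ 2 - algebraMap ℚ L (a / 2) * t) ^ 2 = aeval t (quartic a b c) := by
  have := charZero_of_algebra L
  rw [aeval_quartic]
  simp only [map_sub, map_div₀, map_pow, map_ofNat] at h ⊢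
  linear_combination -h

/-- If `t = (y + p x + r) / (x - e)` satisfies the quadratic equation of `sq_eq_quartic` with
`m = 2 x + m₀`, then `t` and `s = m - t² - a t / 2` generate the same field as `x` and `y`, and
`s² = quartic a b c (t)`. -/
lemma exists_generators {F : Type*} [Field F] [Algebra ℚ F] {x y : F} (a b c e p r m₀ : ℚ)
    (hx : x - algebraMap ℚ F e ≠ 0)
    (h : ∀ t : F, t * (x - algebraMap ℚ F e) = y + algebraMap ℚ F p * x + algebraMap ℚ F r →
      (x - algebraMap ℚ F e) * ((2 * (2 * x + algebraMap ℚ F m₀) +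
        algebraMap ℚ F (b - a ^ 2 / 4)) * t ^ 2 +
        (algebraMap ℚ F a * (2 * x + algebraMap ℚ F m₀) + algebraMap ℚ F c) * t + 1 -
        (2 * x + algebraMap ℚ F m₀) ^ 2) = 0) :
    ∃ t s : F, s ^ 2 = aeval t (quartic a b c) ∧
      ∀ B : IntermediateField ℚ F, t ∈ B → s ∈ B → x ∈ B ∧ y ∈ B := by
  have ht := div_mul_cancel₀ (y + algebraMap ℚ F p * x + algebraMap ℚ F r) hx
  set t := (y + algebraMap ℚ F p * x + algebraMap ℚ F r) / (x - algebraMap ℚ F e)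
  clear_value t
  refine ⟨t, _, sq_eq_quartic (m := 2 * x + algebraMap ℚ F m₀)
    ((mul_eq_zero.1 (h t ht)).resolve_left hx), fun B htB hsB => ?_⟩
  have := charZero_of_algebra F
  have hxB : x ∈ B := by
    convert B.div_mem (B.sub_mem (B.add_mem (B.add_mem hsB (pow_mem htB 2))
      (B.mul_mem (B.algebraMap_mem (a / 2)) htB)) (B.algebraMap_mem m₀)) (ofNat_mem B 2) using 1
    ring
  refine ⟨hxB, ?_⟩
  convert B.sub_mem (B.sub_mem (B.mul_mem htB (B.sub_mem hxB (B.algebraMap_mem e)))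
    (B.mul_mem (B.algebraMap_mem p) hxB)) (B.algebraMap_mem r) using 1
  linear_combination -ht

lemma injective_of_strictMono_comp {n : ℕ} {f : Fin n → ℝ} {σ : Fin n → Fin n}
    (hσ : Function.Surjective σ) (h : StrictMono (f ∘ σ)) : Function.Injective f :=
  (Function.Injective.of_comp_iff' f ⟨Finite.injective_iff_surjective.2 hσ, hσ⟩).1 h.injective

instance : curve11A3.IsElliptic := ⟨by
  rw [isUnit_iff_ne_zero]
  norm_num [curve11A3, WeierstrassCurve.Δ, WeierstrassCurve.b₂, WeierstrassCurve.b₄,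
    WeierstrassCurve.b₆, WeierstrassCurve.b₈]⟩

lemma exists_generators_curve11A3 : ∃ t s : curve11A3.toAffine.FunctionField,
    s ^ 2 = aeval t (quartic 0 2 4) ∧ ∀ B : IntermediateField ℚ curve11A3.toAffine.FunctionField,
      t ∈ B → s ∈ B → xGen curve11A3 ∈ B ∧ yGen curve11A3 ∈ B := by
  refine exists_generators 0 2 4 0 0 0 (-1) (xGen_sub_ne_zero _ _) fun t ht => ?_
  have := charZero_of_algebra curve11A3.toAffine.FunctionField
  have hE := yGen_equation curve11A3
  rw [show curve11A3.a₁ = 0 from rfl, show curve11A3.a₂ = -1 from rfl,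
    show curve11A3.a₃ = 1 from rfl, show curve11A3.a₄ = 0 from rfl,
    show curve11A3.a₆ = 0 from rfl] at hE
  simp only [map_zero, map_one, map_neg, map_ofNat, map_sub, map_div₀, map_pow] at hE ht ⊢
  linear_combination 4 * hE + (4 * (t * (xGen curve11A3 - 0) +
    (yGen curve11A3 + 0 * xGen curve11A3 + 0)) + (0 * (2 * xGen curve11A3 + (-1)) + 4)) * ht

instance : curve15A8.IsElliptic := ⟨by
  rw [isUnit_iff_ne_zero]
  norm_num [curve15A8, WeierstrassCurve.Δ, WeierstrassCurve.b₂, WeierstrassCurve.b₄,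
    WeierstrassCurve.b₆, WeierstrassCurve.b₈]⟩

lemma exists_generators_curve15A8 : ∃ t s : curve15A8.toAffine.FunctionField,
    s ^ 2 = aeval t (quartic (-2) (-1) (-2)) ∧
        ∀ B : IntermediateField ℚ curve15A8.toAffine.FunctionField,
      t ∈ B → s ∈ B → xGen curve15A8 ∈ B ∧ yGen curve15A8 ∈ B := by
  refine exists_generators (-2) (-1) (-2) 0 1 1 1 (xGen_sub_ne_zero _ _) fun t ht => ?_
  have := charZero_of_algebra curve15A8.toAffine.FunctionField
  have hE := yGen_equation curve15A8
  rw [show curve15A8.a₁ = 1 from rfl, show curve15A8.a₂ = 1 from rfl,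
    show curve15A8.a₃ = 1 from rfl, show curve15A8.a₄ = 0 from rfl,
    show curve15A8.a₆ = 0 from rfl] at hE
  simp only [map_zero, map_one, map_neg, map_ofNat, map_sub, map_div₀, map_pow] at hE ht ⊢
  linear_combination 4 * hE + (4 * (t * (xGen curve15A8 - 0) +
    (yGen curve15A8 + 1 * xGen curve15A8 + 1)) + ((-2) * (2 * xGen curve15A8 + 1) + (-2))) * ht

instance : curve17A4.IsElliptic := ⟨by
  rw [isUnit_iff_ne_zero]
  norm_num [curve17A4, WeierstrassCurve.Δ, WeierstrassCurve.b₂, WeierstrassCurve.b₄,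
    WeierstrassCurve.b₆, WeierstrassCurve.b₈]⟩

lemma exists_generators_curve17A4 : ∃ t s : curve17A4.toAffine.FunctionField,
    s ^ 2 = aeval t (quartic 2 3 (-2)) ∧ ∀ B : IntermediateField ℚ curve17A4.toAffine.FunctionField,
      t ∈ B → s ∈ B → xGen curve17A4 ∈ B ∧ yGen curve17A4 ∈ B := by
  refine exists_generators 2 3 (-2) 0 0 1 (-1) (xGen_sub_ne_zero _ _) fun t ht => ?_
  have := charZero_of_algebra curve17A4.toAffine.FunctionField
  have hE := yGen_equation curve17A4
  rw [show curve17A4.a₁ = 1 from rfl, show curve17A4.a₂ = -1 from rfl,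
    show curve17A4.a₃ = 1 from rfl, show curve17A4.a₄ = -1 from rfl,
    show curve17A4.a₆ = 0 from rfl] at hE
  simp only [map_zero, map_one, map_neg, map_ofNat, map_sub, map_div₀, map_pow] at hE ht ⊢
  linear_combination 4 * hE + (4 * (t * (xGen curve17A4 - 0) +
    (yGen curve17A4 + 0 * xGen curve17A4 + 1)) + (2 * (2 * xGen curve17A4 + (-1)) + (-2))) * ht

instance : curve24A4.IsElliptic := ⟨by
  rw [isUnit_iff_ne_zero]
  norm_num [curve24A4, WeierstrassCurve.Δ, WeierstrassCurve.b₂, WeierstrassCurve.b₄,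
    WeierstrassCurve.b₆, WeierstrassCurve.b₈]⟩

lemma exists_generators_curve24A4 : ∃ t s : curve24A4.toAffine.FunctionField,
    s ^ 2 = aeval t (quartic 4 2 4) ∧ ∀ B : IntermediateField ℚ curve24A4.toAffine.FunctionField,
      t ∈ B → s ∈ B → xGen curve24A4 ∈ B ∧ yGen curve24A4 ∈ B := by
  refine exists_generators 4 2 4 1 (-1) 0 (-1) (xGen_sub_ne_zero _ _) fun t ht => ?_
  have := charZero_of_algebra curve24A4.toAffine.FunctionField
  have hE := yGen_equation curve24A4
  rw [show curve24A4.a₁ = 0 from rfl, show curve24A4.a₂ = -1 from rfl,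
    show curve24A4.a₃ = 0 from rfl, show curve24A4.a₄ = 1 from rfl,
    show curve24A4.a₆ = 0 from rfl] at hE
  simp only [map_zero, map_one, map_neg, map_ofNat, map_sub, map_div₀, map_pow] at hE ht ⊢
  linear_combination 4 * hE + (4 * (t * (xGen curve24A4 - 1) +
    (yGen curve24A4 + (-1) * xGen curve24A4 + 0)) + (4 * (2 * xGen curve24A4 + (-1)) + 4)) * ht

instance : curve40A3.IsElliptic := ⟨by
  rw [isUnit_iff_ne_zero]
  norm_num [curve40A3, WeierstrassCurve.Δ, WeierstrassCurve.b₂, WeierstrassCurve.b₄,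
    WeierstrassCurve.b₆, WeierstrassCurve.b₈]⟩

lemma exists_generators_curve40A3 : ∃ t s : curve40A3.toAffine.FunctionField,
    s ^ 2 = aeval t (quartic (-4) 6 4) ∧ ∀ B : IntermediateField ℚ curve40A3.toAffine.FunctionField,
      t ∈ B → s ∈ B → xGen curve40A3 ∈ B ∧ yGen curve40A3 ∈ B := by
  refine exists_generators (-4) 6 4 0 1 (-1) (-1) (xGen_sub_ne_zero _ _) fun t ht => ?_
  have := charZero_of_algebra curve40A3.toAffine.FunctionField
  have hE := yGen_equation curve40A3
  rw [show curve40A3.a₁ = 0 from rfl, show curve40A3.a₂ = 0 from rfl,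
    show curve40A3.a₃ = 0 from rfl, show curve40A3.a₄ = -2 from rfl,
    show curve40A3.a₆ = 1 from rfl] at hE
  simp only [map_zero, map_one, map_neg, map_ofNat, map_sub, map_div₀, map_pow] at hE ht ⊢
  linear_combination 4 * hE + (4 * (t * (xGen curve40A3 - 0) +
    (yGen curve40A3 + 1 * xGen curve40A3 + (-1))) + ((-4) * (2 * xGen curve40A3 + (-1)) + 4)) * ht

/-- The vertices of 8(1,1)a and of 8(1,1)b and the parameter `c`, in terms of `t` and `s`.  The two
graphs differ in the vertex whose square root is adjoined last, hence in the quartic. -/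
noncomputable def param8_11 : Option (Fin 8) → MvPolynomial (Fin 3) ℚ := fun o =>
  o.elim (-((1 + halfSum) * halfSum))
    ![1 + halfSum, -(1 + halfSum), -halfSum, halfSum, halfDiff, -halfDiff, halfRoot, -halfRoot]

lemma aeval_param8_11 {L : Type*} [Field L] [Algebra ℚ L] (t s : L) (v : Fin 8) :
    MvPolynomial.aeval ![t, t⁻¹, s] (param8_11 (some v)) =
      ![1 + (t + t⁻¹) / 2, -(1 + (t + t⁻¹) / 2), -((t + t⁻¹) / 2), (t + t⁻¹) / 2,
        (t⁻¹ - t) / 2, -((t⁻¹ - t) / 2), s / (2 * t), -(s / (2 * t))] v := by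
  fin_cases v <;> simp [param8_11, aeval_halfSum, aeval_halfDiff, aeval_halfRoot]

lemma aeval_param8_11_none {L : Type*} [Field L] [Algebra ℚ L] (t s : L) :
    MvPolynomial.aeval ![t, t⁻¹, s] (param8_11 none) =
      -((1 + (t + t⁻¹) / 2) * ((t + t⁻¹) / 2)) := by
  simp [param8_11, aeval_halfSum]

lemma graph8_11a_isAdmissible : IsAdmissible graph8_11a Set.univ :=
  isAdmissible_univ _ (by decide) (by decide) (by decide)

theorem graph8_11a_isIsomorphicTo : IsIsomorphicTo graph8_11a curve24A4 := by
  refine isIsomorphicTo_of_quartic (q := quartic 4 2 4) graph8_11a_isAdmissible curve24A4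
    (sq_ne_of_not_isSquare_eval_one (by rw [eval_one_quartic]; norm_num)) param8_11 ?_ ?_ ?_ ?_
    exists_generators_curve24A4
  · intro L _ _ t s ht hs v
    have := charZero_of_algebra L
    rw [aeval_quartic] at hs
    simp only [map_ofNat] at hs
    rw [aeval_param8_11, aeval_param8_11, aeval_param8_11_none]
    fin_cases v <;> simp [graph8_11a] <;> field_simp <;>
      first | ring1 | linear_combination hs | linear_combination -hs
  · have hsq : √(65 : ℝ) ^ 2 = 65 := Real.sq_sqrt (by norm_num)
    have h0 := Real.sqrt_nonneg (65 : ℝ)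
    have h1 : 8 < √(65 : ℝ) := by nlinarith
    have h2 : √(65 : ℝ) < 8.1 := by nlinarith
    refine ⟨2, √65, by norm_num, ?_, ?_⟩
    · rw [hsq, aeval_quartic]; norm_num
    · -- the vertices in increasing order
      refine injective_of_strictMono_comp (σ := ![1, 7, 2, 4, 5, 3, 6, 0]) (by decide)
        (Fin.strictMono_iff_lt_succ.2 fun i => ?_)
      simp only [Function.comp_apply, aeval_param8_11]
      fin_cases i <;> simp <;> linarith
  · intro ψ b hψ h
    have e0 := h 0
    have e2 := h 2
    have e4 := h 4
    have e6 := h 6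
    have n1 := eq_neg_of_equivariant (v := 0) (w := 1) hψ h (by decide) rfl
    have n3 := eq_neg_of_equivariant (v := 2) (w := 3) hψ h (by decide) rfl
    have n5 := eq_neg_of_equivariant (v := 4) (w := 5) hψ h (by decide) rfl
    have n7 := eq_neg_of_equivariant (v := 6) (w := 7) hψ h (by decide) rfl
    simp only [graph8_11a, Matrix.cons_val] at e0 e2 e4 e6
    have n2 := eq_one_sub_of_fixed (hψ.ne (by decide)) e0 e2
    -- the vertices other than the last square roots lie on a conic, parametrised by `t`
    have htv : (ψ 0 - 1 - ψ 4) * (ψ 0 - 1 + ψ 4) = 1 := by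
      linear_combination -e0 + e4 - n1
    obtain ⟨t, ht⟩ : ∃ t, t = ψ 0 - 1 - ψ 4 := ⟨_, rfl⟩
    rw [← ht] at htv
    have ht0 : t ≠ 0 := left_ne_zero_of_mul_eq_one htv
    have htinv := inv_eq_of_mul_eq_one_right htv
    have v0 : ψ 0 = 1 + (t + t⁻¹) / 2 := by rw [htinv, ht]; ring
    have v4 : ψ 4 = (t⁻¹ - t) / 2 := by rw [htinv, ht]; ring
    have vb : b = -((1 + (t + t⁻¹) / 2) * ((t + t⁻¹) / 2)) := by
      rw [v0] at e0
      linear_combination -e0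
    rw [n3, n2, v0, vb] at e6
    refine ⟨t, 2 * t * ψ 6, ht0, ?_, fun v => ?_, ?_⟩
    · rw [aeval_quartic]
      simp only [map_ofNat]
      field_simp at e6
      linear_combination -e6
    · rw [aeval_param8_11]
      fin_cases v <;> simp [n1, n2, n3, n5, n7, v0, v4] <;> field_simp
    · rw [aeval_param8_11_none, vb]
  · intro L _ _ t s ht hs B hB
    have := charZero_of_algebra L
    have h0 := hB 0
    have hu := hB 4
    have hw := hB 6
    rw [aeval_param8_11] at h0 hu hw
    simp only [Matrix.cons_val] at h0 hu hw
    have ht : t ∈ B := by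
      convert B.sub_mem (B.sub_mem h0 B.one_mem) hu using 1
      ring
    refine ⟨ht, ?_⟩
    convert B.mul_mem (B.mul_mem hw (ofNat_mem B 2)) ht using 1
    field_simp

lemma graph8_11b_isAdmissible : IsAdmissible graph8_11b Set.univ :=
  isAdmissible_univ _ (by decide) (by decide) (by decide)

theorem graph8_11b_isIsomorphicTo : IsIsomorphicTo graph8_11b curve11A3 := by
  refine isIsomorphicTo_of_quartic (q := quartic 0 2 4) graph8_11b_isAdmissible curve11A3
    (sq_ne_of_not_isSquare_eval_one (by rw [eval_one_quartic]; norm_num)) param8_11 ?_ ?_ ?_ ?_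
    exists_generators_curve11A3
  · intro L _ _ t s ht hs v
    have := charZero_of_algebra L
    rw [aeval_quartic] at hs
    simp only [map_zero, map_ofNat] at hs
    rw [aeval_param8_11, aeval_param8_11, aeval_param8_11_none]
    fin_cases v <;> simp [graph8_11b] <;> field_simp <;>
      first | ring1 | linear_combination hs | linear_combination -hs
  · have hsq : √(33 : ℝ) ^ 2 = 33 := Real.sq_sqrt (by norm_num)
    have h0 := Real.sqrt_nonneg (33 : ℝ)
    have h1 : 5.7 < √(33 : ℝ) := by nlinarith
    have h2 : √(33 : ℝ) < 5.8 := by nlinarith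
    refine ⟨2, √33, by norm_num, ?_, ?_⟩
    · rw [hsq, aeval_quartic]; norm_num
    · -- the vertices in increasing order
      refine injective_of_strictMono_comp (σ := ![1, 7, 2, 4, 5, 3, 6, 0]) (by decide)
        (Fin.strictMono_iff_lt_succ.2 fun i => ?_)
      simp only [Function.comp_apply, aeval_param8_11]
      fin_cases i <;> simp <;> linarith
  · intro ψ b hψ h
    have e0 := h 0
    have e2 := h 2
    have e4 := h 4
    have e6 := h 6
    have n1 := eq_neg_of_equivariant (v := 0) (w := 1) hψ h (by decide) rfl
    have n3 := eq_neg_of_equivariant (v := 2) (w := 3) hψ h (by decide) rfl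
    have n5 := eq_neg_of_equivariant (v := 4) (w := 5) hψ h (by decide) rfl
    have n7 := eq_neg_of_equivariant (v := 6) (w := 7) hψ h (by decide) rfl
    simp only [graph8_11b, Matrix.cons_val] at e0 e2 e4 e6
    have n2 := eq_one_sub_of_fixed (hψ.ne (by decide)) e0 e2
    -- the vertices other than the last square roots lie on a conic, parametrised by `t`
    have htv : (ψ 0 - 1 - ψ 4) * (ψ 0 - 1 + ψ 4) = 1 := by
      linear_combination -e0 + e4 - n1
    obtain ⟨t, ht⟩ : ∃ t, t = ψ 0 - 1 - ψ 4 := ⟨_, rfl⟩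
    rw [← ht] at htv
    have ht0 : t ≠ 0 := left_ne_zero_of_mul_eq_one htv
    have htinv := inv_eq_of_mul_eq_one_right htv
    have v0 : ψ 0 = 1 + (t + t⁻¹) / 2 := by rw [htinv, ht]; ring
    have v4 : ψ 4 = (t⁻¹ - t) / 2 := by rw [htinv, ht]; ring
    have vb : b = -((1 + (t + t⁻¹) / 2) * ((t + t⁻¹) / 2)) := by
      rw [v0] at e0
      linear_combination -e0
    rw [v4, vb] at e6
    refine ⟨t, 2 * t * ψ 6, ht0, ?_, fun v => ?_, ?_⟩
    · rw [aeval_quartic]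
      simp only [map_zero, map_ofNat]
      field_simp at e6
      linear_combination -e6
    · rw [aeval_param8_11]
      fin_cases v <;> simp [n1, n2, n3, n5, n7, v0, v4] <;> field_simp
    · rw [aeval_param8_11_none, vb]
  · intro L _ _ t s ht hs B hB
    have := charZero_of_algebra L
    have h0 := hB 0
    have hu := hB 4
    have hw := hB 6
    rw [aeval_param8_11] at h0 hu hw
    simp only [Matrix.cons_val] at h0 hu hw
    have ht : t ∈ B := by
      convert B.sub_mem (B.sub_mem h0 B.one_mem) hu using 1
      ring
    refine ⟨ht, ?_⟩
    convert B.mul_mem (B.mul_mem hw (ofNat_mem B 2)) ht using 1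
    field_simp

/-- The vertices of 8(2)a and of 8(2)b and the parameter `c`, in terms of `t` and `s`.  The two
graphs differ in the vertex whose square root is adjoined last, hence in the quartic. -/
noncomputable def param8_2 : Option (Fin 8) → MvPolynomial (Fin 3) ℚ := fun o =>
  o.elim (-1 - halfDiff - halfDiff ^ 2)
    ![halfDiff, -1 - halfDiff, -halfDiff, -(-1 - halfDiff), halfSum, -halfSum, halfRoot,
      -halfRoot]

lemma aeval_param8_2 {L : Type*} [Field L] [Algebra ℚ L] (t s : L) (v : Fin 8) :
    MvPolynomial.aeval ![t, t⁻¹, s] (param8_2 (some v)) =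
      ![(t⁻¹ - t) / 2, -1 - (t⁻¹ - t) / 2, -((t⁻¹ - t) / 2), -(-1 - (t⁻¹ - t) / 2),
        (t + t⁻¹) / 2, -((t + t⁻¹) / 2), s / (2 * t), -(s / (2 * t))] v := by
  fin_cases v <;> simp [param8_2, aeval_halfSum, aeval_halfDiff, aeval_halfRoot]

lemma aeval_param8_2_none {L : Type*} [Field L] [Algebra ℚ L] (t s : L) :
    MvPolynomial.aeval ![t, t⁻¹, s] (param8_2 none) =
      -1 - (t⁻¹ - t) / 2 - ((t⁻¹ - t) / 2) ^ 2 := by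
  simp [param8_2, aeval_halfDiff]

lemma graph8_2a_isAdmissible : IsAdmissible graph8_2a Set.univ :=
  isAdmissible_univ _ (by decide) (by decide) (by decide)

theorem graph8_2a_isIsomorphicTo : IsIsomorphicTo graph8_2a curve40A3 := by
  refine isIsomorphicTo_of_quartic (q := quartic (-4) 6 4) graph8_2a_isAdmissible curve40A3
    (sq_ne_of_not_isSquare_eval_one (by rw [eval_one_quartic]; norm_num)) param8_2 ?_ ?_ ?_ ?_
    exists_generators_curve40A3
  · intro L _ _ t s ht hs v
    have := charZero_of_algebra L
    rw [aeval_quartic] at hs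
    simp only [map_neg, map_ofNat] at hs
    rw [aeval_param8_2, aeval_param8_2, aeval_param8_2_none]
    fin_cases v <;> simp [graph8_2a] <;> field_simp <;>
      first | ring1 | linear_combination hs | linear_combination -hs
  · have hsq : √(17 : ℝ) ^ 2 = 17 := Real.sq_sqrt (by norm_num)
    have h0 := Real.sqrt_nonneg (17 : ℝ)
    have h1 : 4 < √(17 : ℝ) := by nlinarith
    have h2 : √(17 : ℝ) < 4.2 := by nlinarith
    refine ⟨2, √17, by norm_num, ?_, ?_⟩
    · rw [hsq, aeval_quartic]; norm_num
    · -- the vertices in increasing order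
      refine injective_of_strictMono_comp (σ := ![5, 7, 0, 1, 3, 2, 6, 4]) (by decide)
        (Fin.strictMono_iff_lt_succ.2 fun i => ?_)
      simp only [Function.comp_apply, aeval_param8_2]
      fin_cases i <;> simp <;> linarith
  · intro ψ b hψ h
    have e0 := h 0
    have e1 := h 1
    have e4 := h 4
    have e6 := h 6
    have n2 := eq_neg_of_equivariant (v := 0) (w := 2) hψ h (by decide) rfl
    have n3 := eq_neg_of_equivariant (v := 1) (w := 3) hψ h (by decide) rfl
    have n5 := eq_neg_of_equivariant (v := 4) (w := 5) hψ h (by decide) rfl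
    have n7 := eq_neg_of_equivariant (v := 6) (w := 7) hψ h (by decide) rfl
    simp only [graph8_2a, Matrix.cons_val] at e0 e1 e4 e6
    have n1 := eq_neg_one_sub_of_cycle (hψ.ne (by decide)) e0 e1
    -- the vertices other than the last square roots lie on a conic, parametrised by `t`
    have htv : (ψ 4 - ψ 0) * (ψ 4 + ψ 0) = 1 := by
      linear_combination -e4 + n2 + e0 - n1
    obtain ⟨t, ht⟩ : ∃ t, t = ψ 4 - ψ 0 := ⟨_, rfl⟩
    rw [← ht] at htv
    have ht0 : t ≠ 0 := left_ne_zero_of_mul_eq_one htv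
    have htinv := inv_eq_of_mul_eq_one_right htv
    have v0 : ψ 0 = (t⁻¹ - t) / 2 := by rw [htinv, ht]; ring
    have v4 : ψ 4 = (t + t⁻¹) / 2 := by rw [htinv, ht]; ring
    have vb : b = -1 - (t⁻¹ - t) / 2 - ((t⁻¹ - t) / 2) ^ 2 := by
      rw [n1, v0] at e0
      linear_combination -e0
    rw [n3, n1, v0, vb] at e6
    refine ⟨t, 2 * t * ψ 6, ht0, ?_, fun v => ?_, ?_⟩
    · rw [aeval_quartic]
      simp only [map_neg, map_ofNat]
      field_simp at e6
      linear_combination -e6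
    · rw [aeval_param8_2]
      fin_cases v <;> simp [n1, n2, n3, n5, n7, v0, v4] <;> field_simp
    · rw [aeval_param8_2_none, vb]
  · intro L _ _ t s ht hs B hB
    have := charZero_of_algebra L
    have h0 := hB 0
    have hu := hB 4
    have hw := hB 6
    rw [aeval_param8_2] at h0 hu hw
    simp only [Matrix.cons_val] at h0 hu hw
    have ht : t ∈ B := by
      convert B.sub_mem hu h0 using 1
      ring
    refine ⟨ht, ?_⟩
    convert B.mul_mem (B.mul_mem hw (ofNat_mem B 2)) ht using 1
    field_simp

lemma graph8_2b_isAdmissible : IsAdmissible graph8_2b Set.univ :=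
  isAdmissible_univ _ (by decide) (by decide) (by decide)

theorem graph8_2b_isIsomorphicTo : IsIsomorphicTo graph8_2b curve11A3 := by
  refine isIsomorphicTo_of_quartic (q := quartic 0 2 4) graph8_2b_isAdmissible curve11A3
    (sq_ne_of_not_isSquare_eval_one (by rw [eval_one_quartic]; norm_num)) param8_2 ?_ ?_ ?_ ?_
    exists_generators_curve11A3
  · intro L _ _ t s ht hs v
    have := charZero_of_algebra L
    rw [aeval_quartic] at hs
    simp only [map_zero, map_ofNat] at hs
    rw [aeval_param8_2, aeval_param8_2, aeval_param8_2_none]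
    fin_cases v <;> simp [graph8_2b] <;> field_simp <;>
      first | ring1 | linear_combination hs | linear_combination -hs
  · have hsq : √(33 : ℝ) ^ 2 = 33 := Real.sq_sqrt (by norm_num)
    have h0 := Real.sqrt_nonneg (33 : ℝ)
    have h1 : 5.7 < √(33 : ℝ) := by nlinarith
    have h2 : √(33 : ℝ) < 5.8 := by nlinarith
    refine ⟨2, √33, by norm_num, ?_, ?_⟩
    · rw [hsq, aeval_quartic]; norm_num
    · -- the vertices in increasing order
      refine injective_of_strictMono_comp (σ := ![7, 5, 0, 1, 3, 2, 4, 6]) (by decide)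
        (Fin.strictMono_iff_lt_succ.2 fun i => ?_)
      simp only [Function.comp_apply, aeval_param8_2]
      fin_cases i <;> simp <;> linarith
  · intro ψ b hψ h
    have e0 := h 0
    have e1 := h 1
    have e4 := h 4
    have e6 := h 6
    have n2 := eq_neg_of_equivariant (v := 0) (w := 2) hψ h (by decide) rfl
    have n3 := eq_neg_of_equivariant (v := 1) (w := 3) hψ h (by decide) rfl
    have n5 := eq_neg_of_equivariant (v := 4) (w := 5) hψ h (by decide) rfl
    have n7 := eq_neg_of_equivariant (v := 6) (w := 7) hψ h (by decide) rfl
    simp only [graph8_2b, Matrix.cons_val] at e0 e1 e4 e6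
    have n1 := eq_neg_one_sub_of_cycle (hψ.ne (by decide)) e0 e1
    -- the vertices other than the last square roots lie on a conic, parametrised by `t`
    have htv : (ψ 4 - ψ 0) * (ψ 4 + ψ 0) = 1 := by
      linear_combination -e4 + n2 + e0 - n1
    obtain ⟨t, ht⟩ : ∃ t, t = ψ 4 - ψ 0 := ⟨_, rfl⟩
    rw [← ht] at htv
    have ht0 : t ≠ 0 := left_ne_zero_of_mul_eq_one htv
    have htinv := inv_eq_of_mul_eq_one_right htv
    have v0 : ψ 0 = (t⁻¹ - t) / 2 := by rw [htinv, ht]; ring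
    have v4 : ψ 4 = (t + t⁻¹) / 2 := by rw [htinv, ht]; ring
    have vb : b = -1 - (t⁻¹ - t) / 2 - ((t⁻¹ - t) / 2) ^ 2 := by
      rw [n1, v0] at e0
      linear_combination -e0
    rw [v4, vb] at e6
    refine ⟨t, 2 * t * ψ 6, ht0, ?_, fun v => ?_, ?_⟩
    · rw [aeval_quartic]
      simp only [map_zero, map_ofNat]
      field_simp at e6
      linear_combination -e6
    · rw [aeval_param8_2]
      fin_cases v <;> simp [n1, n2, n3, n5, n7, v0, v4] <;> field_simp
    · rw [aeval_param8_2_none, vb]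
  · intro L _ _ t s ht hs B hB
    have := charZero_of_algebra L
    have h0 := hB 0
    have hu := hB 4
    have hw := hB 6
    rw [aeval_param8_2] at h0 hu hw
    simp only [Matrix.cons_val] at h0 hu hw
    have ht : t ∈ B := by
      convert B.sub_mem hu h0 using 1
      ring
    refine ⟨ht, ?_⟩
    convert B.mul_mem (B.mul_mem hw (ofNat_mem B 2)) ht using 1
    field_simp

/-- The vertices of 10(2,1,1)a and the parameter `c`, in terms of `t` and `s`. -/
noncomputable def param10_211a : Option (Fin 10) → MvPolynomial (Fin 3) ℚ := fun o =>
  o.elim (MvPolynomial.C (1 / 4) - halfSum ^ 2)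
    ![-MvPolynomial.C (1 / 2) + halfDiff, -MvPolynomial.C (1 / 2) - halfDiff,
      MvPolynomial.C (1 / 2) - halfDiff, MvPolynomial.C (1 / 2) + halfDiff, halfRoot, -halfRoot,
      MvPolynomial.C (1 / 2) + halfSum, -(MvPolynomial.C (1 / 2) + halfSum),
      MvPolynomial.C (1 / 2) - halfSum, -(MvPolynomial.C (1 / 2) - halfSum)]

lemma aeval_param10_211a {L : Type*} [Field L] [Algebra ℚ L] (t s : L) (v : Fin 10) :
    MvPolynomial.aeval ![t, t⁻¹, s] (param10_211a (some v)) =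
      ![-(1 / 2) + ((t⁻¹ - t) / 2), -(1 / 2) - ((t⁻¹ - t) / 2), (1 / 2) - ((t⁻¹ - t) / 2),
        (1 / 2) + ((t⁻¹ - t) / 2), (s / (2 * t)), -(s / (2 * t)), (1 / 2) + ((t + t⁻¹) / 2),
        -((1 / 2) + ((t + t⁻¹) / 2)), (1 / 2) - ((t + t⁻¹) / 2),
        -((1 / 2) - ((t + t⁻¹) / 2))] v := by
  fin_cases v <;> simp [param10_211a, aeval_halfSum, aeval_halfDiff, aeval_halfRoot]

lemma aeval_param10_211a_none {L : Type*} [Field L] [Algebra ℚ L] (t s : L) :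
    MvPolynomial.aeval ![t, t⁻¹, s] (param10_211a none) = 1 / 4 - ((t + t⁻¹) / 2) ^ 2 := by
  simp [param10_211a, aeval_halfSum]

lemma graph10_211a_isAdmissible : IsAdmissible graph10_211a Set.univ :=
  isAdmissible_univ _ (by decide) (by decide) (by decide)

theorem graph10_211a_isIsomorphicTo : IsIsomorphicTo graph10_211a curve17A4 := by
  refine isIsomorphicTo_of_quartic (q := quartic 2 3 (-2)) graph10_211a_isAdmissible curve17A4
    (sq_ne_of_not_isSquare_eval_one (by rw [eval_one_quartic]; norm_num)) param10_211a ?_ ?_ ?_ ?_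
    exists_generators_curve17A4
  · intro L _ _ t s ht hs v
    have := charZero_of_algebra L
    rw [aeval_quartic] at hs
    simp only [map_neg, map_ofNat] at hs
    rw [aeval_param10_211a, aeval_param10_211a, aeval_param10_211a_none]
    fin_cases v <;> simp [graph10_211a] <;> field_simp <;>
      first | ring1 | linear_combination 4 * hs | linear_combination -4 * hs
  · have hsq : √(41 : ℝ) ^ 2 = 41 := Real.sq_sqrt (by norm_num)
    have h0 := Real.sqrt_nonneg (41 : ℝ)
    have h1 : 6.4 < √(41 : ℝ) := by nlinarith
    have h2 : √(41 : ℝ) < 6.5 := by nlinarith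
    refine ⟨2, √41, by norm_num, ?_, ?_⟩
    · rw [hsq, aeval_quartic]; norm_num
    · -- the vertices in increasing order
      refine injective_of_strictMono_comp (σ := ![7, 5, 0, 8, 3, 1, 9, 2, 4, 6]) (by decide)
        (Fin.strictMono_iff_lt_succ.2 fun i => ?_)
      simp only [Function.comp_apply, aeval_param10_211a]
      fin_cases i <;> simp <;> linarith
  · intro ψ b hψ h
    have e0 := h 0
    have e1 := h 1
    have e4 := h 4
    have e6 := h 6
    have e8 := h 8
    have n2 := eq_neg_of_equivariant (v := 0) (w := 2) hψ h (by decide) rfl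
    have n3 := eq_neg_of_equivariant (v := 1) (w := 3) hψ h (by decide) rfl
    have n5 := eq_neg_of_equivariant (v := 4) (w := 5) hψ h (by decide) rfl
    have n7 := eq_neg_of_equivariant (v := 6) (w := 7) hψ h (by decide) rfl
    have n9 := eq_neg_of_equivariant (v := 8) (w := 9) hψ h (by decide) rfl
    simp only [graph10_211a, Matrix.cons_val] at e0 e1 e4 e6 e8
    have n1 := eq_neg_one_sub_of_cycle (hψ.ne (by decide)) e0 e1
    have n8 := eq_one_sub_of_fixed (hψ.ne (by decide)) e6 e8
    -- the vertices other than the last square roots lie on a conic, parametrised by `t`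
    have htv : (ψ 6 - ψ 0 - 1) * (ψ 6 + ψ 0) = 1 := by
      linear_combination -e6 + e0 - n1
    obtain ⟨t, ht⟩ : ∃ t, t = ψ 6 - ψ 0 - 1 := ⟨_, rfl⟩
    rw [← ht] at htv
    have ht0 : t ≠ 0 := left_ne_zero_of_mul_eq_one htv
    have htinv := inv_eq_of_mul_eq_one_right htv
    have v0 : ψ 0 = -1 / 2 + (t⁻¹ - t) / 2 := by rw [htinv, ht]; ring
    have v6 : ψ 6 = 1 / 2 + (t + t⁻¹) / 2 := by rw [htinv, ht]; ring
    have vb : b = 1 / 4 - ((t + t⁻¹) / 2) ^ 2 := by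
      rw [v6] at e6
      linear_combination -e6
    rw [n2, v0, vb] at e4
    refine ⟨t, 2 * t * ψ 4, ht0, ?_, fun v => ?_, ?_⟩
    · rw [aeval_quartic]
      simp only [map_neg, map_ofNat]
      field_simp at e4
      linear_combination -e4 / 4
    · rw [aeval_param10_211a]
      fin_cases v <;> simp [n1, n2, n3, n5, n7, n8, n9, v0, v6] <;> field_simp <;> ring
    · rw [aeval_param10_211a_none, vb]
  · intro L _ _ t s ht hs B hB
    have := charZero_of_algebra L
    have h0 := hB 0
    have hu := hB 6
    have hw := hB 4
    rw [aeval_param10_211a] at h0 hu hw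
    simp only [Matrix.cons_val] at h0 hu hw
    have ht : t ∈ B := by
      convert B.sub_mem (B.sub_mem hu h0) B.one_mem using 1
      ring
    refine ⟨ht, ?_⟩
    convert B.mul_mem (B.mul_mem hw (ofNat_mem B 2)) ht using 1
    field_simp

/-- The vertices of 10(2,1,1)b and the parameter `c`, in terms of `t` and `s`. -/
noncomputable def param10_211b : Option (Fin 10) → MvPolynomial (Fin 3) ℚ := fun o =>
  o.elim (MvPolynomial.C (1 / 4) - halfSum ^ 2)
    ![MvPolynomial.C (1 / 2) + halfSum, -(MvPolynomial.C (1 / 2) + halfSum),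
      MvPolynomial.C (1 / 2) - halfSum, -(MvPolynomial.C (1 / 2) - halfSum), halfRoot, -halfRoot,
      -MvPolynomial.C (1 / 2) + halfDiff, -MvPolynomial.C (1 / 2) - halfDiff,
      MvPolynomial.C (1 / 2) - halfDiff, MvPolynomial.C (1 / 2) + halfDiff]

lemma aeval_param10_211b {L : Type*} [Field L] [Algebra ℚ L] (t s : L) (v : Fin 10) :
    MvPolynomial.aeval ![t, t⁻¹, s] (param10_211b (some v)) =
      ![(1 / 2) + ((t + t⁻¹) / 2), -((1 / 2) + ((t + t⁻¹) / 2)), (1 / 2) - ((t + t⁻¹) / 2),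
        -((1 / 2) - ((t + t⁻¹) / 2)), (s / (2 * t)), -(s / (2 * t)), -(1 / 2) + ((t⁻¹ - t) / 2),
        -(1 / 2) - ((t⁻¹ - t) / 2), (1 / 2) - ((t⁻¹ - t) / 2), (1 / 2) + ((t⁻¹ - t) / 2)] v := by
  fin_cases v <;> simp [param10_211b, aeval_halfSum, aeval_halfDiff, aeval_halfRoot]

lemma aeval_param10_211b_none {L : Type*} [Field L] [Algebra ℚ L] (t s : L) :
    MvPolynomial.aeval ![t, t⁻¹, s] (param10_211b none) = 1 / 4 - ((t + t⁻¹) / 2) ^ 2 := by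
  simp [param10_211b, aeval_halfSum]

lemma graph10_211b_isAdmissible : IsAdmissible graph10_211b Set.univ :=
  isAdmissible_univ _ (by decide) (by decide) (by decide)

theorem graph10_211b_isIsomorphicTo : IsIsomorphicTo graph10_211b curve15A8 := by
  refine isIsomorphicTo_of_quartic (q := quartic (-2) (-1) (-2)) graph10_211b_isAdmissible curve15A8
    (sq_ne_of_not_isSquare_eval_one (by rw [eval_one_quartic]; norm_num)) param10_211b ?_ ?_ ?_ ?_
    exists_generators_curve15A8
  · intro L _ _ t s ht hs v
    have := charZero_of_algebra L
    rw [aeval_quartic] at hs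
    simp only [map_neg, map_one, map_ofNat] at hs
    rw [aeval_param10_211b, aeval_param10_211b, aeval_param10_211b_none]
    fin_cases v <;> simp [graph10_211b] <;> field_simp <;>
      first | ring1 | linear_combination 4 * hs | linear_combination -4 * hs
  · have hsq : √(13 : ℝ) ^ 2 = 13 := Real.sq_sqrt (by norm_num)
    have h0 := Real.sqrt_nonneg (13 : ℝ)
    have h1 : 3.6 < √(13 : ℝ) := by nlinarith
    have h2 : √(13 : ℝ) < 3.61 := by nlinarith
    refine ⟨3, √13, by norm_num, ?_, ?_⟩
    · rw [hsq, aeval_quartic]; norm_num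
    · -- the vertices in increasing order
      refine injective_of_strictMono_comp (σ := ![1, 6, 2, 9, 5, 4, 7, 3, 8, 0]) (by decide)
        (Fin.strictMono_iff_lt_succ.2 fun i => ?_)
      simp only [Function.comp_apply, aeval_param10_211b]
      fin_cases i <;> simp <;> linarith
  · intro ψ b hψ h
    have e0 := h 0
    have e2 := h 2
    have e4 := h 4
    have e6 := h 6
    have e7 := h 7
    have n1 := eq_neg_of_equivariant (v := 0) (w := 1) hψ h (by decide) rfl
    have n3 := eq_neg_of_equivariant (v := 2) (w := 3) hψ h (by decide) rfl
    have n5 := eq_neg_of_equivariant (v := 4) (w := 5) hψ h (by decide) rfl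
    have n8 := eq_neg_of_equivariant (v := 6) (w := 8) hψ h (by decide) rfl
    have n9 := eq_neg_of_equivariant (v := 7) (w := 9) hψ h (by decide) rfl
    simp only [graph10_211b, Matrix.cons_val] at e0 e2 e4 e6 e7
    have n7 := eq_neg_one_sub_of_cycle (hψ.ne (by decide)) e6 e7
    have n2 := eq_one_sub_of_fixed (hψ.ne (by decide)) e0 e2
    -- the vertices other than the last square roots lie on a conic, parametrised by `t`
    have htv : (ψ 0 - ψ 6 - 1) * (ψ 0 + ψ 6) = 1 := by
      linear_combination -e0 + e6 - n7
    obtain ⟨t, ht⟩ : ∃ t, t = ψ 0 - ψ 6 - 1 := ⟨_, rfl⟩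
    rw [← ht] at htv
    have ht0 : t ≠ 0 := left_ne_zero_of_mul_eq_one htv
    have htinv := inv_eq_of_mul_eq_one_right htv
    have v0 : ψ 0 = 1 / 2 + (t + t⁻¹) / 2 := by rw [htinv, ht]; ring
    have v6 : ψ 6 = -1 / 2 + (t⁻¹ - t) / 2 := by rw [htinv, ht]; ring
    have vb : b = 1 / 4 - ((t + t⁻¹) / 2) ^ 2 := by
      rw [v0] at e0
      linear_combination -e0
    rw [n1, v0, vb] at e4
    refine ⟨t, 2 * t * ψ 4, ht0, ?_, fun v => ?_, ?_⟩
    · rw [aeval_quartic]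
      simp only [map_neg, map_one, map_ofNat]
      field_simp at e4
      linear_combination -e4 / 4
    · rw [aeval_param10_211b]
      fin_cases v <;> simp [n1, n2, n3, n5, n7, n8, n9, v0, v6] <;> field_simp <;> ring
    · rw [aeval_param10_211b_none, vb]
  · intro L _ _ t s ht hs B hB
    have := charZero_of_algebra L
    have h0 := hB 0
    have hu := hB 6
    have hw := hB 4
    rw [aeval_param10_211b] at h0 hu hw
    simp only [Matrix.cons_val] at h0 hu hw
    have ht : t ∈ B := by
      convert B.sub_mem (B.sub_mem h0 hu) B.one_mem using 1
      ring
    refine ⟨ht, ?_⟩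
    convert B.mul_mem (B.mul_mem hw (ofNat_mem B 2)) ht using 1
    field_simp

end DynModCurve

/-! ### Arithmetic of quadratic fields -/

namespace DynModCurve

section QuadraticField

variable {K : Type*} [Field K] [Algebra ℚ K] {d : ℤ} {s : K}

/-- Every element of `ℚ(s)`, where `s² = d`, has the form `a + b s`. -/
lemma exists_add_mul_sqrt (hs : s ^ 2 = (d : K)) (hK : IntermediateField.adjoin ℚ {s} = ⊤) (z : K) :
    ∃ a b : ℚ, z = a + b * s := by
  have := charZero_of_algebra K
  have hint : IsIntegral ℚ s := by
    refine IsIntegral.of_pow two_pos ?_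
    rw [hs]
    simpa using isIntegral_algebraMap (R := ℚ) (A := K) (x := (d : ℚ))
  have hz : z ∈ Algebra.adjoin ℚ {s} := by
    rw [← IntermediateField.adjoin_simple_toSubalgebra_of_isAlgebraic hint.isAlgebraic, hK]
    trivial
  induction hz using Algebra.adjoin_induction with
  | mem x hx => exact ⟨0, 1, by rw [Set.mem_singleton_iff.1 hx]; simp⟩
  | algebraMap r => exact ⟨r, 0, by simp⟩
  | add x y _ _ hx hy =>
    obtain ⟨a, b, rfl⟩ := hx
    obtain ⟨a', b', rfl⟩ := hy
    exact ⟨a + a', b + b', by push_cast; ring⟩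
  | mul x y _ _ hx hy =>
    obtain ⟨a, b, rfl⟩ := hx
    obtain ⟨a', b', rfl⟩ := hy
    exact ⟨a * a' + b * b' * d, a * b' + a' * b, by push_cast; linear_combination (b * b' : K) * hs⟩

lemma eq_one_of_squarefree_of_sq {d : ℤ} (hd : Squarefree d) {q : ℚ} (h : q ^ 2 = d) : d = 1 := by
  have hsq : IsSquare d := by
    have : IsSquare (d : ℚ) := ⟨q, by rw [← h, sq]⟩
    exact_mod_cast Rat.isSquare_intCast_iff.1 this
  obtain ⟨r, rfl⟩ := hsq
  have := hd r dvd_rfl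
  rcases Int.isUnit_iff.1 this with rfl | rfl <;> rfl

lemma eq_zero_of_add_mul_sqrt_eq_zero (hd : Squarefree d) (hd1 : d ≠ 1) (hs : s ^ 2 = (d : K))
    {a b : ℚ} (h : (a : K) + b * s = 0) : a = 0 ∧ b = 0 := by
  have := charZero_of_algebra K
  have hb : b = 0 := by
    by_contra hb
    refine hd1 (eq_one_of_squarefree_of_sq hd (q := a / b) ?_)
    have h2 : ((a ^ 2 : ℚ) : K) = ((d * b ^ 2 : ℚ) : K) := by
      push_cast
      linear_combination (a - b * s : K) * h + (b : K) ^ 2 * hs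
    rw [div_pow, div_eq_iff (pow_ne_zero 2 hb)]
    exact_mod_cast h2
  subst hb
  simpa using h

/-- The elements `a + b s` and `a' + b' s` agree only if their coordinates do. -/
lemma coord_eq (hd : Squarefree d) (hd1 : d ≠ 1) (hs : s ^ 2 = (d : K)) {a b a' b' : ℚ}
    (h : (a : K) + b * s = a' + b' * s) : a = a' ∧ b = b' := by
  have h' : ((a - a' : ℚ) : K) + ((b - b' : ℚ) : K) * s = 0 := by
    have := charZero_of_algebra K
    push_cast
    linear_combination h
  obtain ⟨h1, h2⟩ := eq_zero_of_add_mul_sqrt_eq_zero hd hd1 hs h'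
  exact ⟨sub_eq_zero.1 h1, sub_eq_zero.1 h2⟩

/-- If two squarefree integers differ by a rational square factor, they are equal. -/
lemma eq_of_squarefree_of_mul_sq {r d : ℤ} (hr : Squarefree r) (hd : Squarefree d) {q : ℚ}
    (h : (r : ℚ) = d * q ^ 2) : r = d := by
  have hd0 : (d : ℚ) ≠ 0 := by exact_mod_cast hd.ne_zero
  have hsq : IsSquare (r * d) := by
    have : IsSquare ((r * d : ℤ) : ℚ) := ⟨d * q, by push_cast; rw [h]; ring⟩
    exact Rat.isSquare_intCast_iff.1 this
  obtain ⟨m, hm⟩ := hsq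
  obtain ⟨k, rfl⟩ := (hr.dvd_pow_iff_dvd two_ne_zero).1 (Dvd.intro d (by rw [hm, sq]) : r ∣ m ^ 2)
  have hdk : d = r * (k * k) := mul_left_cancel₀ hr.ne_zero (by rw [hm]; ring)
  rcases Int.isUnit_iff.1 (hd k ⟨r, by rw [hdk]; ring⟩) with rfl | rfl <;> simpa using hdk.symm

/-- A squarefree integer that is a square in `ℚ(√d)` is `1` or `d`. -/
lemma eq_one_or_eq_of_sq (hd : Squarefree d) (hs : s ^ 2 = (d : K))
    (hK : IntermediateField.adjoin ℚ {s} = ⊤) {r : ℤ} (hr : Squarefree r) {z : K}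
    (hz : z ^ 2 = (r : K)) : r = 1 ∨ r = d := by
  have := charZero_of_algebra K
  obtain ⟨a, b, rfl⟩ := exists_add_mul_sqrt hs hK z
  by_cases hd1 : d = 1
  · subst hd1
    left
    have hs' : s = 1 ∨ s = -1 := by
      simpa using hs
    rcases hs' with rfl | rfl
    · exact eq_one_of_squarefree_of_sq hr (q := a + b) (by
        have : (((a + b) ^ 2 : ℚ) : K) = (r : ℚ) := by push_cast; linear_combination hz
        exact_mod_cast this)
    · exact eq_one_of_squarefree_of_sq hr (q := a - b) (by
        have : (((a - b) ^ 2 : ℚ) : K) = (r : ℚ) := by push_cast; linear_combination hz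
        exact_mod_cast this)
  · have h1 : ((a ^ 2 + d * b ^ 2 : ℚ) : K) + ((2 * a * b : ℚ) : K) * s = ((r : ℚ) : K) +
      ((0 : ℚ) : K) * s := by
      push_cast
      linear_combination hz - (b : K) ^ 2 * hs
    obtain ⟨h2, h3⟩ := coord_eq hd hd1 hs h1
    rcases mul_eq_zero.1 h3 with h | rfl
    · obtain rfl : a = 0 := by linarith
      right
      exact eq_of_squarefree_of_mul_sq hr hd (q := b) (by rw [← h2]; ring)
    · left
      exact eq_one_of_squarefree_of_sq hr (q := a) (by rw [← h2]; ring)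

/-- The norm of a square of `ℚ(√d)` is the square of a rational number. -/
lemma isSquare_norm_of_sq (hd : Squarefree d) (hd1 : d ≠ 1) (hs : s ^ 2 = (d : K))
    (hK : IntermediateField.adjoin ℚ {s} = ⊤) {α β : ℚ} {z : K} (hz : z ^ 2 = α + β * s) :
    IsSquare (α ^ 2 - d * β ^ 2) := by
  have := charZero_of_algebra K
  obtain ⟨a, b, rfl⟩ := exists_add_mul_sqrt hs hK z
  have h1 : ((a ^ 2 + d * b ^ 2 : ℚ) : K) + ((2 * a * b : ℚ) : K) * s = (α : K) + (β : K) * s := by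
    push_cast
    linear_combination hz - (b : K) ^ 2 * hs
  obtain ⟨h2, h3⟩ := coord_eq hd hd1 hs h1
  exact ⟨a ^ 2 - d * b ^ 2, by rw [← h2, ← h3]; ring⟩

end QuadraticField

end DynModCurve

/-! ### A two-adic absolute value -/

namespace DynModCurve

open NumberField IsDedekindDomain

/-- An absolute value above the prime `2` of a number field of degree at most `2`: nonarchimedean,
with residue field `𝔽₂` or `𝔽₄`.  If `|u|² = |2|`, then `2` is ramified, so that `u` is a
uniformizer, the residue field is `𝔽₂` and the unit `u² / 2` is congruent to `1`. -/
structure IsTwoAdic {K : Type*} [Field K] (v : AbsoluteValue K ℝ) : Prop where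
  add_le : ∀ x y, v (x + y) ≤ max (v x) (v y)
  two_lt : v 2 < 1
  pow_four : ∀ x, v x ≤ 1 → v (x ^ 4 - x) < 1
  ramified : ∀ u, v u ^ 2 = v 2 → v (u ^ 2 - 2) ≤ v u ^ 3

section Ultrametric

variable {K : Type*} [Field K] {v : AbsoluteValue K ℝ}

lemma abv_add_lt (hv : ∀ x y, v (x + y) ≤ max (v x) (v y))
    {x y : K} {r : ℝ} (hx : v x < r) (hy : v y < r) : v (x + y) < r :=
  (hv x y).trans_lt (max_lt hx hy)

lemma abv_add_le (hv : ∀ x y, v (x + y) ≤ max (v x) (v y))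
    {x y : K} {r : ℝ} (hx : v x ≤ r) (hy : v y ≤ r) : v (x + y) ≤ r :=
  (hv x y).trans (max_le hx hy)

lemma abv_sub_lt (hv : ∀ x y, v (x + y) ≤ max (v x) (v y))
    {x y : K} {r : ℝ} (hx : v x < r) (hy : v y < r) : v (x - y) < r := by
  rw [sub_eq_add_neg]
  exact abv_add_lt hv hx (by rwa [v.map_neg])

lemma abv_sub_le (hv : ∀ x y, v (x + y) ≤ max (v x) (v y))
    {x y : K} {r : ℝ} (hx : v x ≤ r) (hy : v y ≤ r) : v (x - y) ≤ r := by
  rw [sub_eq_add_neg]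
  exact abv_add_le hv hx (by rwa [v.map_neg])

lemma abv_add_eq_left (hv : ∀ x y, v (x + y) ≤ max (v x) (v y))
    {x y : K} (h : v y < v x) : v (x + y) = v x := by
  refine le_antisymm (abv_add_le hv le_rfl h.le) ?_
  by_contra! hlt
  have := abv_sub_lt hv hlt h
  rw [add_sub_cancel_right] at this
  exact lt_irrefl _ this

lemma abv_intCast_le (hv : ∀ x y, v (x + y) ≤ max (v x) (v y)) (n : ℤ) : v n ≤ 1 := by
  have h : ∀ m : ℕ, v (m : K) ≤ 1 := by
    intro m
    induction m with
    | zero => simp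
    | succ m ih =>
      rw [Nat.cast_succ]
      exact abv_add_le hv ih (by rw [map_one])
  obtain ⟨m, rfl | rfl⟩ := n.eq_nat_or_neg
  · simpa using h m
  · simpa using h m

lemma abv_sq_sub_sq_lt (hv : ∀ x y, v (x + y) ≤ max (v x) (v y))
    {x y : K} (hx : v x ≤ 1) (hy : v y ≤ 1) (h : v (x - y) < 1) :
    v (x ^ 2 - y ^ 2) < 1 := by
  rw [sq_sub_sq, map_mul]
  exact mul_lt_one_of_nonneg_of_lt_one_right (abv_add_le hv hx hy) (v.nonneg _) h

end Ultrametric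

lemma exists_isTwoAdic_of_finrank_le_two {K : Type*} [Field K] [NumberField K]
    (h2 : Module.finrank ℚ K ≤ 2) : ∃ v : AbsoluteValue K ℝ, IsTwoAdic v := by
  have hpos : 0 < Module.finrank ℚ K := Module.finrank_pos
  have hnorm : Ideal.absNorm (Ideal.span {((2 : ℕ) : 𝓞 K)}) = 2 ^ Module.finrank ℚ K := by
    rw [Ideal.absNorm_span_natCast, RingOfIntegers.rank]
  have hne : Ideal.span {((2 : ℕ) : 𝓞 K)} ≠ ⊤ := by
    rw [Ne, ← Ideal.absNorm_eq_one_iff, hnorm]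
    exact (Nat.one_lt_two_pow hpos.ne').ne'
  obtain ⟨P, hP, hle⟩ := Ideal.exists_le_maximal _ hne
  have hmem : (2 : 𝓞 K) ∈ P := hle (Ideal.mem_span_singleton_self _)
  have hbot : P ≠ ⊥ := by
    rintro rfl
    exact two_ne_zero ((Ideal.mem_bot).1 hmem)
  let w : HeightOneSpectrum (𝓞 K) := ⟨P, hP.isPrime, hbot⟩
  have hdvd : Ideal.absNorm P ∣ 2 ^ Module.finrank ℚ K :=
      hnorm ▸ Ideal.absNorm_dvd_absNorm_of_le hle
  have hP1 : Ideal.absNorm P ≠ 1 := by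
    rw [Ne, Ideal.absNorm_eq_one_iff]
    exact hP.ne_top
  have hcases : Ideal.absNorm P = 2 ∨ (Ideal.absNorm P = 4 ∧ Module.finrank ℚ K = 2) := by
    obtain ⟨k, hk, hk'⟩ := (Nat.dvd_prime_pow Nat.prime_two).1 hdvd
    have : k ≠ 0 := by rintro rfl; exact hP1 hk'
    have : k = 1 ∨ k = 2 := by omega
    rcases this with rfl | rfl
    · exact Or.inl hk'
    · exact Or.inr ⟨hk', by omega⟩
  let _ : Field (𝓞 K ⧸ P) := Ideal.Quotient.field P
  have hcard : Nat.card (𝓞 K ⧸ P) = Ideal.absNorm P := rfl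
  have : Finite (𝓞 K ⧸ P) := Nat.finite_of_card_ne_zero (by
    rw [hcard]; rcases hcases with h | h <;> omega)
  let _ : Fintype (𝓞 K ⧸ P) := Fintype.ofFinite _
  have hpow : ∀ n : 𝓞 K, n ^ Ideal.absNorm P - n ∈ P := by
    intro n
    rw [← Ideal.Quotient.eq_zero_iff_mem, map_sub, map_pow, ← hcard, Nat.card_eq_fintype_card,
      FiniteField.pow_card, sub_self]
  set v := HeightOneSpectrum.adicAbv K w with hv
  have hb := HeightOneSpectrum.one_lt_absNorm_nnreal w
  have hadd : ∀ x y, v (x + y) ≤ max (v x) (v y) := HeightOneSpectrum.isNonarchimedean_adicAbv K w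
  have hlt : ∀ r : 𝓞 K, v (algebraMap (𝓞 K) K r) < 1 ↔ r ∈ P :=
    fun r => w.adicAbv_coe_lt_one_iff hb r
  have hle1 : ∀ r : 𝓞 K, v (algebraMap (𝓞 K) K r) ≤ 1 := fun r => w.adicAbv_coe_le_one hb r
  have hmono : StrictMono (WithZeroMulInt.toNNReal (HeightOneSpectrum.absNorm_ne_zero w)) :=
    WithZeroMulInt.toNNReal_strictMono hb
  have hdef : ∀ x, v x = (WithZeroMulInt.toNNReal (HeightOneSpectrum.absNorm_ne_zero w)
      (w.valuation K x) : ℝ) := fun x => rfl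
  have happrox : ∀ x, v x ≤ 1 → ∃ n : 𝓞 K, v (x - algebraMap (𝓞 K) K n) < 1 := by
    intro x hx
    have hx' : w.valuation K x ≤ 1 := by
      rw [← hmono.le_iff_le, map_one]
      exact_mod_cast hx
    obtain ⟨n, hn⟩ := w.exists_valuation_sub_lt_of_integer hx' 1
    refine ⟨n, ?_⟩
    rw [← v.map_neg, neg_sub]
    have := hmono hn
    rw [Units.val_one, map_one] at this
    exact_mod_cast this
  have hres : ∀ x, v x ≤ 1 → v (x ^ Ideal.absNorm P - x) < 1 := by
    intro x hx
    obtain ⟨n, hn⟩ := happrox x hx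
    have hn1 := hle1 n
    have hx2 : v (x ^ 2) ≤ 1 := by rw [map_pow]; exact pow_le_one₀ (v.nonneg _) hx
    have hn2 : v (algebraMap (𝓞 K) K n ^ 2) ≤ 1 := by
      rw [map_pow]; exact pow_le_one₀ (v.nonneg _) hn1
    have h1 : v (x ^ Ideal.absNorm P - algebraMap (𝓞 K) K n ^ Ideal.absNorm P) < 1 := by
      have hsq := abv_sq_sub_sq_lt hadd hx hn1 hn
      rcases hcases with h | ⟨h, -⟩
      · rwa [h]
      · have := abv_sq_sub_sq_lt hadd hx2 hn2 hsq
        rwa [h, show (4 : ℕ) = 2 * 2 from rfl, pow_mul, pow_mul]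
    have h2 := (hlt _).2 (hpow n)
    rw [map_sub, map_pow] at h2
    have h3 := abv_sub_lt hadd (abv_add_lt hadd h1 h2) hn
    convert h3 using 2
    ring
  have hval2 : w.valuation K 2 = w.intValuation (2 : 𝓞 K) := by
    have e2 : algebraMap (𝓞 K) K 2 = 2 := map_ofNat _ 2
    rw [← e2, w.valuation_of_algebraMap]
  have h2v : v 2 < 1 := by
    have := (hlt 2).2 hmem
    rwa [map_ofNat] at this
  refine ⟨v, hadd, h2v, fun x hx => ?_, fun u hu => ?_⟩
  · have h := hres x hx
    rcases hcases with hq | ⟨hq, -⟩ <;> rw [hq] at h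
    · rw [show x ^ 4 - x = (x ^ 2 + x + 1) * (x ^ 2 - x) by ring, map_mul]
      refine mul_lt_one_of_nonneg_of_lt_one_right (abv_add_le hadd (abv_add_le hadd ?_ hx) ?_)
        (v.nonneg _) h
      · rw [map_pow]; exact pow_le_one₀ (v.nonneg _) hx
      · rw [map_one]
    · exact h
  · have h2pos : 0 < v 2 := v.pos two_ne_zero
    have hw : v (u ^ 2 / 2) = 1 := by rw [map_div₀, map_pow, hu, div_self h2pos.ne']
    rcases hcases with hq | ⟨hq, hrank⟩
    · have h := hres _ hw.le
      rw [hq, show (u ^ 2 / 2) ^ 2 - u ^ 2 / 2 = u ^ 2 / 2 * ((u ^ 2 - 2) / 2) by ring, map_mul, hw,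
        one_mul] at h
      -- `2` is not divisible by `P ^ 3`, so no value lies strictly between `|u|` and `1`
      have h2val : WithZero.exp (-2 : ℤ) ≤ w.valuation K 2 := by
        by_contra! hlt2
        have h8 : w.intValuation (2 : 𝓞 K) ≤ WithZero.exp (-((3 : ℕ) : ℤ)) := by
          rw [← hval2]
          generalize w.valuation K 2 = γ at hlt2
          induction γ using WithZero.expRecOn with
          | zero => exact zero_le
          | exp n =>
            rw [WithZero.exp_lt_exp] at hlt2
            rw [WithZero.exp_le_exp]
            push_cast
            omega
        rw [HeightOneSpectrum.intValuation_le_pow_iff_dvd] at h8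
        have h8' := Ideal.absNorm_dvd_absNorm_of_le (Ideal.dvd_iff_le.1 h8)
        have hnorm' : Ideal.absNorm (Ideal.span {(2 : 𝓞 K)}) = 2 ^ Module.finrank ℚ K := by
          exact_mod_cast hnorm
        rw [map_pow, hnorm', show w.asIdeal = P from rfl, hq,
          Nat.pow_dvd_pow_iff_le_right (le_refl 2)] at h8'
        omega
      have huval : w.valuation K u ^ 2 = w.valuation K 2 := by
        rw [hdef, hdef] at hu
        apply hmono.injective
        rw [map_pow]
        exact_mod_cast hu
      have hle3 : w.valuation K ((u ^ 2 - 2) / 2) ≤ w.valuation K u := by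
        rw [← huval] at h2val
        have h' : w.valuation K ((u ^ 2 - 2) / 2) < 1 := by
          rw [hdef] at h
          rw [← hmono.lt_iff_lt, map_one]
          exact_mod_cast h
        generalize w.valuation K ((u ^ 2 - 2) / 2) = γ at h' ⊢
        generalize w.valuation K u = δ at h2val ⊢
        induction γ using WithZero.expRecOn with
        | zero => exact zero_le
        | exp n =>
          induction δ using WithZero.expRecOn with
          | zero =>
            rw [zero_pow two_ne_zero] at h2val
            exact absurd h2val (not_le.2 WithZero.exp_pos)
          | exp m =>
            rw [← WithZero.exp_zero, WithZero.exp_lt_exp] at h'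
            rw [← WithZero.exp_nsmul, WithZero.exp_le_exp] at h2val
            rw [WithZero.exp_le_exp]
            simp at h2val
            omega
      have hle4 : v ((u ^ 2 - 2) / 2) ≤ v u := by
        rw [hdef, hdef]
        exact_mod_cast hmono.monotone hle3
      rw [map_div₀, div_le_iff₀ h2pos, ← hu] at hle4
      linarith [pow_succ' (v u) 2]
    · -- here `2` generates `P`, so it has odd valuation and is not of the form `u²`
      exfalso
      have hspan : P = Ideal.span {(2 : 𝓞 K)} := by
        obtain ⟨J, hJ⟩ := Ideal.dvd_iff_le.2 hle
        have hJ1 := congrArg Ideal.absNorm hJ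
        rw [hnorm, hrank, map_mul, hq] at hJ1
        have hJ2 : J = ⊤ := by
          rw [← Ideal.absNorm_eq_one_iff]
          omega
        rw [hJ2, Ideal.mul_top] at hJ
        exact_mod_cast hJ.symm
      have hval : w.valuation K 2 = WithZero.exp (-1 : ℤ) := by
        rw [hval2, w.intValuation_singleton two_ne_zero hspan]
      have hu' : w.valuation K u ^ 2 = WithZero.exp (-1 : ℤ) := by
        rw [← hval]
        apply hmono.injective
        rw [hdef, hdef] at hu
        rw [map_pow]
        exact_mod_cast hu
      have hu0 : w.valuation K u ≠ 0 := by
        intro h0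
        rw [h0, zero_pow two_ne_zero] at hu'
        exact WithZero.exp_ne_zero hu'.symm
      have hlog := congrArg WithZero.log hu'
      rw [WithZero.log_pow, WithZero.log_exp] at hlog
      simp at hlog
      omega

/-- A prime of `ℚ(√d)` above `2` provides such an absolute value; for `d = 1` the field is `ℚ`. -/
theorem exists_isTwoAdic {K : Type*} [Field K] [Algebra ℚ K] {d : ℤ} {s : K}
    (hs : s ^ 2 = (d : K)) (hK : IntermediateField.adjoin ℚ {s} = ⊤) :
    ∃ v : AbsoluteValue K ℝ, IsTwoAdic v := by
  have := charZero_of_algebra K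
  obtain rfl : ‹Algebra ℚ K› = DivisionRing.toRatAlgebra := Subsingleton.elim _ _
  have hp : (Polynomial.X ^ 2 - Polynomial.C (d : ℚ)).Monic :=
      Polynomial.monic_X_pow_sub_C _ two_ne_zero
  have h0 : Polynomial.aeval s (Polynomial.X ^ 2 - Polynomial.C (d : ℚ)) = 0 := by
    simp [hs]
  have hint : IsIntegral ℚ s := ⟨_, hp, h0⟩
  have hfin := IntermediateField.adjoin.finiteDimensional hint
  have hrank := IntermediateField.adjoin.finrank hint
  have hdeg : (minpoly ℚ s).natDegree ≤ 2 := by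
    have := Polynomial.natDegree_le_of_dvd (minpoly.dvd ℚ s h0) hp.ne_zero
    rwa [Polynomial.natDegree_X_pow_sub_C] at this
  rw [hK] at hfin hrank
  rw [IntermediateField.finrank_top'] at hrank
  have : FiniteDimensional ℚ K := IntermediateField.topEquiv.toLinearEquiv.finiteDimensional
  have : NumberField K := ⟨⟩
  exact exists_isTwoAdic_of_finrank_le_two (hrank.trans_le hdeg)

end DynModCurve

/-! ### Doubling and points of odd order -/

namespace DynModCurve

open WeierstrassCurve.Affine

/-- If `ht` strictly increases under doubling as soon as it exceeds `1`, then it is at most `1`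
on elements of odd order. -/
lemma le_one_of_odd_order {G : Type*} [AddCommGroup G] (ht : G → ℝ)
    (hgrow : ∀ R, R ≠ 0 → R + R ≠ 0 → 1 < ht R → ht R < ht (R + R)) {R : G} {n : ℕ} (hn : Odd n)
    (hR : n • R = 0) (hR0 : R ≠ 0) : ht R ≤ 1 := by
  by_contra! hbig
  have hcop : ∀ k, Nat.Coprime (2 ^ k) n := fun k =>
    Nat.Coprime.pow_left k (Nat.coprime_two_left.2 hn)
  have hne : ∀ k, (2 ^ k) • R ≠ 0 := by
    intro k h
    have h1 := addOrderOf_dvd_of_nsmul_eq_zero h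
    have h2 := addOrderOf_dvd_of_nsmul_eq_zero hR
    have h3 := Nat.dvd_gcd h1 h2
    rw [hcop k, Nat.dvd_one] at h3
    exact hR0 (AddMonoid.addOrderOf_eq_one_iff.1 h3)
  have hdouble : ∀ k, (2 ^ (k + 1)) • R = (2 ^ k) • R + (2 ^ k) • R := fun k => by
    rw [pow_succ, mul_two, add_nsmul]
  have hge : ∀ k, ht R ≤ ht ((2 ^ k) • R) ∧ (1 ≤ k → ht R < ht ((2 ^ k) • R)) := by
    intro k
    induction k with
    | zero => simp
    | succ k ih =>
      have := hgrow _ (hne k) (by rw [← hdouble]; exact hne _) (hbig.trans_le ih.1)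
      rw [← hdouble] at this
      exact ⟨(ih.1.trans_lt this).le, fun _ => ih.1.trans_lt this⟩
  have hnpos : 0 < n := hn.pos
  have h1 := (hge n.totient).2 (Nat.totient_pos.2 hnpos)
  have h2 : (2 ^ n.totient) • R = R := by
    have h3 : 2 ^ n.totient ≡ 1 [MOD addOrderOf R] :=
      (Nat.ModEq.pow_totient (Nat.coprime_two_left.2 hn)).of_dvd
          (addOrderOf_dvd_of_nsmul_eq_zero hR)
    have := (nsmul_eq_nsmul_iff_modEq (x := R)).2 h3
    rwa [one_nsmul] at this
  rw [h2] at h1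
  exact lt_irrefl _ h1

variable {K : Type*} [Field K]

lemma abv_four (v : AbsoluteValue K ℝ) : v 4 = v 2 ^ 2 := by
  rw [← map_pow]; norm_num

lemma abv_sq_le {v : AbsoluteValue K ℝ} {x : K} (h : v x ≤ 1) : v (x ^ 2) ≤ 1 := by
  rw [map_pow]
  exact pow_le_one₀ (v.nonneg _) h

lemma abv_mul_lt_left {v : AbsoluteValue K ℝ} {x y : K} (hx : v x < 1) (hy : v y ≤ 1) :
    v (x * y) < 1 := by
  rw [map_mul]
  exact mul_lt_one_of_nonneg_of_lt_one_left (v.nonneg _) hx hy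

lemma abv_mul_le {v : AbsoluteValue K ℝ} {x y : K} (hx : v x ≤ 1) (hy : v y ≤ 1) :
    v (x * y) ≤ 1 := by
  rw [map_mul]
  exact mul_le_one₀ hx (v.nonneg _) hy

/-- The real number `|x(P) - e|` for an affine point `P`; the value `0` at infinity is arbitrary. -/
noncomputable def xAbs (v : AbsoluteValue K ℝ) (W : WeierstrassCurve.Affine K) (e : K) : W.Point → ℝ
  | .zero => 0
  | .some x _ _ => v (x - e)

/-- The Weierstrass curve `W` has the form `η² = 4 X (X² + A X + 1)` in the coordinates
`X = x - e` and `η = 2 y + a₁ x + a₃`. -/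
structure IsModel (W : WeierstrassCurve K) (e A : K) : Prop where
  b₂ : W.b₂ = 4 * (A - 3 * e)
  b₄ : W.b₄ = 2 * (3 * e ^ 2 - 2 * A * e + 1)
  b₆ : W.b₆ = 4 * (-e ^ 3 + A * e ^ 2 - e)

lemma equation_eta {W : WeierstrassCurve.Affine K} {x y : K} (h : W.Equation x y) :
    (2 * y + W.a₁ * x + W.a₃) ^ 2 = 4 * x ^ 3 + W.b₂ * x ^ 2 + 2 * W.b₄ * x + W.b₆ := by
  rw [equation_iff] at h
  simp only [WeierstrassCurve.b₂, WeierstrassCurve.b₄, WeierstrassCurve.b₆]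
  linear_combination 4 * h

lemma IsModel.eta_sq {W : WeierstrassCurve.Affine K} {e A : K} (hW : IsModel W e A) {x y : K}
    (h : W.Equation x y) : (2 * y + W.a₁ * x + W.a₃) ^ 2 =
      4 * (x - e) * ((x - e) ^ 2 + A * (x - e) + 1) := by
  rw [equation_eta h, hW.b₂, hW.b₄, hW.b₆]
  ring

/-! ### Sequences of doublings -/

section TwoAdic

variable {v : AbsoluteValue K ℝ}

/-- `X` and `X'` are related as the `X`-coordinates of a point of `η² = X (4 X² + α X + 4)`, not
of order `2`, and of its double. -/
def IsDoubling (α X X' : K) : Prop :=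
  X * (4 * X ^ 2 + α * X + 4) ≠ 0 ∧ X' * (X * (4 * X ^ 2 + α * X + 4)) = (X ^ 2 - 1) ^ 2

lemma IsTwoAdic.four_lt (hv : IsTwoAdic v) : v 4 < 1 := by
  rw [abv_four]
  exact pow_lt_one₀ (v.nonneg _) hv.two_lt two_ne_zero

lemma IsDoubling.one_lt (hv : IsTwoAdic v) {α X X' : K} (hα : v α ≤ 1) (h : IsDoubling α X X')
    (hX : v X < 1) : 1 < v X' := by
  have hnum : v ((X ^ 2 - 1) ^ 2) = 1 := by
    have h1 : v (-1 + X ^ 2) = v (-1) := abv_add_eq_left hv.add_le (by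
      rw [v.map_neg, map_one, map_pow]; exact pow_lt_one₀ (v.nonneg _) hX two_ne_zero)
    rw [show X ^ 2 - 1 = -1 + X ^ 2 by ring, map_pow, h1]; simp
  have hden : v (4 * X ^ 2 + α * X + 4) ≤ 1 := by
    have h4 := hv.four_lt.le
    exact abv_add_le hv.add_le (abv_add_le hv.add_le (abv_mul_le h4 (abv_sq_le hX.le))
      (abv_mul_le hα hX.le)) h4
  have hden' : v (X * (4 * X ^ 2 + α * X + 4)) < 1 := abv_mul_lt_left hX hden
  have hprod := congrArg v h.2
  rw [hnum, map_mul] at hprod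
  by_contra! hle
  nlinarith [v.nonneg (X * (4 * X ^ 2 + α * X + 4)), v.nonneg X']

/-- In characteristic two, with `α` odd, doubling reads `X ↦ ((X² - 1) / X)²`; it maps `𝔽₄` to `∞`
within three steps, through `ω ↦ 1 ↦ 0 ↦ ∞`. -/
lemma false_of_doubling_of_odd (hv : IsTwoAdic v) {α : K} (hα : v (α - 1) < 1) {X : ℕ → K}
    (hX : ∀ n, v (X n) ≤ 1) (h : ∀ n, IsDoubling α (X n) (X (n + 1))) : False := by
  have hα1 : v α = 1 := by
    have : v (1 + (α - 1)) = v 1 := abv_add_eq_left hv.add_le (by rwa [map_one])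
    rwa [add_sub_cancel, map_one] at this
  have hunit : ∀ n, v (X n) = 1 := fun n => by
    by_contra hne
    exact absurd (hX (n + 1)) (not_le.2 ((h n).one_lt hv hα1.le (lt_of_le_of_ne (hX n) hne)))
  have hsmall : ∀ n, v (4 * X n ^ 2 + 4) < 1 := fun n =>
    abv_add_lt hv.add_le (abv_mul_lt_left hv.four_lt (abv_sq_le (hX n))) hv.four_lt
  have hden : ∀ n, v (X n * (4 * X n ^ 2 + α * X n + 4)) = 1 := fun n => by
    have h1 : v (α * X n + (4 * X n ^ 2 + 4)) = v (α * X n) := abv_add_eq_left hv.add_le (by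
      rw [map_mul, hα1, hunit, one_mul]; exact hsmall n)
    rw [map_mul, show 4 * X n ^ 2 + α * X n + 4 = α * X n + (4 * X n ^ 2 + 4) by ring, h1, map_mul,
      hα1, hunit]
    norm_num
  -- no `X n` is congruent to `1`, as the next one would not be a unit
  have hne1 : ∀ n, ¬ v (X n - 1) < 1 := fun n hlt => by
    have hprod := congrArg v (h n).2
    rw [map_mul, hden, mul_one, hunit] at hprod
    have h1 : v (X n ^ 2 - 1 ^ 2) < 1 :=
      abv_sq_sub_sq_lt hv.add_le (hX n) (by rw [map_one]) hlt
    rw [one_pow] at h1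
    rw [map_pow] at hprod
    have := pow_lt_one₀ (v.nonneg _) h1 two_ne_zero
    linarith
  have homega : v (X 0 ^ 2 + X 0 + 1) < 1 := by
    have h1 := hv.pow_four _ (hX 0)
    rw [show X 0 ^ 4 - X 0 = X 0 * ((X 0 - 1) * (X 0 ^ 2 + X 0 + 1)) by ring, map_mul, hunit,
        one_mul,
      map_mul] at h1
    have h2 : v (X 0 - 1) = 1 := le_antisymm
      (abv_sub_le hv.add_le (hX 0) (by rw [map_one])) (not_lt.1 (hne1 0))
    rwa [h2, one_mul] at h1
  refine hne1 1 ?_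
  have hx1 : v (X 0 + 1) ≤ 1 := abv_add_le hv.add_le (hX 0) (by rw [map_one])
  have h1 : v (X 0 ^ 2 - 1 - X 0) < 1 := by
    rw [show X 0 ^ 2 - 1 - X 0 = X 0 ^ 2 + X 0 + 1 - 2 * (X 0 + 1) by ring]
    exact abv_sub_lt hv.add_le homega (abv_mul_lt_left hv.two_lt hx1)
  have h2 : v ((X 0 ^ 2 - 1) ^ 2 - X 0 ^ 2) < 1 :=
    abv_sq_sub_sq_lt hv.add_le (abv_sub_le hv.add_le (abv_sq_le (hX 0)) (by rw [map_one])) (hX 0) h1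
  have h3 : v (X 0 * (4 * X 0 ^ 2 + α * X 0 + 4) - X 0 ^ 2) < 1 := by
    rw [show X 0 * (4 * X 0 ^ 2 + α * X 0 + 4) - X 0 ^ 2 =
      (4 * X 0 ^ 2 + 4) * X 0 + (α - 1) * X 0 ^ 2 by ring]
    exact abv_add_lt hv.add_le (abv_mul_lt_left (hsmall 0) (hX 0))
      (abv_mul_lt_left hα (abv_sq_le (hX 0)))
  have h4 := abv_sub_lt hv.add_le h2 h3
  rw [sub_sub_sub_cancel_right, ← (h 0).2, show X (0 + 1) * (X 0 * (4 * X 0 ^ 2 + α * X 0 + 4)) -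
    X 0 * (4 * X 0 ^ 2 + α * X 0 + 4) = (X 1 - 1) * (X 0 * (4 * X 0 ^ 2 + α * X 0 + 4)) by ring,
    map_mul, hden, mul_one] at h4
  exact h4

/-- With `α = 4 A` and `A` odd, a sequence of doublings of units must have `X ≡ 1` throughout, and
comparing absolute values forces `|X - 1|² = |2|`; but then `|X' - 1| ≤ |2|`. -/
lemma false_of_doubling_of_four_mul_odd [CharZero K] (hv : IsTwoAdic v) {B : ℤ} {X : ℕ → K}
    (hX : ∀ n, v (X n) ≤ 1)
    (h : ∀ n, IsDoubling (4 * (2 * B + 1 : K)) (X n) (X (n + 1))) : False := by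
  have hB := abv_intCast_le hv.add_le B
  have h2 := hv.two_lt
  have h20 : 0 < v 2 := v.pos two_ne_zero
  have h4 := hv.four_lt
  have hA : v (2 * B + 1 : K) ≤ 1 :=
    abv_add_le hv.add_le (abv_mul_le h2.le hB) (by rw [map_one])
  have hunit : ∀ n, v (X n) = 1 := fun n => by
    by_contra hne
    exact absurd (hX (n + 1)) (not_le.2 ((h n).one_lt hv (abv_mul_le h4.le hA)
      (lt_of_le_of_ne (hX n) hne)))
  have hone : v (1 : K) ≤ 1 := by rw [map_one]
  have hu : ∀ n, v (X n - 1) < 1 := by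
    intro n
    by_contra! hge
    have h1 := hv.pow_four _ (hX n)
    rw [show X n ^ 4 - X n = X n * ((X n - 1) * (X n ^ 2 + X n + 1)) by ring, map_mul, hunit,
        one_mul,
      map_mul, le_antisymm (abv_sub_le hv.add_le (hX n) hone) hge, one_mul] at h1
    have h5 : v (X n + 1) = 1 := by
      have h6 : v (X n - 1 + 2) = v (X n - 1) := abv_add_eq_left hv.add_le (h2.trans_le hge)
      rw [show X n + 1 = X n - 1 + 2 by ring, h6]
      exact le_antisymm (abv_sub_le hv.add_le (hX n) hone) hge
    have h6 : v (X n - 1) = 1 := le_antisymm (abv_sub_le hv.add_le (hX n) hone) hge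
    have hprod := congrArg v (h n).2
    rw [map_pow, show X n ^ 2 - 1 = (X n - 1) * (X n + 1) by ring, map_mul (v) (X n - 1), h5, h6,
      map_mul, hunit, one_mul, show 4 * X n ^ 2 + 4 * (2 * B + 1 : K) * X n + 4 =
        4 * (X n ^ 2 + (2 * B + 1) * X n + 1) by ring] at hprod
    have h7 : v (X n * (4 * (X n ^ 2 + (2 * B + 1) * X n + 1))) < 1 := by
      rw [map_mul, hunit, one_mul]
      exact abv_mul_lt_left h4 (abv_add_le hv.add_le (abv_add_le hv.add_le (abv_sq_le (hX n))
        (abv_mul_le hA (hX n))) hone)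
    linarith
  -- the denominator is `4` times a unit
  have hden : ∀ n, v (X n * (4 * X n ^ 2 + 4 * (2 * B + 1) * X n + 4)) = v 2 ^ 2 := by
    intro n
    have h5 : v (1 + (2 * (B + 1) + (X n - 1) * (X n + 1 + (2 * B + 1)))) = v 1 := by
      refine abv_add_eq_left hv.add_le ?_
      rw [map_one]
      refine abv_add_lt hv.add_le (abv_mul_lt_left h2 (abv_add_le hv.add_le hB hone))
        (abv_mul_lt_left (hu n) (abv_add_le hv.add_le (abv_add_le hv.add_le (hX n) hone) hA))
    rw [map_mul, hunit, show 4 * X n ^ 2 + 4 * (2 * B + 1) * X n + 4 =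
      4 * (1 + (2 * (B + 1) + (X n - 1) * (X n + 1 + (2 * B + 1)))) by ring, map_mul, h5, map_one,
      abv_four, one_mul, mul_one]
  have hcrit : ∀ n, v (X n - 1) ^ 2 = v 2 := by
    intro n
    have hprod := congrArg v (h n).2
    rw [map_mul, hden, hunit, one_mul, map_pow,
      show X n ^ 2 - 1 = (X n - 1) * (X n - 1 + 2) by ring,
      map_mul] at hprod
    have hp : v 2 = v (X n - 1) * v (X n - 1 + 2) := by
      rw [sq_eq_sq₀ h20.le (by positivity)] at hprod
      exact hprod
    rcases le_or_gt (v (X n - 1)) (v 2) with hle | hgt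
    · have h5 := abv_add_le hv.add_le hle le_rfl
      nlinarith [v.nonneg (X n - 1), v.nonneg (X n - 1 + 2)]
    · rw [abv_add_eq_left hv.add_le hgt] at hp
      rw [hp, sq]
  -- the numerator of `X 1 - 1`
  set u := X 0 - 1 with hu_def
  have hu2 := hcrit 0
  have hram := hv.ramified u hu2
  have hp0 : 0 < v u := by
    by_contra! hle
    nlinarith [v.nonneg u]
  have hnum : v (u ^ 4 - 4 - (4 * (2 * (B + 1)) + 4 * (2 * B + 3) * (2 * u + u ^ 2))) ≤
      v 2 ^ 3 := by
    refine abv_sub_le hv.add_le ?_ (abv_add_le hv.add_le ?_ ?_)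
    · have h5 : v (u ^ 2 - 2 + 4) ≤ v u ^ 3 := by
        refine abv_add_le hv.add_le hram ?_
        rw [abv_four, ← hu2]
        nlinarith [pow_pos hp0 3, hu 0]
      rw [show u ^ 4 - 4 = (u ^ 2 - 2) * (u ^ 2 - 2 + 4) by ring, map_mul, ← hu2]
      calc v (u ^ 2 - 2) * v (u ^ 2 - 2 + 4) ≤ v u ^ 3 * v u ^ 3 := by gcongr
        _ = (v u ^ 2) ^ 3 := by ring
    · rw [map_mul, map_mul, abv_four]
      have := abv_add_le hv.add_le hB hone
      calc v 2 ^ 2 * (v 2 * v (B + 1)) ≤ v 2 ^ 2 * (v 2 * 1) := by gcongr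
        _ = v 2 ^ 3 := by ring
    · have h5 : v (2 * B + 3) ≤ 1 := by
        have := abv_intCast_le hv.add_le (2 * B + 3)
        push_cast at this
        exact this
      have h6 : v (2 * u + u ^ 2) ≤ v 2 := by
        refine abv_add_le hv.add_le ?_ (by rw [map_pow, hu2])
        rw [map_mul]
        exact mul_le_of_le_one_right h20.le (hu 0).le
      rw [map_mul, map_mul, abv_four]
      calc v 2 ^ 2 * v (2 * B + 3) * v (2 * u + u ^ 2) ≤ v 2 ^ 2 * 1 * v 2 := by gcongr
        _ = v 2 ^ 3 := by ring
  have hX0 : X 0 = 1 + u := by rw [hu_def]; ring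
  have hid : (X 1 - 1) * (X 0 * (4 * X 0 ^ 2 + 4 * (2 * B + 1) * X 0 + 4)) =
      u ^ 4 - 4 - (4 * (2 * (B + 1)) + 4 * (2 * B + 3) * (2 * u + u ^ 2)) := by
    rw [sub_mul, (h 0).2, hX0]
    ring
  rw [← hid, map_mul, hden] at hnum
  have h5 : v (X 1 - 1) ≤ v 2 := by
    have : 0 < v 2 ^ 2 := by positivity
    nlinarith
  have h6 := hcrit 1
  nlinarith [v.nonneg (X 1 - 1)]

end TwoAdic

/-! ### Points of odd order on a model -/

variable [DecidableEq K]

/-- The duplication formula: either `η = 0` and `2 P = 0`, or `x(2 P)` is given by the usual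
rational function of `x(P)`. -/
lemma add_self_cases {W : WeierstrassCurve.Affine K} {x y : K} (h : W.Nonsingular x y) :
    (2 * y + W.a₁ * x + W.a₃ = 0 ∧ Point.some x y h + Point.some x y h = 0) ∨
    (2 * y + W.a₁ * x + W.a₃ ≠ 0 ∧ ∃ x' y' h', Point.some x y h + Point.some x y h =
        Point.some x' y' h' ∧
      x' * (2 * y + W.a₁ * x + W.a₃) ^ 2 = x ^ 4 - W.b₄ * x ^ 2 - 2 * W.b₆ * x - W.b₈) := by
  have hη : y - W.negY x y = 2 * y + W.a₁ * x + W.a₃ := by rw [negY]; ring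
  by_cases hy : y = W.negY x y
  · left
    exact ⟨by rw [← hη, sub_eq_zero]; exact hy, Point.add_self_of_Y_eq hy⟩
  · right
    have hη0 : 2 * y + W.a₁ * x + W.a₃ ≠ 0 := by rw [← hη, sub_ne_zero]; exact hy
    refine ⟨hη0, _, _, _, Point.add_self_of_Y_ne hy, ?_⟩
    rw [slope_of_Y_ne rfl hy, hη, addX]
    have heq := (equation_iff x y).1 h.1
    have hl := div_mul_cancel₀ (3 * x ^ 2 + 2 * W.a₂ * x + W.a₄ - W.a₁ * y) hη0
    generalize (3 * x ^ 2 + 2 * W.a₂ * x + W.a₄ - W.a₁ * y) / (2 * y + W.a₁ * x + W.a₃) = l at hl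
    simp only [WeierstrassCurve.b₄, WeierstrassCurve.b₆, WeierstrassCurve.b₈]
    linear_combination -(W.a₁ ^ 2 + 4 * W.a₂ + 8 * x) * heq +
      (l * (2 * y + W.a₁ * x + W.a₃) + (3 * x ^ 2 + 2 * W.a₂ * x + W.a₄ - W.a₁ * y) +
        W.a₁ * (2 * y + W.a₁ * x + W.a₃)) * hl

lemma IsModel.add_self_cases [CharZero K] {W : WeierstrassCurve.Affine K} {e A : K}
    (hW : IsModel W e A) {x y : K} (h : W.Nonsingular x y) :
    (2 * y + W.a₁ * x + W.a₃ = 0 ∧ Point.some x y h + Point.some x y h = 0) ∨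
    (2 * y + W.a₁ * x + W.a₃ ≠ 0 ∧ ∃ x' y' h', Point.some x y h + Point.some x y h =
        Point.some x' y' h' ∧
      (x' - e) * (2 * y + W.a₁ * x + W.a₃) ^ 2 = ((x - e) ^ 2 - 1) ^ 2) := by
  refine (DynModCurve.add_self_cases h).imp_right ?_
  rintro ⟨h0, x', y', h', hadd, hx⟩
  refine ⟨h0, x', y', h', hadd, ?_⟩
  have h8 := W.b_relation
  have h4 : (4 : K) ≠ 0 := by norm_num
  apply mul_left_cancel₀ h4
  rw [sub_mul, hx, hW.eta_sq h.1, hW.b₄, hW.b₆]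
  rw [hW.b₂, hW.b₄, hW.b₆] at h8
  linear_combination -h8

section TwoAdic

variable {v : AbsoluteValue K ℝ}

/-- Doubling moves a point of a model with large `X` further away from the origin. -/
lemma IsModel.xAbs_lt [CharZero K] (hv : IsTwoAdic v) {W : WeierstrassCurve.Affine K} {e A : K}
    (hW : IsModel W e A) (hA : v (4 * A) ≤ 1) (R : W.Point) (h2 : R + R ≠ 0)
    (h : 1 < xAbs v W e R) : xAbs v W e R < xAbs v W e (R + R) := by
  obtain _ | ⟨x, y, hxy⟩ := R
  · simp [xAbs] at h; linarith
  rcases hW.add_self_cases hxy with ⟨-, h0⟩ | ⟨h0, x', y', h', hadd, hx'⟩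
  · exact absurd h0 h2
  rw [hadd]
  change 1 < v (x - e) at h
  change v (x - e) < v (x' - e)
  have hη := hW.eta_sq hxy.1
  rw [hη] at hx'
  have hη0 : 4 * (x - e) * ((x - e) ^ 2 + A * (x - e) + 1) ≠ 0 := hη ▸ pow_ne_zero 2 h0
  generalize x - e = X at h hx' hη0 ⊢
  generalize x' - e = X' at hx' ⊢
  have hnum : v ((X ^ 2 - 1) ^ 2) = v X ^ 4 := by
    have h1 : v (X ^ 2 + -1) = v (X ^ 2) := abv_add_eq_left hv.add_le (by
      rw [v.map_neg, map_one, map_pow]; nlinarith)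
    rw [sub_eq_add_neg, map_pow, h1, map_pow]; ring
  have h4 : v 4 < 1 := by
    have := hv.two_lt
    have h0 := v.nonneg 2
    rw [show (4 : K) = 2 ^ 2 by norm_num, map_pow]; nlinarith
  have hden : v (4 * X ^ 2 + (4 * A) * X + 4) < v X ^ 2 := by
    refine abv_add_lt hv.add_le (abv_add_lt hv.add_le ?_ ?_) (by nlinarith)
    · rw [map_mul, map_pow]
      exact mul_lt_of_lt_one_left (by positivity) h4
    · rw [map_mul]; nlinarith [v.nonneg (4 * A)]
  have hden0 : 0 < v (4 * X ^ 2 + (4 * A) * X + 4) := by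
    rw [v.pos_iff]
    intro h; apply hη0; linear_combination X * h
  have hprod := congrArg v hx'
  rw [hnum, show 4 * X * (X ^ 2 + A * X + 1) = X * (4 * X ^ 2 + (4 * A) * X + 4) by ring, map_mul,
    map_mul] at hprod
  have hX0 : 0 < v X := by linarith
  by_contra! hle
  have h1 : v X' * (v X * v (4 * X ^ 2 + (4 * A) * X + 4)) ≤
      v X * (v X * v (4 * X ^ 2 + (4 * A) * X + 4)) := by
    gcongr
  have h2 : v X * (v X * v (4 * X ^ 2 + (4 * A) * X + 4)) < v X * (v X * v X ^ 2) := by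
    gcongr
  nlinarith

/-- A model has no points of odd order other than the origin if its sequences of doublings cannot
stay integral. -/
lemma IsModel.eq_zero_of_odd_order [CharZero K] (hv : IsTwoAdic v) {W : WeierstrassCurve.Affine K}
    {e A : K} (hW : IsModel W e A) (hA : v (4 * A) ≤ 1)
    (hseq : ∀ X : ℕ → K, (∀ n, v (X n) ≤ 1) → (∀ n, IsDoubling (4 * A) (X n) (X (n + 1))) → False)
    {R : W.Point} {n : ℕ} (hn : Odd n) (hR : n • R = 0) : R = 0 := by
  by_contra hR0
  have hzero : ∀ Q : W.Point, n • Q = 0 → Q ≠ 0 → Q + Q ≠ 0 := by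
    intro Q hQ hQ0 h2
    obtain ⟨k, rfl⟩ := hn
    rw [add_nsmul, one_nsmul, mul_comm, mul_nsmul, two_nsmul, ← nsmul_add, h2, nsmul_zero,
        zero_add] at hQ
    exact hQ0 hQ
  let S : ℕ → W.Point := fun k => 2 ^ k • R
  have hS : ∀ k, S (k + 1) = S k + S k := fun k => by
    show 2 ^ (k + 1) • R = 2 ^ k • R + 2 ^ k • R
    rw [pow_succ, mul_two, add_nsmul]
  have hSn : ∀ k, n • S k = 0 := fun k => by
    show n • 2 ^ k • R = 0
    rw [nsmul_left_comm, hR, nsmul_zero]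
  have hS0 : ∀ k, S k ≠ 0 := by
    intro k
    induction k with
    | zero => simpa [S] using hR0
    | succ k ih => rw [hS]; exact hzero _ (hSn k) ih
  have hle : ∀ k, xAbs v W e (S k) ≤ 1 := fun k =>
    le_one_of_odd_order (xAbs v W e) (fun Q _ h2 h => hW.xAbs_lt hv hA Q h2 h) hn (hSn k) (hS0 k)
  have hex : ∀ k, ∃ X, ∀ x y h, S k = Point.some x y h → x - e = X := fun k => by
    rcases hk : S k with _ | ⟨x, y, h⟩
    · exact absurd hk (hS0 k)
    · refine ⟨x - e, fun x' y' h' heq => ?_⟩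
      obtain ⟨rfl, rfl⟩ := Point.some.inj heq
      rfl
  choose X hXdef using hex
  refine hseq X (fun k => ?_) fun k => ?_
  · rcases hk : S k with _ | ⟨x, y, h⟩
    · exact absurd hk (hS0 k)
    · rw [← hXdef k x y h hk]
      have := hle k
      rw [hk] at this
      exact this
  · rcases hk : S k with _ | ⟨x, y, h⟩
    · exact absurd hk (hS0 k)
    · rcases hW.add_self_cases h with ⟨-, h0⟩ | ⟨h0, x', y', h', hadd, hx'⟩
      · rw [← hk, ← hS] at h0
        exact absurd h0 (hS0 _)
      · rw [← hk, ← hS] at hadd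
        have hη := hW.eta_sq h.1
        have hfac : (x - e) * (4 * (x - e) ^ 2 + 4 * A * (x - e) + 4) =
            (2 * y + W.a₁ * x + W.a₃) ^ 2 := by rw [hη]; ring
        rw [← hXdef k x y h hk, ← hXdef _ x' y' h' hadd]
        exact ⟨hfac ▸ pow_ne_zero 2 h0, by rw [hfac]; exact hx'⟩

end TwoAdic

end DynModCurve

/-! ### Torsion subgroups of abelian groups -/

namespace DynModCurve

open WeierstrassCurve.Affine

section Group

variable {G : Type*} [AddCommGroup G]

/-- A subgroup that is closed under halving contains all the torsion, if there is none of odd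
order. -/
lemma torsion_le_of_half_mem (hodd : ∀ (R : G) (n : ℕ), Odd n → n • R = 0 → R = 0)
    (S : AddSubgroup G) (hS : ∀ R, R + R ∈ S → R ∈ S) : AddCommGroup.torsion G ≤ S := by
  intro R hR
  obtain ⟨n, hn, hnR⟩ := isOfFinAddOrder_iff_nsmul_eq_zero.1 hR
  obtain ⟨k, m, hm, rfl⟩ := Nat.exists_eq_two_pow_mul_odd hn.ne'
  have h0 : 2 ^ k • R ∈ S := by
    rw [hodd (2 ^ k • R) m hm (by rw [← mul_nsmul, hnR])]
    exact S.zero_mem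
  clear hn hnR
  induction k with
  | zero => simpa using h0
  | succ k ih => exact ih (hS _ (by rwa [← two_nsmul, ← mul_nsmul, ← pow_succ]))

/-- The torsion subgroup is isomorphic to `H` if `H` embeds with torsion image closed under
halving. -/
lemma nonempty_torsion_addEquiv {H : Type*} [AddCommGroup H] [Finite H]
    (hodd : ∀ (R : G) (n : ℕ), Odd n → n • R = 0 → R = 0) (f : H →+ G)
    (hf : Function.Injective f) (hhalf : ∀ R, R + R ∈ f.range → R ∈ f.range) :
    Nonempty (AddCommGroup.torsion G ≃+ H) := by
  have h : AddCommGroup.torsion G = f.range := by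
    refine le_antisymm (torsion_le_of_half_mem hodd _ hhalf) ?_
    rintro _ ⟨x, rfl⟩
    exact f.isOfFinAddOrder (isOfFinAddOrder_of_finite x)
  rw [h]
  exact ⟨(AddMonoidHom.ofInjective hf).symm⟩

lemma nonempty_addEquiv_zmod {S : AddSubgroup G} {P : G} (hS : S = AddSubgroup.zmultiples P) :
    Nonempty (S ≃+ ZMod (addOrderOf P)) := by
  subst hS
  rw [← Nat.card_zmultiples]
  exact ⟨(zmodAddCyclicAddEquiv inferInstance).symm⟩

lemma torsion_eq_zmultiples (hodd : ∀ (R : G) (n : ℕ), Odd n → n • R = 0 → R = 0) {P : G}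
    (hP : IsOfFinAddOrder P) (h2 : ∀ R : G, R + R = 0 → R ∈ AddSubgroup.zmultiples P)
    (hhalf : ∀ R : G, R + R ≠ P) : AddCommGroup.torsion G = AddSubgroup.zmultiples P := by
  refine le_antisymm (torsion_le_of_half_mem hodd _ ?_) ?_
  · rintro R ⟨k, hk⟩
    change k • P = R + R at hk
    obtain ⟨j, rfl | rfl⟩ := Int.even_or_odd' k
    · have := h2 (R - j • P) (by rw [sub_add_sub_comm, ← hk, ← add_zsmul, two_mul, sub_self])
      simpa using add_mem this (AddSubgroup.zsmul_mem_zmultiples P j)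
    · refine absurd ?_ (hhalf (R - j • P))
      rw [sub_add_sub_comm, ← hk, ← add_zsmul, add_zsmul, two_mul, one_zsmul, add_sub_cancel_left]
  · rw [AddSubgroup.zmultiples_le]
    exact hP

lemma nonempty_torsion_addEquiv_zmod_two_prod_zmod_four
    (hodd : ∀ (R : G) (n : ℕ), Odd n → n • R = 0 → R = 0) {P Q : G} (hP : P + P ≠ 0)
    (hP4 : P + P + (P + P) = 0) (hQ : Q + Q = 0) (hQ0 : Q ≠ 0) (hQP : Q ≠ P + P)
    (h2 : ∀ R : G, R + R = 0 → R = 0 ∨ R = P + P ∨ R = Q ∨ R = Q + (P + P))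
    (hhalfP : ∀ R : G, R + R ≠ P) (hhalfQ : ∀ R : G, R + R ≠ Q)
    (hhalfPQ : ∀ R : G, R + R ≠ Q + P) :
    Nonempty (AddCommGroup.torsion G ≃+ ZMod 2 × ZMod 4) := by
  have hQ' : zmultiplesHom G Q (2 : ℕ) = 0 := by
    simpa [two_zsmul] using hQ
  have hP' : zmultiplesHom G P (4 : ℕ) = 0 := by
    simp only [Nat.cast_ofNat, zmultiplesHom_apply]
    rw [← hP4, show (4 : ℤ) = 2 + 2 from rfl, add_zsmul, two_zsmul]
  let f : ZMod 2 × ZMod 4 →+ G := AddMonoidHom.coprod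
    (ZMod.lift 2 ⟨zmultiplesHom G Q, hQ'⟩) (ZMod.lift 4 ⟨zmultiplesHom G P, hP'⟩)
  have hf : ∀ a b : ℤ, f ((a : ZMod 2), (b : ZMod 4)) = a • Q + b • P := fun a b => by
    simp [f]
  have hmem : ∀ a b : ℤ, a • Q + b • P ∈ f.range := fun a b => ⟨_, hf a b⟩
  refine nonempty_torsion_addEquiv hodd f ?_ ?_
  · rw [injective_iff_map_eq_zero]
    rintro ⟨a, b⟩ hab
    obtain ⟨a, rfl⟩ := ZMod.intCast_surjective a
    obtain ⟨b, rfl⟩ := ZMod.intCast_surjective b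
    rw [hf] at hab
    have hb2 : (2 * b) • P = 0 := by
      have : (2 : ℤ) • (a • Q + b • P) = 0 := by rw [hab, zsmul_zero]
      rwa [zsmul_add, zsmul_comm, two_zsmul, hQ, zsmul_zero, zero_add, ← mul_zsmul] at this
    have h4 : ∀ j : ℤ, (2 * (2 * j)) • P = 0 := fun j => by
      rw [← mul_assoc, mul_comm, mul_zsmul, show (2 * 2 : ℤ) = 2 + 2 from rfl, add_zsmul, two_zsmul,
        hP4, zsmul_zero]
    have h2Q : ∀ i : ℤ, (2 * i) • Q = 0 := fun i => by
      rw [mul_comm, mul_zsmul, two_zsmul, hQ, zsmul_zero]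
    obtain ⟨b, rfl | rfl⟩ := Int.even_or_odd' b
    · obtain ⟨i, rfl | rfl⟩ := Int.even_or_odd' a <;> obtain ⟨j, rfl | rfl⟩ := Int.even_or_odd' b
      · ext
        · exact (ZMod.intCast_zmod_eq_zero_iff_dvd _ 2).2 ⟨i, rfl⟩
        · exact (ZMod.intCast_zmod_eq_zero_iff_dvd _ 4).2 ⟨j, by push_cast; ring⟩
      · rw [h2Q, mul_add, add_zsmul, h4, mul_one, two_zsmul, zero_add, zero_add] at hab
        exact absurd hab hP
      · rw [add_zsmul, h2Q, h4, one_zsmul, zero_add, add_zero] at hab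
        exact absurd hab hQ0
      · rw [add_zsmul, h2Q, mul_add, add_zsmul, h4, mul_one, one_zsmul, two_zsmul, zero_add,
          zero_add] at hab
        refine absurd ?_ hQP
        rw [eq_neg_of_add_eq_zero_left hab, neg_eq_iff_add_eq_zero, hP4]
    · rw [mul_add, add_zsmul, h4, mul_one, two_zsmul, zero_add] at hb2
      exact absurd hb2 hP
  · rintro R ⟨⟨a, b⟩, hab⟩
    obtain ⟨a, rfl⟩ := ZMod.intCast_surjective a
    obtain ⟨b, rfl⟩ := ZMod.intCast_surjective b
    rw [hf] at hab
    obtain ⟨i, hi⟩ := Int.even_or_odd' a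
    obtain ⟨j, hj⟩ := Int.even_or_odd' b
    have haQ : (2 * i) • Q = 0 := by rw [mul_comm, mul_zsmul, two_zsmul, hQ, zsmul_zero]
    have hR : ∀ T : G, R + R = T + (2 * j) • P → (R - j • P) + (R - j • P) = T := fun T h => by
      rw [sub_add_sub_comm, h, ← add_zsmul, two_mul, add_sub_cancel_right]
    rcases hi with rfl | rfl <;> rcases hj with rfl | rfl
    · have := h2 (R - j • P) (hR 0 (by rw [← hab, haQ]))
      have h3 : R - j • P ∈ f.range := by
        rcases this with h | h | h | h <;> rw [h]
        · exact zero_mem _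
        · simpa [two_zsmul] using hmem 0 2
        · simpa using hmem 1 0
        · simpa [two_zsmul] using hmem 1 2
      simpa using add_mem h3 (hmem 0 j)
    · exact absurd (hR P (by rw [← hab, haQ, add_zsmul, one_zsmul]; abel)) (hhalfP _)
    · exact absurd (hR Q (by rw [← hab, add_zsmul, haQ, one_zsmul]; abel)) (hhalfQ _)
    · exact absurd (hR (Q + P) (by
        rw [← hab, add_zsmul, haQ, add_zsmul, one_zsmul, one_zsmul]; abel))
        (hhalfPQ _)

end Group

end DynModCurve

/-! ### Torsion of the models -/

namespace DynModCurve

open WeierstrassCurve.Affine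

section Model

variable {K : Type*} [Field K]

/-- `k` is the `X`-coordinate of the double of a point of `η² = 4 X (X² + A X + 1)` that does not
have order `2`. -/
def IsDouble (A k : K) : Prop :=
  ∃ X η : K, η ≠ 0 ∧ η ^ 2 = 4 * X * (X ^ 2 + A * X + 1) ∧ (X ^ 2 - 1) ^ 2 = k * η ^ 2

/-- The point `R` is affine, with coordinate `x - e = X`. -/
def HasX (W : WeierstrassCurve.Affine K) (e X : K) (R : W.Point) : Prop :=
  ∃ y h, R = Point.some (X + e) y h

variable {W : WeierstrassCurve.Affine K} {e A X X' : K} {P Q R R' : W.Point}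

lemma HasX.ne_zero (h : HasX W e X R) : R ≠ 0 := by
  obtain ⟨y, h, rfl⟩ := h
  exact Point.some_ne_zero h

lemma HasX.eq (h : HasX W e X R) (h' : HasX W e X' R) : X = X' := by
  obtain ⟨y, h, rfl⟩ := h
  obtain ⟨y', h', heq⟩ := h'
  exact add_right_cancel (Point.some.inj heq).1

variable [CharZero K]

lemma IsModel.exists_hasX (hW : IsModel W e A) {η : K} (hη0 : η ≠ 0)
    (hη : η ^ 2 = 4 * X * (X ^ 2 + A * X + 1)) : ∃ R : W.Point, HasX W e X R := by
  obtain ⟨y, hy⟩ : ∃ y, 2 * y + W.a₁ * (X + e) + W.a₃ = η :=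
    ⟨(η - W.a₁ * (X + e) - W.a₃) / 2, by ring⟩
  have heq : W.Equation (X + e) y := by
    rw [equation_iff]
    have h2 := hW.b₂
    have h4 := hW.b₄
    have h6 := hW.b₆
    simp only [WeierstrassCurve.b₂, WeierstrassCurve.b₄, WeierstrassCurve.b₆] at h2 h4 h6
    rw [← hy] at hη
    linear_combination hη / 4 - (X + e) ^ 2 / 4 * h2 - (X + e) / 2 * h4 - h6 / 4
  refine ⟨Point.some (X + e) y ((nonsingular_iff _ _).2 ⟨heq, Or.inr fun h => hη0 ?_⟩), y, _, rfl⟩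
  rw [← hy]
  linear_combination h

lemma IsModel.eq_of_hasX (hW : IsModel W e A) (hX : X * (X ^ 2 + A * X + 1) = 0)
    (h : HasX W e X R) (h' : HasX W e X R') : R = R' := by
  obtain ⟨y, h, rfl⟩ := h
  obtain ⟨y', h', rfl⟩ := h'
  have h1 := hW.eta_sq h.1
  have h2 := hW.eta_sq h'.1
  rw [add_sub_cancel_right, mul_assoc, hX, mul_zero, sq_eq_zero_iff] at h1 h2
  obtain rfl : y = y' := by linear_combination (h1 - h2) / 2
  rfl

variable [DecidableEq K]

lemma IsModel.add_self_eq_zero (hW : IsModel W e A) (hX : X * (X ^ 2 + A * X + 1) = 0)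
    (h : HasX W e X R) : R + R = 0 := by
  obtain ⟨y, h, rfl⟩ := h
  rcases hW.add_self_cases h with h0 | ⟨h0, -⟩
  · exact h0.2
  · refine absurd ?_ h0
    rw [← sq_eq_zero_iff, hW.eta_sq h.1, add_sub_cancel_right, mul_assoc, hX, mul_zero]

lemma IsModel.hasX_add_self (hW : IsModel W e A) (h : HasX W e X R)
    (hX : X * (X ^ 2 + A * X + 1) ≠ 0)
    (hX' : (X ^ 2 - 1) ^ 2 = X' * (4 * X * (X ^ 2 + A * X + 1))) : HasX W e X' (R + R) := by
  obtain ⟨y, h, rfl⟩ := h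
  have hη := hW.eta_sq h.1
  rw [add_sub_cancel_right] at hη
  rcases hW.add_self_cases h with ⟨h0, -⟩ | ⟨h0, x', y', h', hadd, hx'⟩
  · rw [h0, zero_pow two_ne_zero, mul_assoc, zero_eq_mul] at hη
    exact absurd (hη.resolve_left (by norm_num)) hX
  · rw [add_sub_cancel_right, hX', ← hη] at hx'
    obtain rfl : x' = X' + e := sub_eq_iff_eq_add.1 (mul_right_cancel₀ (pow_ne_zero 2 h0) hx')
    exact ⟨y', h', hadd⟩

lemma IsModel.isDouble (hW : IsModel W e A) (h : HasX W e X (R + R)) : IsDouble A X := by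
  obtain ⟨y', h', hR'⟩ := h
  rcases R with _ | ⟨x, y, h⟩
  · exact absurd hR'.symm (Point.some_ne_zero h')
  · rcases hW.add_self_cases h with ⟨-, h0⟩ | ⟨h0, x'', y'', h'', hadd, hx'⟩
    · rw [h0] at hR'
      exact absurd hR'.symm (Point.some_ne_zero h')
    · rw [hR'] at hadd
      obtain ⟨rfl, -⟩ := Point.some.inj hadd
      rw [add_sub_cancel_right] at hx'
      exact ⟨x - e, _, h0, hW.eta_sq h.1, hx'.symm⟩

lemma IsModel.eq_zero_or_hasX (hW : IsModel W e A) (h : R + R = 0) :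
    R = 0 ∨ ∃ X, HasX W e X R ∧ X * (X ^ 2 + A * X + 1) = 0 := by
  rcases R with _ | ⟨x, y, hxy⟩
  · exact Or.inl rfl
  · refine Or.inr ⟨x - e, ⟨y, by rwa [sub_add_cancel], by simp⟩, ?_⟩
    rcases hW.add_self_cases hxy with ⟨h0, -⟩ | ⟨-, x', y', h', hadd, -⟩
    · have := hW.eta_sq hxy.1
      rw [h0, zero_pow two_ne_zero, mul_assoc, zero_eq_mul] at this
      exact this.resolve_left (by norm_num)
    · rw [h] at hadd
      exact absurd hadd.symm (Point.some_ne_zero h')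

/-- The double of a point with `X = ±1` is the origin of the `(X, η)`-plane. -/
lemma IsModel.hasX_zero (hW : IsModel W e A) {ε : K} (hε : ε ^ 2 = 1) (h2 : 2 * ε + A ≠ 0)
    (hP : HasX W e ε P) : HasX W e 0 (P + P) := by
  refine hW.hasX_add_self hP ?_ (by rw [hε]; ring)
  rw [show ε * (ε ^ 2 + A * ε + 1) = 2 * ε + A by linear_combination (A + ε) * hε]
  exact h2

/-- The torsion is cyclic of order `4`, generated by a point with `X = ±1`, if this point is not
divisible by `2` and there are no further points of order `2`. -/
theorem IsModel.torsion_zmod_four (hW : IsModel W e A)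
    (hodd : ∀ (R : W.Point) (n : ℕ), Odd n → n • R = 0 → R = 0)
    (hroot : ∀ X : K, X ^ 2 + A * X + 1 ≠ 0) {ε η : K} (hε : ε ^ 2 = 1) (hη0 : η ≠ 0)
    (hη : η ^ 2 = 4 * (2 * ε + A)) (hhalf : ¬ IsDouble A ε) :
    Nonempty (AddCommGroup.torsion W.Point ≃+ ZMod 4) := by
  have h2 : 2 * ε + A ≠ 0 := fun h => hη0 (by rw [← sq_eq_zero_iff, hη, h, mul_zero])
  obtain ⟨P, hP⟩ := hW.exists_hasX (X := ε) hη0 (by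
    rw [hη]; linear_combination (-4 * (A + ε)) * hε)
  have hPP := hW.hasX_zero hε h2 hP
  have hT : P + P + (P + P) = 0 := hW.add_self_eq_zero (zero_mul _) hPP
  have hord : addOrderOf P = 2 ^ (1 + 1) := by
    refine addOrderOf_eq_prime_pow ?_ ?_
    · rw [pow_one, two_nsmul]
      exact hPP.ne_zero
    · rw [show 2 ^ (1 + 1) = 2 + 2 from rfl, add_nsmul, two_nsmul, hT]
  have h := nonempty_addEquiv_zmod (torsion_eq_zmultiples (P := P) hodd
    (addOrderOf_pos_iff.1 (by rw [hord]; norm_num)) (fun R hR => ?_)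
    fun R hR => hhalf (hW.isDouble (R := R) (hR ▸ hP)))
  · rwa [hord] at h
  · rcases hW.eq_zero_or_hasX hR with rfl | ⟨X, hX, hX0⟩
    · exact zero_mem _
    · obtain rfl := (mul_eq_zero.1 hX0).resolve_right (hroot X)
      rw [hW.eq_of_hasX (zero_mul _) hX hPP]
      exact add_mem (AddSubgroup.mem_zmultiples P) (AddSubgroup.mem_zmultiples P)

/-- The torsion is cyclic of order `8`, generated by a point whose double has `X = ±1`, if this
point is not divisible by `2` and there are no further points of order `2`. -/
theorem IsModel.torsion_zmod_eight (hW : IsModel W e A)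
    (hodd : ∀ (R : W.Point) (n : ℕ), Odd n → n • R = 0 → R = 0)
    (hroot : ∀ X : K, X ^ 2 + A * X + 1 ≠ 0) {ε : K} (hε : ε ^ 2 = 1) (h2 : 2 * ε + A ≠ 0)
    {η : K} (hη0 : η ≠ 0) (hη : η ^ 2 = 4 * X * (X ^ 2 + A * X + 1))
    (hX : (X ^ 2 - 1) ^ 2 = ε * η ^ 2) (hhalf : ¬ IsDouble A X) :
    Nonempty (AddCommGroup.torsion W.Point ≃+ ZMod 8) := by
  obtain ⟨P, hP⟩ := hW.exists_hasX hη0 hη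
  have hP2 : HasX W e ε (P + P) := by
    refine hW.hasX_add_self hP (fun h => hη0 ?_) (by rw [hX, hη])
    rw [← sq_eq_zero_iff, hη, mul_assoc, h, mul_zero]
  have hP4 := hW.hasX_zero hε h2 hP2
  have hT := hW.add_self_eq_zero (zero_mul _) hP4
  have h4 : 4 • P = P + P + (P + P) := by rw [show 4 = 2 + 2 from rfl, add_nsmul, two_nsmul]
  have hord : addOrderOf P = 2 ^ (2 + 1) := by
    refine addOrderOf_eq_prime_pow ?_ ?_
    · rw [show 2 ^ 2 = 4 from rfl, h4]
      exact hP4.ne_zero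
    · rw [show 2 ^ (2 + 1) = 4 + 4 from rfl, add_nsmul, h4, hT]
  have h := nonempty_addEquiv_zmod (torsion_eq_zmultiples (P := P) hodd
    (addOrderOf_pos_iff.1 (by rw [hord]; norm_num)) (fun R hR => ?_)
    fun R hR => hhalf (hW.isDouble (R := R) (hR ▸ hP)))
  · rwa [hord] at h
  · rcases hW.eq_zero_or_hasX hR with rfl | ⟨X, hX, hX0⟩
    · exact zero_mem _
    · obtain rfl := (mul_eq_zero.1 hX0).resolve_right (hroot X)
      rw [hW.eq_of_hasX (zero_mul _) hX hP4, ← h4]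
      exact AddSubgroup.nsmul_mem_zmultiples P 4

/-- The torsion is `ℤ/2 × ℤ/4` if there are points with `X = 1` and with `X = -1`, neither of them
divisible by `2`, and no point of order `2` other than the one with `X = 0` is divisible by `2`. -/
theorem IsModel.torsion_zmod_two_prod_zmod_four (hW : IsModel W e A)
    (hodd : ∀ (R : W.Point) (n : ℕ), Odd n → n • R = 0 → R = 0)
    {η η' : K} (hη0 : η ≠ 0) (hη'0 : η' ≠ 0) (hη : η ^ 2 = 4 * (2 + A))
    (hη' : η' ^ 2 = 4 * (-2 + A)) (hhalf : ¬ IsDouble A 1) (hhalf' : ¬ IsDouble A (-1))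
    (hhalf0 : ∀ X : K, X ^ 2 + A * X + 1 = 0 → ¬ IsDouble A X) :
    Nonempty (AddCommGroup.torsion W.Point ≃+ ZMod 2 × ZMod 4) := by
  obtain ⟨P, hP⟩ := hW.exists_hasX (X := 1) hη0 (by rw [hη]; ring)
  obtain ⟨P', hP'⟩ := hW.exists_hasX (X := -1) hη'0 (by rw [hη']; ring)
  have hPP := hW.hasX_zero (one_pow 2) (fun h => hη0 (by
    rw [← sq_eq_zero_iff, hη]; linear_combination 4 * h)) hP
  have hPP' := hW.hasX_zero (neg_one_sq) (fun h => hη'0 (by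
    rw [← sq_eq_zero_iff, hη']; linear_combination 4 * h)) hP'
  have heq := hW.eq_of_hasX (zero_mul _) hPP' hPP
  have hT := hW.add_self_eq_zero (zero_mul _) hPP
  have hQ : P' - P + (P' - P) = 0 := by rw [sub_add_sub_comm, heq, sub_self]
  have h11 : (1 : K) ≠ -1 := by norm_num
  have hQ0 : P' - P ≠ 0 := fun h => h11 (hP.eq (sub_eq_zero.1 h ▸ hP'))
  have hQP : P' - P ≠ P + P := fun h => by
    have h' : P' = -P := by
      rw [eq_neg_iff_add_eq_zero, ← hT]
      nth_rw 2 [← h]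
      abel
    obtain ⟨y, hy, rfl⟩ := hP
    rw [h', Point.neg_some] at hP'
    exact h11 (HasX.eq ⟨_, _, rfl⟩ hP')
  -- the points of order `2` other than `P + P` have the roots of `X ^ 2 + A * X + 1` as coordinates
  have hroot : ∀ S : W.Point, S + S = 0 → S ≠ 0 → S ≠ P + P →
      ∃ X, HasX W e X S ∧ X ^ 2 + A * X + 1 = 0 := fun S hS hS0 hST => by
    obtain ⟨X, hX, hX0⟩ := (hW.eq_zero_or_hasX hS).resolve_left hS0
    refine ⟨X, hX, (mul_eq_zero.1 hX0).resolve_left fun h => hST ?_⟩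
    subst h
    exact hW.eq_of_hasX (zero_mul _) hX hPP
  obtain ⟨r, hr, hr0⟩ := hroot _ hQ hQ0 hQP
  obtain ⟨r', hr', hr'0⟩ := hroot (P' - P + (P + P)) (by rw [add_add_add_comm, hQ, hT, add_zero])
    (fun h => hQP (by rw [eq_neg_of_add_eq_zero_left h, neg_eq_of_add_eq_zero_left hT]))
    (fun h => hQ0 (add_eq_right.1 h))
  have hrr' : r' ≠ r := by
    rintro rfl
    exact hPP.ne_zero (add_eq_left.1 (hW.eq_of_hasX (by rw [hr0, mul_zero]) hr' hr))
  refine nonempty_torsion_addEquiv_zmod_two_prod_zmod_four (P := P) (Q := P' - P) hodd hPP.ne_zero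
    hT hQ hQ0 hQP (fun R hR => ?_) (fun R h => hhalf (hW.isDouble (R := R) (h ▸ hP)))
    (fun R h => hhalf0 r hr0 (hW.isDouble (R := R) (h ▸ hr)))
    (fun R h => hhalf' (hW.isDouble (R := R) (by rwa [h, sub_add_cancel])))
  by_cases hR0 : R = 0
  · exact Or.inl hR0
  by_cases hRT : R = P + P
  · exact Or.inr (Or.inl hRT)
  obtain ⟨X, hX, hX0⟩ := hroot R hR hR0 hRT
  by_cases hXr : X = r
  · subst hXr
    exact Or.inr (Or.inr (Or.inl (hW.eq_of_hasX (by rw [hX0, mul_zero]) hX hr)))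
  · have h1 : X + r + A = 0 := (mul_eq_zero.1 (show (X - r) * (X + r + A) = 0 by
      linear_combination hX0 - hr0)).resolve_left (sub_ne_zero.2 hXr)
    have h2 : r' + r + A = 0 := (mul_eq_zero.1 (show (r' - r) * (r' + r + A) = 0 by
      linear_combination hr'0 - hr0)).resolve_left (sub_ne_zero.2 hrr')
    obtain rfl : X = r' := by linear_combination h1 - h2
    exact Or.inr (Or.inr (Or.inr (hW.eq_of_hasX (by rw [hX0, mul_zero]) hX hr')))

end Model

end DynModCurve

/-! ### Halving points over quadratic fields -/

namespace DynModCurve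

section Halving

variable {K : Type*} [Field K]

lemma IsDouble.exists_sq {A k : K} (h : IsDouble A k) : ∃ z, z ^ 2 = k := by
  obtain ⟨X, η, h0, -, h⟩ := h
  exact ⟨(X ^ 2 - 1) / η, by rw [div_pow, h, mul_div_cancel_right₀ _ (pow_ne_zero 2 h0)]⟩

/-- The halving equation in terms of `w = X + X⁻¹` and `z = (X - X⁻¹) / 2`. -/
lemma IsDouble.exists_add_inv [CharZero K] {A k : K} (h : IsDouble A k) :
    ∃ w z, w ^ 2 - 4 = 4 * k * (w + A) ∧ z ^ 2 = k * (w + A) := by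
  obtain ⟨X, η, h0, hη, h⟩ := h
  have hX : X ≠ 0 := by
    rintro rfl
    apply h0
    rw [← sq_eq_zero_iff, hη]
    ring
  rw [hη] at h
  have hw : (X + X⁻¹) ^ 2 - 4 = 4 * k * (X + X⁻¹ + A) := by
    field_simp
    linear_combination h
  refine ⟨X + X⁻¹, (X - X⁻¹) / 2, hw, ?_⟩
  linear_combination hw / 4 - mul_inv_cancel₀ hX

/-- If a point of order `2` with `X = r ≠ 0` has a half with coordinate `X`, then
`(X - r)² = r² - 1`. -/
lemma IsDouble.exists_sq_of_root {A r : K} (h : IsDouble A r) (hr : r ^ 2 + A * r + 1 = 0) :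
    ∃ z, z ^ 2 = -2 - A * r := by
  obtain ⟨X, η, h0, hη, h⟩ := h
  rw [hη] at h
  have h1 : (X ^ 2 - 2 * r * X + 1) ^ 2 = 0 := by
    linear_combination h + 4 * X ^ 2 * hr
  refine ⟨X - r, ?_⟩
  linear_combination (sq_eq_zero_iff.1 h1) + hr

/-- If `X + X⁻¹ = t` and the point with coordinate `X` is divisible by `2`, then `X` is a square,
hence so is `t + 2`. -/
lemma IsDouble.exists_sq_add_two {A X t : K} (h : IsDouble A X) (hX : X ^ 2 = t * X - 1) :
    ∃ z, z ^ 2 = t + 2 := by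
  obtain ⟨z, rfl⟩ := h.exists_sq
  have hz : z ≠ 0 := by
    rintro rfl
    simp at hX
  refine ⟨z + z⁻¹, ?_⟩
  field_simp
  linear_combination hX

variable [Algebra ℚ K] {d : ℤ} {s : K}

lemma exists_eq_of_sq_eq {q : ℚ} (hs : s ^ 2 = (d : K)) {z : K}
    (hz : z ^ 2 = ((q ^ 2 * d : ℚ) : K)) :
    ∃ q' : ℚ, q' ^ 2 = q ^ 2 ∧ z = q' * s := by
  have := charZero_of_algebra K
  have h : z ^ 2 = (q * s) ^ 2 := by rw [hz, mul_pow, hs]; push_cast; rfl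
  rcases sq_eq_sq_iff_eq_or_eq_neg.1 h with h | h
  · exact ⟨q, rfl, h⟩
  · exact ⟨-q, neg_sq q, by rw [h]; push_cast; ring⟩

/-- The point with `X = ε = ±1` is not divisible by `2` if `8 + 4 ε A` is `d` times a square: the
number `ε (w + A)` of `IsDouble.exists_add_inv` then has norm `A² - 4`. -/
lemma not_isDouble_of_sq_eq_one (hd : Squarefree d) (hd1 : d ≠ 1) (hs : s ^ 2 = (d : K))
    (hK : IntermediateField.adjoin ℚ {s} = ⊤) {A ε q : ℚ} (hε : ε ^ 2 = 1)
    (hq : 8 + 4 * ε * A = q ^ 2 * d) (hA : ¬ IsSquare (A ^ 2 - 4)) :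
    ¬ IsDouble (A : K) (ε : K) := by
  have := charZero_of_algebra K
  intro h
  obtain ⟨w, z, hw, hz⟩ := h.exists_add_inv
  have hε' : (ε : K) ^ 2 = 1 := by exact_mod_cast hε
  obtain ⟨q', hq', hw⟩ := exists_eq_of_sq_eq (q := q) hs (z := w - 2 * ε) (by
    rw [← hq]
    push_cast
    linear_combination hw + 4 * hε')
  obtain rfl : w = 2 * ε + q' * s := by linear_combination hw
  apply hA
  have := isSquare_norm_of_sq hd hd1 hs hK (α := 2 + ε * A) (β := ε * q') (z := z) (by
    rw [hz]
    push_cast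
    linear_combination 2 * hε')
  convert this using 1
  linear_combination (-A ^ 2 + d * q' ^ 2) * hε + d * hq' - hq

/-- The points of order `2` with `X ≠ 0` are not divisible by `2`: the number `r² - 1 = -2 - A r` of
`IsDouble.exists_sq_of_root` has norm `4 - A²`. -/
lemma not_isDouble_of_root (hd : Squarefree d) (hd1 : d ≠ 1) (hs : s ^ 2 = (d : K))
    (hK : IntermediateField.adjoin ℚ {s} = ⊤) {A q : ℚ} (hq : A ^ 2 - 4 = q ^ 2 * d)
    (hA : ¬ IsSquare (4 - A ^ 2)) (r : K) (hr : r ^ 2 + A * r + 1 = 0) : ¬ IsDouble (A : K) r := by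
  have := charZero_of_algebra K
  intro h
  obtain ⟨z, hz⟩ := h.exists_sq_of_root hr
  obtain ⟨q', hq', hr'⟩ := exists_eq_of_sq_eq (q := q) hs (z := 2 * r + A) (by
    rw [← hq]; push_cast; linear_combination 4 * hr)
  obtain rfl : r = (q' * s - A) / 2 := by linear_combination hr' / 2
  apply hA
  have := isSquare_norm_of_sq hd hd1 hs hK (α := -2 + A ^ 2 / 2) (β := -(A * q' / 2)) (z := z) (by
    rw [hz]; push_cast; ring)
  convert this using 1
  linear_combination A ^ 2 / 4 * d * hq' - A ^ 2 / 4 * hq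

/-- The polynomial `X² + A X + 1` of discriminant `q² r` has a root in `ℚ(√d)` only if `r` is `1`
or `d`. -/
lemma eq_one_or_eq_of_root (hd : Squarefree d) (hs : s ^ 2 = (d : K))
    (hK : IntermediateField.adjoin ℚ {s} = ⊤) {r : ℤ} (hr : Squarefree r) {A q : ℚ} (hq0 : q ≠ 0)
    (hq : A ^ 2 - 4 = q ^ 2 * r) {X : K} (hX : X ^ 2 + A * X + 1 = 0) : r = 1 ∨ r = d := by
  have := charZero_of_algebra K
  refine eq_one_or_eq_of_sq hd hs hK hr (z := (2 * X + A) / q) ?_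
  have hq0' : (q : K) ^ 2 ≠ 0 := pow_ne_zero 2 (by exact_mod_cast hq0)
  have hq' : (A : K) ^ 2 - 4 = q ^ 2 * r := by exact_mod_cast congrArg (Rat.cast (K := K)) hq
  rw [div_pow, div_eq_iff hq0']
  linear_combination 4 * hX + hq'

lemma not_isDouble_neg_one (hd : Squarefree d) (hs : s ^ 2 = (d : K))
    (hK : IntermediateField.adjoin ℚ {s} = ⊤) (hd1 : d ≠ -1) (A : K) : ¬ IsDouble A (-1) := by
  intro h
  obtain ⟨z, hz⟩ := h.exists_sq
  rcases eq_one_or_eq_of_sq hd hs hK (r := -1) isUnit_one.neg.squarefree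
      (by push_cast; exact hz) with h | h
  · exact absurd h (by decide)
  · exact hd1 h.symm

end Halving

end DynModCurve

/-! ### The torsion of the curves with a rational point of order `2` -/

namespace DynModCurve

section Curves

variable {K : Type*} [Field K] [Algebra ℚ K] {d : ℤ} {s : K}

lemma isModel_curve24A4 : IsModel (curve24A4.baseChange K) 0 ((-1 : ℚ) : K) := by
  constructor <;>
    simp [curve24A4, WeierstrassCurve.b₂, WeierstrassCurve.b₄, WeierstrassCurve.b₆]

lemma isModel_curve40A3 : IsModel (curve40A3.baseChange K) 1 ((3 : ℚ) : K) := by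
  constructor <;>
    simp [curve40A3, WeierstrassCurve.b₂, WeierstrassCurve.b₄, WeierstrassCurve.b₆] <;> norm_num

lemma isModel_curve17A4 : IsModel (curve17A4.baseChange K) 1 ((9 / 4 : ℚ) : K) := by
  have := charZero_of_algebra K
  constructor <;>
    simp [curve17A4, WeierstrassCurve.b₂, WeierstrassCurve.b₄, WeierstrassCurve.b₆] <;> norm_num

lemma isModel_curve15A8 : IsModel (curve15A8.baseChange K) (-1) ((-7 / 4 : ℚ) : K) := by
  have := charZero_of_algebra K
  constructor <;>
    simp [curve15A8, WeierstrassCurve.b₂, WeierstrassCurve.b₄, WeierstrassCurve.b₆] <;> norm_num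

/-- Halving the point of order `4` of 24A4 requires `√-1` or `√3`. -/
lemma not_isDouble_one_curve24A4 (hd : Squarefree d) (hs : s ^ 2 = (d : K))
    (hK : IntermediateField.adjoin ℚ {s} = ⊤) (h1 : d ≠ -1) (h3 : d ≠ 3) :
    ¬ IsDouble ((-1 : ℚ) : K) 1 := by
  have := charZero_of_algebra K
  intro h
  obtain ⟨w, z, hw, hz⟩ := h.exists_add_inv
  push_cast at hw hz
  have hw' : w * (w - 4) = 0 := by linear_combination hw
  rcases mul_eq_zero.1 hw' with rfl | hw
  · rcases eq_one_or_eq_of_sq hd hs hK (r := -1) isUnit_one.neg.squarefree (z := z) (by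
      push_cast; linear_combination hz) with h | h
    · exact absurd h (by decide)
    · exact h1 h.symm
  · obtain rfl := sub_eq_zero.1 hw
    rcases eq_one_or_eq_of_sq hd hs hK (r := 3) Int.prime_three.squarefree (z := z) (by
      push_cast; linear_combination hz) with h | h
    · exact absurd h (by decide)
    · exact h3 h.symm

/-- Halving the point of order `4` of 15A8 requires `√-3` or `√5`. -/
lemma not_isDouble_one_curve15A8 (hd : Squarefree d) (hs : s ^ 2 = (d : K))
    (hK : IntermediateField.adjoin ℚ {s} = ⊤) (h1 : d ≠ -3) (h3 : d ≠ 5) :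
    ¬ IsDouble ((-7 / 4 : ℚ) : K) 1 := by
  have := charZero_of_algebra K
  intro h
  obtain ⟨w, z, hw, hz⟩ := h.exists_add_inv
  push_cast at hw hz
  have hw' : (w - 1) * (w - 3) = 0 := by linear_combination hw
  rcases mul_eq_zero.1 hw' with hw | hw
  · obtain rfl := sub_eq_zero.1 hw
    rcases eq_one_or_eq_of_sq hd hs hK (r := -3) Int.prime_three.neg.squarefree (z := 2 * z) (by
      push_cast; linear_combination 4 * hz) with h | h
    · exact absurd h (by decide)
    · exact h1 h.symm
  · obtain rfl := sub_eq_zero.1 hw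
    rcases eq_one_or_eq_of_sq hd hs hK (r := 5)
        (Nat.prime_iff_prime_int.1 Nat.prime_five).squarefree
      (z := 2 * z) (by push_cast; linear_combination 4 * hz) with h | h
    · exact absurd h (by decide)
    · exact h3 h.symm

/-- The points of order `8` of 15A8 over `ℚ(√5)` are not divisible by `2`. -/
lemma not_isDouble_curve15A8_of_five (hd : Squarefree (5 : ℤ)) (hs : s ^ 2 = ((5 : ℤ) : K))
    (hK : IntermediateField.adjoin ℚ {s} = ⊤) : ¬ IsDouble ((-7 / 4 : ℚ) : K) ((3 + s) / 2) := by
  have := charZero_of_algebra K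
  intro h
  obtain ⟨w, z, hw, hz⟩ := h.exists_add_inv
  push_cast at hw hz
  have hs' : s ^ 2 = 5 := by rw [hs]; norm_num
  -- with `θ = (1 + s) / 2`, so that `θ ^ 2 = (3 + s) / 2`, the solutions are `w = θ, 3 θ + 4`
  have hw' : (w - (1 + s) / 2) * (w - (11 + 3 * s) / 2) = 0 := by
    linear_combination hw + 3 / 4 * hs'
  rcases mul_eq_zero.1 hw' with hw | hw <;> obtain rfl := sub_eq_zero.1 hw
  · have := isSquare_norm_of_sq hd (by decide) hs hK (α := -5 / 8) (β := 1 / 8) (z := z) (by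
      rw [hz]; push_cast; linear_combination hs' / 4)
    norm_num at this
  · have := isSquare_norm_of_sq hd (by decide) hs hK (α := 75 / 8) (β := 33 / 8) (z := z) (by
      rw [hz]; push_cast; linear_combination 3 / 4 * hs')
    norm_num at this

variable [DecidableEq K]

/-- There are no points of odd order if `A` is an odd integer. -/
lemma IsModel.eq_zero_of_odd_order_of_odd (hs : s ^ 2 = (d : K))
    (hK : IntermediateField.adjoin ℚ {s} = ⊤) {W : WeierstrassCurve.Affine K} {e : K} {A : ℚ}
    (hW : IsModel W e A) {B : ℤ} (hA : A = 2 * B + 1) (R : W.Point) (n : ℕ) (hn : Odd n)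
    (hR : n • R = 0) : R = 0 := by
  have := charZero_of_algebra K
  obtain ⟨v, hv⟩ := exists_isTwoAdic hs hK
  subst hA
  refine hW.eq_zero_of_odd_order hv ?_ (fun X hX h => ?_) hn hR
  · have := abv_intCast_le hv.add_le (4 * (2 * B + 1))
    push_cast at this ⊢
    exact this
  · refine false_of_doubling_of_four_mul_odd hv (B := B) hX fun n => ?_
    have := h n
    push_cast at this
    exact this

/-- There are no points of odd order if `4 A` is an odd integer. -/
lemma IsModel.eq_zero_of_odd_order_of_four_mul_odd (hs : s ^ 2 = (d : K))
    (hK : IntermediateField.adjoin ℚ {s} = ⊤) {W : WeierstrassCurve.Affine K} {e : K} {A : ℚ}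
    (hW : IsModel W e A) {B : ℤ} (hA : 4 * A = 2 * B + 1) (R : W.Point) (n : ℕ) (hn : Odd n)
    (hR : n • R = 0) : R = 0 := by
  have := charZero_of_algebra K
  obtain ⟨v, hv⟩ := exists_isTwoAdic hs hK
  have hA' : (4 * A : K) = ((2 * B + 1 : ℤ) : K) := by
    have := congrArg (Rat.cast (K := K)) hA
    push_cast at this ⊢
    exact this
  refine hW.eq_zero_of_odd_order hv ?_ (fun X hX h => ?_) hn hR
  · rw [hA']
    exact abv_intCast_le hv.add_le _
  · refine false_of_doubling_of_odd hv ?_ hX h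
    rw [hA']
    push_cast
    rw [add_sub_cancel_right]
    exact abv_mul_lt_left hv.two_lt (abv_intCast_le hv.add_le B)

theorem torsion_curve40A3 (hd : Squarefree d) (hs : s ^ 2 = (d : K))
    (hK : IntermediateField.adjoin ℚ {s} = ⊤) :
    (d = 5 → Nonempty (Torsion curve40A3 K ≃+ ZMod 2 × ZMod 4)) ∧
      (d ≠ 5 → Nonempty (Torsion curve40A3 K ≃+ ZMod 4)) := by
  have := charZero_of_algebra K
  have hW := isModel_curve40A3 (K := K)
  have hodd := hW.eq_zero_of_odd_order_of_odd hs hK (B := 1) (by norm_num)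
  refine ⟨?_, fun h5 => ?_⟩
  · rintro rfl
    refine hW.torsion_zmod_two_prod_zmod_four hodd (η := 2 * s) (η' := 2) ?_ ?_ ?_ ?_ ?_ ?_ ?_
    · intro h
      have h0 : s = 0 := by simpa using h
      norm_num [h0] at hs
    · norm_num
    · push_cast at hs ⊢
      linear_combination 4 * hs
    · push_cast
      norm_num
    · have := not_isDouble_of_sq_eq_one hd (by decide) hs hK (A := 3) (ε := 1) (q := 2)
        (by norm_num)
        (by norm_num) (by norm_num)
      simpa using this
    · exact not_isDouble_neg_one hd hs hK (by decide) _
    · exact not_isDouble_of_root hd (by decide) hs hK (q := 1) (by norm_num) (by norm_num)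
  · refine hW.torsion_zmod_four hodd (ε := -1) (η := 2) ?_ ?_ ?_ ?_ ?_
    · intro X hX
      rcases eq_one_or_eq_of_root hd hs hK (r := 5)
          (Nat.prime_iff_prime_int.1 Nat.prime_five).squarefree
        (q := 1) one_ne_zero (by norm_num) hX with h | h
      · exact absurd h (by decide)
      · exact h5 h.symm
    · norm_num
    · norm_num
    · push_cast
      norm_num
    · by_cases h1 : d = -1
      · subst h1
        have := not_isDouble_of_sq_eq_one hd (by decide) hs hK (A := 3) (ε := -1) (q := 2)
            (by norm_num)
          (by norm_num) (by norm_num)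
        simpa using this
      · exact not_isDouble_neg_one hd hs hK h1 _

theorem torsion_curve17A4 (hd : Squarefree d) (hs : s ^ 2 = (d : K))
    (hK : IntermediateField.adjoin ℚ {s} = ⊤) :
    (d = 17 → Nonempty (Torsion curve17A4 K ≃+ ZMod 2 × ZMod 4)) ∧
      (d ≠ 17 → Nonempty (Torsion curve17A4 K ≃+ ZMod 4)) := by
  have := charZero_of_algebra K
  have hW := isModel_curve17A4 (K := K)
  have hodd := hW.eq_zero_of_odd_order_of_four_mul_odd hs hK (B := 4) (by norm_num)
  refine ⟨?_, fun h5 => ?_⟩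
  · rintro rfl
    refine hW.torsion_zmod_two_prod_zmod_four hodd (η := s) (η' := 1) ?_ one_ne_zero ?_ ?_ ?_ ?_ ?_
    · rintro rfl
      norm_num at hs
    · push_cast at hs ⊢
      linear_combination hs
    · push_cast
      norm_num
    · have := not_isDouble_of_sq_eq_one hd (by decide) hs hK (A := 9 / 4) (ε := 1) (q := 1)
        (by norm_num) (by norm_num) (by norm_num)
      simpa using this
    · exact not_isDouble_neg_one hd hs hK (by decide) _
    · exact not_isDouble_of_root hd (by decide) hs hK (q := 1 / 4) (by norm_num) (by norm_num)
  · refine hW.torsion_zmod_four hodd (ε := -1) (η := 1) ?_ ?_ one_ne_zero ?_ ?_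
    · intro X hX
      rcases eq_one_or_eq_of_root hd hs hK (r := 17)
        (Nat.prime_iff_prime_int.1 (by norm_num : Nat.Prime 17)).squarefree
        (q := 1 / 4) (by norm_num) (by norm_num) hX with h | h
      · exact absurd h (by decide)
      · exact h5 h.symm
    · norm_num
    · push_cast
      norm_num
    · by_cases h1 : d = -1
      · subst h1
        have := not_isDouble_of_sq_eq_one hd (by decide) hs hK (A := 9 / 4) (ε := -1) (q := 1)
          (by norm_num) (by norm_num) (by norm_num)
        simpa using this
      · exact not_isDouble_neg_one hd hs hK h1 _

theorem torsion_curve24A4 (hd : Squarefree d) (hs : s ^ 2 = (d : K))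
    (hK : IntermediateField.adjoin ℚ {s} = ⊤) :
    (d = -3 → Nonempty (Torsion curve24A4 K ≃+ ZMod 2 × ZMod 4)) ∧
      (d = -1 ∨ d = 3 → Nonempty (Torsion curve24A4 K ≃+ ZMod 8)) ∧
      (d ≠ -3 ∧ d ≠ -1 ∧ d ≠ 3 → Nonempty (Torsion curve24A4 K ≃+ ZMod 4)) := by
  have := charZero_of_algebra K
  have hW := isModel_curve24A4 (K := K)
  have hodd := hW.eq_zero_of_odd_order_of_odd hs hK (B := -1) (by norm_num)
  have hroot : d ≠ -3 → ∀ X : K, X ^ 2 + ((-1 : ℚ) : K) * X + 1 ≠ 0 := fun h3 X hX => by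
    rcases eq_one_or_eq_of_root hd hs hK (r := -3) Int.prime_three.neg.squarefree
      (q := 1) one_ne_zero (by norm_num) hX with h | h
    · exact absurd h (by decide)
    · exact h3 h.symm
  refine ⟨?_, ?_, fun ⟨h3, h1, h3'⟩ => ?_⟩
  · rintro rfl
    refine hW.torsion_zmod_two_prod_zmod_four hodd (η := 2) (η' := 2 * s) ?_ ?_ ?_ ?_ ?_ ?_ ?_
    · norm_num
    · intro h
      have h0 : s = 0 := by simpa using h
      norm_num [h0] at hs
    · push_cast
      norm_num
    · push_cast at hs ⊢
      linear_combination 4 * hs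
    · exact not_isDouble_one_curve24A4 hd hs hK (by decide) (by decide)
    · exact not_isDouble_neg_one hd hs hK (by decide) _
    · exact not_isDouble_of_root hd (by decide) hs hK (q := 1) (by norm_num) (by norm_num)
  · -- generators of order `8`: their coordinates satisfy `X + X⁻¹ = 0` and `X + X⁻¹ = 4`
    rintro (rfl | rfl)
    · push_cast at hs
      refine hW.torsion_zmod_eight hodd (hroot (by decide)) (ε := 1) (X := s) (η := 2) (one_pow 2)
        ?_ ?_ ?_ ?_ ?_
      · push_cast
        norm_num
      · norm_num
      · push_cast
        linear_combination (-4 * s + 4) * hs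
      · linear_combination (s ^ 2 - 3) * hs
      · intro h
        obtain ⟨z, hz⟩ := h.exists_sq_add_two (t := 0) (by linear_combination hs)
        rcases eq_one_or_eq_of_sq hd (by push_cast; exact hs) hK (r := 2) Int.prime_two.squarefree
          (z := z) (by rw [hz]; norm_num) with h | h <;> exact absurd h (by decide)
    · push_cast at hs
      have h2s : 2 + s ≠ 0 := fun h => by
        have : (1 : K) = 0 := by linear_combination hs + (2 - s) * h
        exact one_ne_zero this
      have hs0 : s ≠ 0 := by
        rintro rfl
        norm_num at hs
      refine hW.torsion_zmod_eight hodd (hroot (by decide)) (ε := 1) (X := 2 + s)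
        (η := 2 * s * (2 + s)) (one_pow 2) ?_ ?_ ?_ ?_ ?_
      · push_cast
        norm_num
      · exact mul_ne_zero (mul_ne_zero two_ne_zero hs0) h2s
      · push_cast
        linear_combination (4 * (2 + s) ^ 2 - 4 * (2 + s)) * hs
      · linear_combination -(3 * s ^ 2 + 8 * s + 3) * hs
      · intro h
        obtain ⟨z, hz⟩ := h.exists_sq_add_two (t := 4) (by linear_combination hs)
        rcases eq_one_or_eq_of_sq hd (by push_cast; exact hs) hK (r := 6)
          (Int.squarefree_natAbs.1 (by decide +kernel)) (z := z)
          (by rw [hz]; norm_num) with h | h <;>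
          exact absurd h (by decide)
  · refine hW.torsion_zmod_four hodd (hroot h3) (ε := 1) (η := 2) (one_pow 2) ?_ ?_
      (not_isDouble_one_curve24A4 hd hs hK h1 h3')
    · norm_num
    · push_cast
      norm_num

theorem torsion_curve15A8 (hd : Squarefree d) (hs : s ^ 2 = (d : K))
    (hK : IntermediateField.adjoin ℚ {s} = ⊤) :
    (d = -15 → Nonempty (Torsion curve15A8 K ≃+ ZMod 2 × ZMod 4)) ∧
      (d = -3 ∨ d = 5 → Nonempty (Torsion curve15A8 K ≃+ ZMod 8)) ∧
      (d ≠ -15 ∧ d ≠ -3 ∧ d ≠ 5 → Nonempty (Torsion curve15A8 K ≃+ ZMod 4)) := by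
  have := charZero_of_algebra K
  have hW := isModel_curve15A8 (K := K)
  have hodd := hW.eq_zero_of_odd_order_of_four_mul_odd hs hK (B := -4) (by norm_num)
  have hroot : d ≠ -15 → ∀ X : K, X ^ 2 + ((-7 / 4 : ℚ) : K) * X + 1 ≠ 0 := fun h3 X hX => by
    rcases eq_one_or_eq_of_root hd hs hK (r := -15) (Int.squarefree_natAbs.1 (by decide +kernel))
      (q := 1 / 4) (by norm_num) (by norm_num) hX with h | h
    · exact absurd h (by decide)
    · exact h3 h.symm
  refine ⟨?_, ?_, fun ⟨h3, h1, h3'⟩ => ?_⟩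
  · rintro rfl
    refine hW.torsion_zmod_two_prod_zmod_four hodd (η := 1) (η' := s) one_ne_zero ?_ ?_ ?_ ?_ ?_ ?_
    · rintro rfl
      norm_num at hs
    · push_cast
      norm_num
    · push_cast at hs ⊢
      linear_combination hs
    · exact not_isDouble_one_curve15A8 hd hs hK (by decide) (by decide)
    · exact not_isDouble_neg_one hd hs hK (by decide) _
    · exact not_isDouble_of_root hd (by decide) hs hK (q := 1 / 4) (by norm_num) (by norm_num)
  · -- generators of order `8`: their coordinates satisfy `X + X⁻¹ = 1` and `X + X⁻¹ = 3`
    rintro (rfl | rfl)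
    · push_cast at hs
      have h2s : 1 + s ≠ 0 := fun h => by
        have : (4 : K) = 0 := by linear_combination hs + (1 - s) * h
        norm_num at this
      have hs0 : s ≠ 0 := by
        rintro rfl
        norm_num at hs
      refine hW.torsion_zmod_eight hodd (hroot (by decide)) (ε := 1) (X := (1 + s) / 2)
        (η := s * ((1 + s) / 2)) (one_pow 2) ?_ ?_ ?_ ?_ ?_
      · push_cast
        norm_num
      · exact mul_ne_zero hs0 (div_ne_zero h2s two_ne_zero)
      · push_cast
        linear_combination (1 + s) * (s - 1) / 4 * hs
      · linear_combination -(3 * s ^ 2 + 4 * s - 3) / 16 * hs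
      · intro h
        obtain ⟨z, hz⟩ := h.exists_sq_add_two (t := 1) (by linear_combination hs / 4)
        rcases eq_one_or_eq_of_sq hd (by push_cast; exact hs) hK (r := 3) Int.prime_three.squarefree
          (z := z) (by rw [hz]; norm_num) with h | h <;> exact absurd h (by decide)
    · have hs' := hs
      push_cast at hs
      have h2s : 3 + s ≠ 0 := fun h => by
        have : (4 : K) = 0 := by linear_combination hs + (3 - s) * h
        norm_num at this
      have hs0 : s ≠ 0 := by
        rintro rfl
        norm_num at hs
      refine hW.torsion_zmod_eight hodd (hroot (by decide)) (ε := 1) (X := (3 + s) / 2)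
        (η := s * ((3 + s) / 2)) (one_pow 2) ?_ ?_ ?_ ?_ (not_isDouble_curve15A8_of_five hd hs' hK)
      · push_cast
        norm_num
      · exact mul_ne_zero hs0 (div_ne_zero h2s two_ne_zero)
      · push_cast
        linear_combination (3 + s) * (s + 1) / 4 * hs
      · linear_combination -(3 * s ^ 2 + 12 * s + 5) / 16 * hs
  · refine hW.torsion_zmod_four hodd (hroot h3) (ε := 1) (η := 1) (one_pow 2) one_ne_zero ?_
      (not_isDouble_one_curve15A8 hd hs hK h1 h3')
    push_cast
    norm_num

end Curves

end DynModCurve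

/-! ### The torsion of the curve 11A3 -/

namespace DynModCurve

open WeierstrassCurve.Affine

/-- The roots of this cubic are the inverses of the `x`-coordinates of the points of order `2` of
11A3.  The homogeneous cubic has no nontrivial zero modulo `3`. -/
lemma cubic_ne_zero (r : ℚ) : r ^ 3 - 4 * r + 4 ≠ 0 := by
  intro h
  have hden : (r.den : ℚ) ≠ 0 := by exact_mod_cast r.den_ne_zero
  have h1 : r.num ^ 3 - 4 * r.num * (r.den : ℤ) ^ 2 + 4 * (r.den : ℤ) ^ 3 = 0 := by
    have h2 : (r.num : ℚ) = r * r.den := (Rat.mul_den_eq_num r).symm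
    have : (r.num : ℚ) ^ 3 - 4 * r.num * (r.den : ℚ) ^ 2 + 4 * (r.den : ℚ) ^ 3 = 0 := by
      rw [h2]
      linear_combination (r.den : ℚ) ^ 3 * h
    exact_mod_cast this
  have h3 : ∀ a b : ZMod 3, a ^ 3 - 4 * a * b ^ 2 + 4 * b ^ 3 = 0 → a = 0 ∧ b = 0 := by decide
  obtain ⟨ha, hb⟩ := h3 (r.num : ZMod 3) (r.den : ZMod 3) (by
    have := congrArg (Int.cast (R := ZMod 3)) h1
    push_cast at this
    exact this)
  rw [ZMod.intCast_zmod_eq_zero_iff_dvd] at ha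
  rw [ZMod.natCast_eq_zero_iff] at hb
  have := Nat.dvd_gcd (Int.natCast_dvd.1 ha) hb
  rw [r.reduced] at this
  exact absurd this (by decide)

section Curve11A3

variable {K : Type*} [Field K]

section

variable [Algebra ℚ K] {d : ℤ} {s : K}

/-- A root in `ℚ(√d)` and its conjugate would make the third root rational. -/
lemma cubic_ne_zero_of_quadratic (hd : Squarefree d) (hs : s ^ 2 = (d : K))
    (hK : IntermediateField.adjoin ℚ {s} = ⊤) (t : K) : t ^ 3 - 4 * t + 4 ≠ 0 := by
  have := charZero_of_algebra K
  have hrat : ∀ r : ℚ, (r : K) ^ 3 - 4 * r + 4 ≠ 0 := fun r h =>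
    cubic_ne_zero r (by exact_mod_cast h)
  obtain ⟨a, b, rfl⟩ := exists_add_mul_sqrt hs hK t
  by_cases hd1 : d = 1
  · subst hd1
    have hs' : s = 1 ∨ s = -1 := by simpa using hs
    rcases hs' with rfl | rfl
    · simpa using hrat (a + b)
    · simpa [← sub_eq_add_neg] using hrat (a - b)
  · intro h
    obtain ⟨h1, h2⟩ := eq_zero_of_add_mul_sqrt_eq_zero hd hd1 hs
      (a := a ^ 3 + 3 * a * b ^ 2 * d - 4 * a + 4) (b := b * (3 * a ^ 2 + b ^ 2 * d - 4)) (by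
        push_cast
        linear_combination h - (3 * a * b ^ 2 + b ^ 3 * s : K) * hs)
    rcases mul_eq_zero.1 h2 with rfl | hb
    · exact cubic_ne_zero a (by linear_combination h1)
    · -- the third root of the cubic is `-2 * a`
      exact cubic_ne_zero (-2 * a) (by linear_combination h1 - 3 * a * hb)

end

/-- The curve `y² + y = x³ - x²` over `K`. -/
abbrev curve11A3Over (K : Type*) [Field K] : WeierstrassCurve.Affine K := ⟨0, -1, 1, 0, 0⟩

lemma equation_curve11A3Over {x y : K} (h : (curve11A3Over K).Equation x y) :
    y ^ 2 + y = x ^ 3 - x ^ 2 := by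
  rw [equation_iff] at h
  simp only at h
  linear_combination h

variable {v : AbsoluteValue K ℝ}

lemma abv_y_le_one (hv : IsTwoAdic v) {x y : K} (h : y ^ 2 + y = x ^ 3 - x ^ 2) (hx : v x ≤ 1) :
    v y ≤ 1 := by
  by_contra! hy
  have h1 : v (y ^ 2 + y) = v y ^ 2 := by
    rw [abv_add_eq_left hv.add_le, map_pow]
    rw [map_pow]
    nlinarith
  have h2 : v (x ^ 3 - x ^ 2) ≤ 1 := by
    rw [show x ^ 3 - x ^ 2 = x ^ 2 * (x - 1) by ring]
    exact abv_mul_le (abv_sq_le hx) (abv_sub_le hv.add_le hx v.map_one.le)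
  rw [← h, h1] at h2
  nlinarith

/-- All affine points of the reduction over `𝔽₄` have `x = 0` or `x = 1`. -/
lemma abv_lt_one_or (hv : IsTwoAdic v) {x y : K} (h : y ^ 2 + y = x ^ 3 - x ^ 2) (hx : v x ≤ 1) :
    v (x - 0) < 1 ∨ v (x - 1) < 1 := by
  have hy := abv_y_le_one hv h hx
  have hone : v 1 ≤ 1 := v.map_one.le
  have hx3 : v (x * (x ^ 2 - (x ^ 2) ^ 2)) ≤ 1 :=
    abv_mul_le hx (abv_sub_le hv.add_le (abv_sq_le hx) (abv_sq_le (abv_sq_le hx)))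
  have hy3 : v (y * (y ^ 2 + y + 1)) ≤ 1 :=
    abv_mul_le hy (abv_add_le hv.add_le (abv_add_le hv.add_le (abv_sq_le hy) hy) hone)
  have hprod : v (x * (x - 1)) < 1 := by
    -- both sides of the equation satisfy `c ^ 2 + c = 0` over `𝔽₄`, as `y` is in `𝔽₄`
    have hid : x * (x - 1) = (x ^ 4 - x) * (x ^ 2 + 1) - (y ^ 4 - y) +
        2 * (x * (x ^ 2 - (x ^ 2) ^ 2)) -
        2 * (y * (y ^ 2 + y + 1)) := by
      linear_combination (y ^ 2 + y + x ^ 3 - x ^ 2 + 1) * h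
    rw [hid]
    exact abv_sub_lt hv.add_le (abv_add_lt hv.add_le (abv_sub_lt hv.add_le
      (abv_mul_lt_left (hv.pow_four x hx) (abv_add_le hv.add_le (abv_sq_le hx) hone))
      (hv.pow_four y hy)) (abv_mul_lt_left hv.two_lt hx3)) (abv_mul_lt_left hv.two_lt hy3)
  rcases lt_or_ge (v x) 1 with hlt | hge
  · exact Or.inl (by rwa [sub_zero])
  · rw [map_mul, le_antisymm hx hge, one_mul] at hprod
    exact Or.inr hprod

variable [DecidableEq K]

lemma add_self_cases_curve11A3Over {x y : K} (h : (curve11A3Over K).Nonsingular x y) :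
    (2 * y + 1 = 0 ∧ Point.some x y h + Point.some x y h = 0) ∨
    ∃ x' y' h', Point.some x y h + Point.some x y h = Point.some x' y' h' ∧
      x' * (4 * x ^ 3 - 4 * x ^ 2 + 1) = x ^ 4 - 2 * x + 1 := by
  have heq := equation_curve11A3Over h.1
  rcases add_self_cases h with ⟨h0, h1⟩ | ⟨-, x', y', h', hadd, hx⟩
  · exact Or.inl ⟨by simpa using h0, h1⟩
  · refine Or.inr ⟨x', y', h', hadd, ?_⟩
    simp only [WeierstrassCurve.b₄, WeierstrassCurve.b₆, WeierstrassCurve.b₈] at hx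
    linear_combination hx - 4 * x' * heq

lemma xAbs_lt_curve11A3Over (hv : IsTwoAdic v) (R : (curve11A3Over K).Point) (h2 : R + R ≠ 0)
    (h : 1 < xAbs v _ 0 R) : xAbs v _ 0 R < xAbs v _ 0 (R + R) := by
  obtain _ | ⟨x, y, hxy⟩ := R
  · simp [xAbs] at h; linarith
  rcases add_self_cases_curve11A3Over hxy with ⟨-, h0⟩ | ⟨x', y', h', hadd, hx'⟩
  · exact absurd h0 h2
  rw [hadd]
  change 1 < v (x - 0) at h
  change v (x - 0) < v (x' - 0)
  simp only [sub_zero] at h ⊢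
  have hx4 : v (x ^ 4) = v x ^ 4 := map_pow _ _ _
  have hx3 : 1 < v x ^ 3 := one_lt_pow₀ h three_ne_zero
  have hnum : v (x ^ 4 + (1 - 2 * x)) = v x ^ 4 := by
    rw [abv_add_eq_left hv.add_le, hx4]
    rw [hx4]
    refine abv_sub_lt hv.add_le (by rw [map_one]; exact one_lt_pow₀ h four_ne_zero) ?_
    rw [map_mul]
    have := hv.two_lt
    nlinarith
  have hden : v (4 * (x ^ 3 - x ^ 2) + 1) < v x ^ 3 := by
    refine abv_add_lt hv.add_le ?_ (by rwa [map_one])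
    have h3 : v (x ^ 3 - x ^ 2) ≤ v x ^ 3 := by
      refine abv_sub_le hv.add_le (map_pow v x 3).le ?_
      rw [map_pow]
      exact pow_le_pow_right₀ h.le (by norm_num)
    rw [map_mul]
    have := hv.four_lt
    have := v.nonneg 4
    nlinarith
  have hprod := congrArg v hx'
  rw [show x ^ 4 - 2 * x + 1 = x ^ 4 + (1 - 2 * x) by ring, hnum, map_mul,
    show 4 * x ^ 3 - 4 * x ^ 2 + 1 = 4 * (x ^ 3 - x ^ 2) + 1 by ring] at hprod
  by_contra! hle
  have hx0 : 0 < v x := by linarith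
  have : v x' * v (4 * (x ^ 3 - x ^ 2) + 1) < v x * v x ^ 3 :=
    mul_lt_mul' hle hden (v.nonneg _) hx0
  nlinarith

lemma one_lt_xAbs_add (hv : IsTwoAdic v) {x y x' y' : K} (h : (curve11A3Over K).Nonsingular x y)
    (h' : (curve11A3Over K).Nonsingular x' y') (hx : v x ≤ 1) (hx' : v x' ≤ 1) (hne : x ≠ x')
    (hxx : v (x - x') < 1) (hyy : v (y - y') = 1) :
    1 < xAbs v _ 0 (Point.some x y h + Point.some x' y' h') := by
  have hone : v 1 ≤ 1 := v.map_one.le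
  have hl : 1 < v ((y - y') / (x - x')) := by
    rw [map_div₀, hyy]
    exact (one_lt_div (v.pos (sub_ne_zero.2 hne))).2 hxx
  rw [Point.add_of_X_ne hne]
  change 1 < v (addX _ x x' (slope _ x x' y y') - 0)
  rw [slope_of_X_ne hne, addX, show ((y - y') / (x - x')) ^ 2 + 0 * ((y - y') / (x - x')) - -1 - x -
    x' - 0 = ((y - y') / (x - x')) ^ 2 + (1 - x - x') by ring, abv_add_eq_left hv.add_le, map_pow]
  · exact one_lt_pow₀ hl two_ne_zero
  · rw [map_pow]
    exact (abv_sub_le hv.add_le (abv_sub_le hv.add_le hone hx) hx').trans_lt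
      (one_lt_pow₀ hl two_ne_zero)

/-- Two integral points with congruent `x`-coordinates, whose sum and difference are integral too,
are equal up to sign: otherwise, the line through one of them and plus or minus the other one has a
slope with a denominator. -/
lemma eq_or_eq_neg_of_lt (hv : IsTwoAdic v) {x y x' y' : K}
    (h : (curve11A3Over K).Nonsingular x y) (h' : (curve11A3Over K).Nonsingular x' y')
    (hadd : xAbs v _ 0 (Point.some x y h + Point.some x' y' h') ≤ 1)
    (hsub : xAbs v _ 0 (Point.some x y h - Point.some x' y' h') ≤ 1)
    (hx : v x ≤ 1) (hx' : v x' ≤ 1) (hy' : v y' ≤ 1) (hxx : v (x - x') < 1) :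
    Point.some x y h = Point.some x' y' h' ∨ Point.some x y h = -Point.some x' y' h' := by
  by_cases hne : x = x'
  · subst hne
    rcases Y_eq_of_X_eq h.1 h'.1 rfl with rfl | rfl
    · exact Or.inl rfl
    · exact Or.inr rfl
  exfalso
  have hprod : v ((y - y') * (y + y' + 1)) < 1 := by
    have h1 := equation_curve11A3Over h.1
    have h2 := equation_curve11A3Over h'.1
    rw [show (y - y') * (y + y' + 1) = (x - x') * (x ^ 2 + x * x' + x' ^ 2 - (x + x')) by
      linear_combination h1 - h2]
    exact abv_mul_lt_left hxx (abv_sub_le hv.add_le (abv_add_le hv.add_le (abv_add_le hv.add_le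
      (abv_sq_le hx) (abv_mul_le hx hx')) (abv_sq_le hx')) (abv_add_le hv.add_le hx hx'))
  have hunit : v (1 + 2 * y') = 1 := by
    rw [abv_add_eq_left hv.add_le, map_one]
    rw [map_one]
    exact abv_mul_lt_left hv.two_lt hy'
  rcases lt_or_ge (v (y - y')) 1 with hlt | hge
  · rw [sub_eq_add_neg, Point.neg_some] at hsub
    refine absurd hsub (not_le.2 (one_lt_xAbs_add hv _ _ hx hx' hne hxx ?_))
    rw [negY, show y - (-y' - 0 * x' - 1) = 1 + 2 * y' + (y - y') by ring,
      abv_add_eq_left hv.add_le, hunit]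
    rwa [hunit]
  · have hlt : v (y + y' + 1) < 1 := by
      rw [map_mul] at hprod
      nlinarith [v.nonneg (y + y' + 1)]
    refine absurd hadd (not_le.2 (one_lt_xAbs_add hv _ _ hx hx' hne hxx ?_))
    rw [v.map_sub, show y' - y = 1 + 2 * y' + -(y + y' + 1) by ring, abv_add_eq_left hv.add_le,
        hunit]
    rwa [v.map_neg, hunit]

/-- The torsion is generated by `(0, 0)`, of order `5`. -/
theorem torsion_curve11A3Over (hv : IsTwoAdic v) (hroot : ∀ t : K, t ^ 3 - 4 * t + 4 ≠ 0) :
    Nonempty (AddCommGroup.torsion (curve11A3Over K).Point ≃+ ZMod 5) := by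
  have h2tors : ∀ R : (curve11A3Over K).Point, R + R = 0 → R = 0 := by
    rintro (_ | ⟨x, y, h⟩) h0
    · rfl
    exfalso
    rcases add_self_cases_curve11A3Over h with ⟨h1, -⟩ | ⟨x', y', h', hadd, -⟩
    · have h2 : 4 * x ^ 3 - 4 * x ^ 2 + 1 = 0 := by
        linear_combination -4 * equation_curve11A3Over h.1 + (2 * y + 1) * h1
      have hx : x ≠ 0 := by
        rintro rfl
        simp at h2
      refine hroot x⁻¹ ?_
      field_simp
      linear_combination h2
    · rw [hadd] at h0
      exact Point.some_ne_zero h' h0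
  have hint : ∀ R ∈ AddCommGroup.torsion (curve11A3Over K).Point, xAbs v _ 0 R ≤ 1 := by
    intro R hR
    by_cases hR0 : R = 0
    · subst hR0
      exact zero_le_one
    obtain ⟨n, hn, hnR⟩ := isOfFinAddOrder_iff_nsmul_eq_zero.1 hR
    obtain ⟨k, m, hm, rfl⟩ := Nat.exists_eq_two_pow_mul_odd hn.ne'
    have hmR : m • R = 0 := by
      clear hn
      induction k with
      | zero => simpa using hnR
      | succ k ih => exact ih (h2tors _ (by rwa [← two_nsmul, ← mul_nsmul', ← mul_assoc,
          ← pow_succ']))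
    exact le_one_of_odd_order _ (fun S _ h2 h => xAbs_lt_curve11A3Over hv S h2 h) hm hmR hR0
  have hns : (curve11A3Over K).Nonsingular 0 0 := by
    rw [nonsingular_iff, equation_iff]
    simp
  obtain ⟨y₂, hy₂, hP2⟩ : ∃ y₂ h, Point.some 0 0 hns + Point.some 0 0 hns = Point.some 1 y₂ h := by
    rcases add_self_cases_curve11A3Over hns with ⟨h0, -⟩ | ⟨x', y', h', hadd, hx⟩
    · simp at h0
    · obtain rfl : x' = 1 := by linear_combination hx
      exact ⟨y', h', hadd⟩
  obtain ⟨y₄, hy₄, hP4⟩ : ∃ y₄ h, Point.some 1 y₂ hy₂ + Point.some 1 y₂ hy₂ =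
      Point.some 0 y₄ h := by
    rcases add_self_cases_curve11A3Over hy₂ with ⟨h0, h1⟩ | ⟨x', y', h', hadd, hx⟩
    · exact absurd (h2tors _ h1) (Point.some_ne_zero hy₂)
    · obtain rfl : x' = 0 := by linear_combination hx
      exact ⟨y', h', hadd⟩
  set P := Point.some 0 0 hns with hP
  have hP5 : 5 • P = 0 := by
    rw [← hP2] at hP4
    have h5 : 5 • P = P + P + (P + P) + P := by
      rw [show 5 = 2 + 2 + 1 from rfl, add_nsmul, add_nsmul, two_nsmul, one_nsmul]
    rcases Y_eq_of_X_eq hy₄.1 hns.1 rfl with rfl | rfl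
    · have h3 : P + P = -P := by
        rw [eq_neg_iff_add_eq_zero]
        rwa [← add_assoc, ← hP, add_eq_right] at hP4
      rw [hP2, hP, Point.neg_some] at h3
      exact absurd (Point.some.inj h3).1 one_ne_zero
    · rw [h5, hP4]
      exact neg_add_cancel P
  have hPtors : P ∈ AddCommGroup.torsion (curve11A3Over K).Point :=
    isOfFinAddOrder_iff_nsmul_eq_zero.2 ⟨5, by norm_num, hP5⟩
  have hle : AddCommGroup.torsion (curve11A3Over K).Point = AddSubgroup.zmultiples P := by
    refine le_antisymm ?_ (AddSubgroup.zmultiples_le.2 hPtors)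
    intro R hR
    rcases hRxy : R with _ | ⟨x, y, h⟩
    · exact zero_mem _
    have hmem : ∀ {x' y' : K} (h'), v x' ≤ 1 → v (x - x') < 1 →
        Point.some x' y' h' ∈ AddSubgroup.zmultiples P →
        Point.some x y h ∈ AddSubgroup.zmultiples P := by
      intro x' y' h' hx' hxx hQ
      have hQtors := AddSubgroup.zmultiples_le.2 hPtors hQ
      rw [hRxy] at hR
      have hx : v x ≤ 1 := by
        have := hint _ hR
        simpa [xAbs] using this
      rcases eq_or_eq_neg_of_lt hv h h' (hint _ (add_mem hR hQtors)) (hint _ (sub_mem hR hQtors)) hx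
        hx' (abv_y_le_one hv (equation_curve11A3Over h'.1) hx') hxx with heq | heq
      · rwa [heq]
      · rw [heq]
        exact neg_mem hQ
    have hx : v x ≤ 1 := by
      have := hint _ hR
      rw [hRxy] at this
      simpa [xAbs] using this
    rcases abv_lt_one_or hv (equation_curve11A3Over h.1) hx with hx0 | hx1
    · exact hmem hns (by simp) hx0 (AddSubgroup.mem_zmultiples P)
    · refine hmem hy₂ (by simp) hx1 ?_
      rw [← hP2]
      exact add_mem (AddSubgroup.mem_zmultiples P) (AddSubgroup.mem_zmultiples P)
  have h := nonempty_addEquiv_zmod hle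
  have : Fact (Nat.Prime 5) := ⟨Nat.prime_five⟩
  rwa [addOrderOf_eq_prime hP5 (Point.some_ne_zero hns)] at h

theorem torsion_curve11A3 [Algebra ℚ K] {d : ℤ} {s : K} (hd : Squarefree d) (hs : s ^ 2 = (d : K))
    (hK : IntermediateField.adjoin ℚ {s} = ⊤) : Nonempty (Torsion curve11A3 K ≃+ ZMod 5) := by
  obtain ⟨v, hv⟩ := exists_isTwoAdic hs hK
  have h : curve11A3.baseChange K = curve11A3Over K := by
    ext <;> simp [curve11A3]
  unfold Torsion
  rw [h]
  exact torsion_curve11A3Over hv (cubic_ne_zero_of_quadratic hd hs hK)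

end Curve11A3

end DynModCurve

theorem theorem3p4 {K : Type*} [Field K] [Algebra ℚ K] [DecidableEq K] (d : ℤ)
    (hd : Squarefree d) (s : K) (hs : s ^ 2 = (d : K))
    (hK : IntermediateField.adjoin ℚ {s} = ⊤) :
    -- 11A3
    ((DynModCurve.IsIsomorphicTo DynModCurve.graph8_11b DynModCurve.curve11A3 ∧
        DynModCurve.IsIsomorphicTo DynModCurve.graph8_2b DynModCurve.curve11A3) ∧
      Nonempty (DynModCurve.Torsion DynModCurve.curve11A3 K ≃+ ZMod 5)) ∧
    -- 15A8
    (DynModCurve.IsIsomorphicTo DynModCurve.graph10_211b DynModCurve.curve15A8 ∧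
      (d = -15 → Nonempty (DynModCurve.Torsion DynModCurve.curve15A8 K ≃+ ZMod 2 × ZMod 4)) ∧
      (d = -3 ∨ d = 5 → Nonempty (DynModCurve.Torsion DynModCurve.curve15A8 K ≃+ ZMod 8)) ∧
      (d ≠ -15 ∧ d ≠ -3 ∧ d ≠ 5 →
        Nonempty (DynModCurve.Torsion DynModCurve.curve15A8 K ≃+ ZMod 4))) ∧
    -- 17A4
    (DynModCurve.IsIsomorphicTo DynModCurve.graph10_211a DynModCurve.curve17A4 ∧
      (d = 17 → Nonempty (DynModCurve.Torsion DynModCurve.curve17A4 K ≃+ ZMod 2 × ZMod 4)) ∧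
      (d ≠ 17 → Nonempty (DynModCurve.Torsion DynModCurve.curve17A4 K ≃+ ZMod 4))) ∧
    -- 24A4
    (DynModCurve.IsIsomorphicTo DynModCurve.graph8_11a DynModCurve.curve24A4 ∧
      (d = -3 → Nonempty (DynModCurve.Torsion DynModCurve.curve24A4 K ≃+ ZMod 2 × ZMod 4)) ∧
      (d = -1 ∨ d = 3 → Nonempty (DynModCurve.Torsion DynModCurve.curve24A4 K ≃+ ZMod 8)) ∧
      (d ≠ -3 ∧ d ≠ -1 ∧ d ≠ 3 →
        Nonempty (DynModCurve.Torsion DynModCurve.curve24A4 K ≃+ ZMod 4))) ∧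
    -- 40A3
    (DynModCurve.IsIsomorphicTo DynModCurve.graph8_2a DynModCurve.curve40A3 ∧
      (d = 5 → Nonempty (DynModCurve.Torsion DynModCurve.curve40A3 K ≃+ ZMod 2 × ZMod 4)) ∧
      (d ≠ 5 → Nonempty (DynModCurve.Torsion DynModCurve.curve40A3 K ≃+ ZMod 4))) := by
  have h15 := DynModCurve.torsion_curve15A8 hd hs hK
  have h24 := DynModCurve.torsion_curve24A4 hd hs hK
  exact ⟨⟨⟨DynModCurve.graph8_11b_isIsomorphicTo, DynModCurve.graph8_2b_isIsomorphicTo⟩,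
    DynModCurve.torsion_curve11A3 hd hs hK⟩, ⟨DynModCurve.graph10_211b_isIsomorphicTo, h15⟩,
    ⟨DynModCurve.graph10_211a_isIsomorphicTo, DynModCurve.torsion_curve17A4 hd hs hK⟩,
    ⟨DynModCurve.graph8_11a_isIsomorphicTo, h24⟩,
    DynModCurve.graph8_2a_isIsomorphicTo, DynModCurve.torsion_curve40A3 hd hs hK⟩
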